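/- Let $n\ge 2$, let $M$ be a connected smooth $n$-manifold (without boundary, Hausdorff, second countable) and $f:M\to\mathbb{R}^{n+1}$ a smooth map. Call $f$ a \emph{frontal} if near each point there is a smooth map $\nu$ to the unit sphere $S^n\subset\mathbb{R}^{n+1}$ (the \emph{unit normal}) with $df(v)\cdot\nu=0$ for all tangent vectors $v$; the local normals are required to agree up to sign where they overlap, but $f$ need not be co-orientable. It is a \emph{front} if moreover $(f,\nu)$ is an immersion. A frontal is \emph{flat} if the connection $D$ on the bundle $\mathcal{E}_f=\nu^{\perp}$ given by $D_X\xi=d\xi(X)-(d\xi(X)\cdot\nu)\,\nu$ satisfies $$R^D(X,Y)\xi=D_XD_Y\xi-D_YD_X\xi-D_{[X,Y]}\xi=0$$ for all smooth (local) vector fields $X,Y$ and smooth (local) sections $\xi$ of $\mathcal{E}_f$. A front is \emph{weakly complete} if the Riemannian metric $df\cdot df+d\nu\cdot d\nu$ is complete. A point $p$ is \emph{umbilic} if $\delta_1(df)_p=\delta_2(d\nu)_p$ for some real $(\delta_1,\delta_2)\ne(0,0)$, and $f$ is \emph{totally umbilic} if every point is umbilic. (1) Let $f:M\to\mathbb{R}^{n+1}$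 be a weakly complete flat front which is not totally umbilic. Then for each non-umbilic point $q\in M$ there are an open interval $I\ni 0$, a diffeomorphism from $I\times\mathbb{R}^{n-1}$ onto an open neighbourhood of $q$ (with coordinates $t,w_2,\dots,w_n$), a smooth curve $\gamma:I\to S^n$ parametrized by arc length, a smooth orthonormal frame $\{e_2,\dots,e_n\}$ of the normal bundle $(\gamma')^{\perp}$ of $\gamma$ in $S^n$ (that is, for each $t$ the vectors $e_j(t)$ are orthonormal and orthogonal to $\gamma(t)$ and $\gamma'(t)$), a smooth function $a:I\to\mathbb{R}$ and a constant vector $c\in\mathbb{R}^{n+1}$ such that, in these coordinates, $$f(t,w_2,\dots,w_n)=c+\int_0^t a(\tau)\gamma'(\tau)\,d\tau+\sum_{j=2}^n w_j\,e_j(t)\qquad\text{on all of } I\times\mathbb{R}^{n-1}.\qquad(*)$$ (2) Conversely, let $I\ni0$ be an open interval, $\gamma:I\to S^n$ a smooth curve parametrized by arc length, $\{e_2,\dots,e_n\}$ a smooth orthonormal frame of the normal bundle $(\gamma')^{\perp}$ of $\gamma$ in $S^n$, $a:I\to\mathbb{R}$ a smooth function and $c\in\mathbb{R}^{n+1}$.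 Then the map $f:I\times\mathbb{R}^{n-1}\to\mathbb{R}^{n+1}$ defined by $(*)$ is a flat front without umbilic points (with respect to a suitable unit normal). -/

import Mathlib

open Set Filter Topology
open scoped Manifold ContDiff ENNReal

namespace FlatFront

section Fronts

variable (E : Type*) [NormedAddCommGroup E] [NormedSpace ℝ E]
  {M : Type*} [TopologicalSpace M] [ChartedSpace E M]
  {V : Type*} [NormedAddCommGroup V] [InnerProductSpace ℝ V]

/-- `ν` is a unit normal vector field of `f : M → V` on the open set `U`, given locally and hence
up to sign: for each `p ∈ U`, `ν p` is a smooth unit normal vector field of `f` defined on a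
neighbourhood `W` of `p`, and near each `q ∈ W` the local fields `ν p` and `ν q` agree up to sign.
(`f` is not assumed to be co-orientable. A globally defined unit normal field `ν₀` is the special
case `ν = fun _ ↦ ν₀`.) -/
def IsUnitNormalField (f : M → V) (U : Set M) (ν : M → M → V) : Prop :=
  ∀ p ∈ U, ∃ W : Set M, IsOpen W ∧ p ∈ W ∧ W ⊆ U ∧
    ContMDiffOn 𝓘(ℝ, E) 𝓘(ℝ, V) ∞ (ν p) W ∧
    (∀ q ∈ W, ‖ν p q‖ = 1) ∧
    (∀ q ∈ W, ∀ v : TangentSpace 𝓘(ℝ, E) q, inner ℝ (mvfderiv 𝓘(ℝ, E) f q v) (ν p q) = 0) ∧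
    ∀ q ∈ W, ν p =ᶠ[𝓝 q] ν q ∨ ν p =ᶠ[𝓝 q] fun x ↦ -ν q x

/-- The differential `dν` at `p` (well defined up to sign). -/
noncomputable def dGauss (ν : M → M → V) (p : M) : TangentSpace 𝓘(ℝ, E) p →L[ℝ] V :=
  mvfderiv 𝓘(ℝ, E) (ν p) p

/-- `f` is a frontal on the open set `U`, with unit normal vector field `ν`. -/
structure IsFrontal (f : M → V) (U : Set M) (ν : M → M → V) : Prop where
  smooth : ContMDiffOn 𝓘(ℝ, E) 𝓘(ℝ, V) ∞ f U
  normal : IsUnitNormalField E f U ν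

/-- `f` is a (wave) front on the open set `U`, with unit normal vector field `ν`:
the Legendrian lift `(f, ν)` is an immersion. -/
structure IsFront (f : M → V) (U : Set M) (ν : M → M → V) : Prop extends
    IsFrontal E f U ν where
  immersion : ∀ p ∈ U,
    Function.Injective (mvfderiv 𝓘(ℝ, E) (fun q ↦ ((f q, ν p q) : V × V)) p)

/-- `p` is an umbilic point: `δ₁ df = δ₂ dν` at `p` for some `(δ₁, δ₂) ≠ (0, 0)`. -/
def IsUmbilic (f : M → V) (ν : M → M → V) (p : M) : Prop :=
  ∃ δ₁ δ₂ : ℝ, (δ₁, δ₂) ≠ (0, 0) ∧ δ₁ • mvfderiv 𝓘(ℝ, E) f p = δ₂ • dGauss E ν p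

/-- The connection `D` of the coherent tangent bundle `𝓔_f = ν^⊥` induced by a frontal with unit
normal `ν`: the value `(D_X ξ)(p)` is the part of `dξ_p(X)` orthogonal to `ν`. -/
noncomputable def conn (ν : M → M → V) (X : ∀ p : M, TangentSpace 𝓘(ℝ, E) p) (ξ : M → V) (p : M) :
    V :=
  mvfderiv 𝓘(ℝ, E) ξ p (X p) - (inner ℝ (mvfderiv 𝓘(ℝ, E) ξ p (X p)) (ν p p) : ℝ) • ν p p

/-- The curvature `R^D(X, Y) ξ = D_X D_Y ξ - D_Y D_X ξ - D_{[X, Y]} ξ`. -/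
noncomputable def curv (ν : M → M → V) (X Y : ∀ p : M, TangentSpace 𝓘(ℝ, E) p) (ξ : M → V)
    (p : M) : V :=
  conn E ν X (conn E ν Y ξ) p - conn E ν Y (conn E ν X ξ) p
    - conn E ν (VectorField.mlieBracket 𝓘(ℝ, E) X Y) ξ p

variable [IsManifold 𝓘(ℝ, E) ∞ M]

/-- The induced coherent tangent bundle over the open set `U` is flat: `R^D(X, Y) ξ = 0` for all
smooth vector fields `X`, `Y` and smooth sections `ξ` of `𝓔_f = ν^⊥` on open subsets of `U`. -/
def IsFlat (U : Set M) (ν : M → M → V) : Prop :=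
  ∀ W ⊆ U, IsOpen W → ∀ (X Y : ∀ p : M, TangentSpace 𝓘(ℝ, E) p) (ξ : M → V),
    ContMDiffOn 𝓘(ℝ, E) 𝓘(ℝ, E).tangent ∞ (fun p ↦ (⟨p, X p⟩ : TangentBundle 𝓘(ℝ, E) M)) W →
    ContMDiffOn 𝓘(ℝ, E) 𝓘(ℝ, E).tangent ∞ (fun p ↦ (⟨p, Y p⟩ : TangentBundle 𝓘(ℝ, E) M)) W →
    ContMDiffOn 𝓘(ℝ, E) 𝓘(ℝ, V) ∞ ξ W →
    (∀ p ∈ W, inner ℝ (ξ p) (ν p p) = 0) →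
    ∀ p ∈ W, curv E ν X Y ξ p = 0

/-- `f` is a flat front on the open set `U`, with unit normal vector field `ν`. -/
structure IsFlatFront (f : M → V) (U : Set M) (ν : M → M → V) : Prop extends
    IsFront E f U ν where
  flat : IsFlat E U ν

/-- The norm of a tangent vector for the lift metric `ds²_# = df · df + dν · dν`. -/
noncomputable def liftNorm (f : M → V) (ν : M → M → V) (p : M) (v : TangentSpace 𝓘(ℝ, E) p) : ℝ :=
  √(‖mvfderiv 𝓘(ℝ, E) f p v‖ ^ 2 + ‖dGauss E ν p v‖ ^ 2)

/-- The Riemannian distance of the lift metric: the infimum of the lengths of `C¹` paths. -/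
noncomputable def liftDist (f : M → V) (ν : M → M → V) (p q : M) : ℝ≥0∞ :=
  letI : ∀ x : M, ENorm (TangentSpace 𝓘(ℝ, E) x) :=
    fun x ↦ ⟨fun v ↦ ENNReal.ofReal (liftNorm E f ν x v)⟩
  Manifold.riemannianEDist 𝓘(ℝ, E) p q

/-- `f` (with unit normal `ν`) is weakly complete: the lift metric is complete, that is, Cauchy
sequences for its Riemannian distance converge in `M`. -/
def IsWeaklyComplete (f : M → V) (ν : M → M → V) : Prop :=
  ∀ u : ℕ → M,
    (∀ ε : ℝ≥0∞, 0 < ε → ∃ N : ℕ, ∀ k ≥ N, ∀ l ≥ N, liftDist E f ν (u k) (u l) < ε) →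
    ∃ x : M, Tendsto u atTop (𝓝 x)

end Fronts

section Representation

variable {V : Type*} [NormedAddCommGroup V] [InnerProductSpace ℝ V]

/-- `γ` is a smooth curve in the unit sphere of `V`, defined on the open interval `I` and
parametrized by arc length, `e` is a smooth orthonormal frame, consisting of `m` vector fields
along `γ` tangent to the sphere and orthogonal to `γ'`, and `a` is a smooth function on `I`.
If `dim V = m + 2` then `e` is an orthonormal frame of the normal bundle `(γ')^⊥` of `γ` in the
sphere. -/
structure IsRepData {m : ℕ} (I : Set ℝ) (γ : ℝ → V) (e : Fin m → ℝ → V) (a : ℝ → ℝ) : Prop where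
  isOpen : IsOpen I
  ordConnected : I.OrdConnected
  zero_mem : (0 : ℝ) ∈ I
  smooth_curve : ContDiffOn ℝ ∞ γ I
  sphere : ∀ t ∈ I, ‖γ t‖ = 1
  arcLength : ∀ t ∈ I, ‖deriv γ t‖ = 1
  smooth_frame : ∀ j, ContDiffOn ℝ ∞ (e j) I
  orthonormal : ∀ t ∈ I, Orthonormal ℝ (fun j ↦ e j t)
  tangent_sphere : ∀ t ∈ I, ∀ j, inner ℝ (e j t) (γ t) = 0
  perp : ∀ t ∈ I, ∀ j, inner ℝ (e j t) (deriv γ t) = 0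
  smooth_fun : ContDiffOn ℝ ∞ a I

/-- The map `(t, w) ↦ ∫₀ᵗ a(τ) γ'(τ) dτ + ∑ j, w_j e_j(t)`. -/
noncomputable def repMap {m : ℕ} (γ : ℝ → V) (e : Fin m → ℝ → V) (a : ℝ → ℝ)
    (x : ℝ × EuclideanSpace ℝ (Fin m)) : V :=
  (∫ τ in (0 : ℝ)..x.1, a τ • deriv γ τ) + ∑ j, x.2 j • e j x.1

end Representation

end FlatFront

/-!
By the Gauss equation the curvature of `ν^⊥` is
`R^D(X, Y) ξ = ⟪ξ, dν(Y)⟫ dν(X) - ⟪ξ, dν(X)⟫ dν(Y)`, so a frontal is flat if and only if `dν` has rank at most one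
(`IsFlat.dGauss_rank_le_one`, `isFlat_of_rank_le_one`). For the map defined by a curve `γ` in the
sphere, with normal `γ`, this and the other assertions are a computation (`IsRepData.isFlatFront`,
`IsRepData.not_isUmbilic`).

Conversely, `dν` does not vanish at a non-umbilic point `q`. Near a point with `dν ≠ 0` the level
sets of a component `τ = ⟪ν, b⟫` of the normal form a foliation, the normal is a function `g` of
`τ`, and `f` maps the leaves into the affine subspaces `⟪y, g⟫ = h`, `⟪y, g'⟫ = h'` of codimension
two (`exists_local_product`). Let `γ` be `g`, reparametrized by arc length. A linear differential
equation provides an orthonormal frame `e` of `γ` in the sphere which is parallel, and a curve `A`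
with `A' = a γ'` that runs through these subspaces, so that `e` spans their directions
(`exists_isRepData`). This defines the surface `F(t, w) = A(t) + ∑ j, w_j e_j(t)`.

The `sheet` is the set of the points of `M` whose contact element `(f, ±ν)` is one of `F`, and it
is a neighbourhood of `q`. On its interior the coordinates `p = (t, w)` of the contact element are
smooth, and they are local diffeomorphisms because `(f, ν)` is an immersion
(`IsCurveParameter.exists_localInverse`). It remains to find a section of `p` over `I × ℝ^(n-1)`,
for a short interval `I`; its values over `w = 0` are given near `q`, and it is extended by
lifting the rays `r ↦ (t, r w)` (`exists_section`). The lift of a ray has constant speed for the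
lift metric, so by weak completeness it converges (`IsCurveParameter.exists_tendsto`). If `dν`
vanished at its end point `x` then `df` would be injective there; but the vectors along the lift
that correspond to `∂/∂t` have bounded images under `df` and unit images under `dν`, a
contradiction (`IsCurveParameter.exists_dGauss_ne_zero`). Hence a neighbourhood of `x` is again
foliated, the leaves near `x` are those which the sheet meets, and `x` belongs to the interior of
the sheet (`IsCurveParameter.mem_interior_sheet`). So the lift can be continued beyond `x`.
-/

namespace FlatFront

/-! ### Inverse functions -/

section Inverse

variable {F : Type*} [NormedAddCommGroup F] [NormedSpace ℝ F] [CompleteSpace F]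
  {G : Type*} [NormedAddCommGroup G] [NormedSpace ℝ G]

/-- The inverse function theorem for `C^∞` maps, with an inverse that is `C^∞` on its whole
domain. -/
theorem exists_openPartialHomeomorph_of_contDiffOn {g : F → G} {O : Set F} (hO : IsOpen O)
    {x : F} (hx : x ∈ O) (hg : ContDiffOn ℝ ∞ g O) (f' : F ≃L[ℝ] G)
    (hf' : HasFDerivAt g (f' : F →L[ℝ] G) x) :
    ∃ R : OpenPartialHomeomorph F G, x ∈ R.source ∧ R.source ⊆ O ∧ (R : F → G) = g ∧
      ContDiffOn ℝ ∞ R.symm R.target := by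
  have hgx : ContDiffAt ℝ ∞ g x := hg.contDiffAt (hO.mem_nhds hx)
  set R₀ := hgx.toOpenPartialHomeomorph g hf' (by simp) with hR₀
  set s : Set F := O ∩ fderiv ℝ g ⁻¹' range ((↑) : (F ≃L[ℝ] G) → F →L[ℝ] G) with hs
  have hso : IsOpen s :=
    (hg.continuousOn_fderiv_of_isOpen hO (by simp)).isOpen_inter_preimage hO
      ContinuousLinearEquiv.isOpen
  have hxs : x ∈ s := ⟨hx, f', hf'.fderiv.symm⟩
  refine ⟨R₀.restrOpen s hso, ?_, ?_, rfl, ?_⟩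
  · exact ⟨hgx.mem_toOpenPartialHomeomorph_source hf' (by simp), hxs⟩
  · intro y hy
    exact hy.2.1
  · intro y hy
    have hy' : (R₀.restrOpen s hso).symm y ∈ (R₀.restrOpen s hso).source :=
      (R₀.restrOpen s hso).map_target hy
    obtain ⟨hyO, e, he⟩ := hy'.2
    have hgy : ContDiffAt ℝ ∞ g ((R₀.restrOpen s hso).symm y) := hg.contDiffAt (hO.mem_nhds hyO)
    refine ((R₀.restrOpen s hso).contDiffAt_symm (f₀' := e) hy ?_ hgy).contDiffWithinAt
    have := (hgy.differentiableAt (by simp)).hasFDerivAt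
    rw [← he] at this
    exact this

/-- The inverse function theorem in one real variable. -/
theorem exists_openPartialHomeomorph_of_deriv_ne_zero {g : ℝ → ℝ} {O : Set ℝ} (hO : IsOpen O)
    {x : ℝ} (hx : x ∈ O) (hg : ContDiffOn ℝ ∞ g O) (hd : deriv g x ≠ 0) :
    ∃ R : OpenPartialHomeomorph ℝ ℝ, x ∈ R.source ∧ R.source ⊆ O ∧ (R : ℝ → ℝ) = g ∧
      ContDiffOn ℝ ∞ R.symm R.target := by
  have hgx : ContDiffAt ℝ ∞ g x := hg.contDiffAt (hO.mem_nhds hx)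
  have := (hgx.differentiableAt (by simp)).hasDerivAt
  exact exists_openPartialHomeomorph_of_contDiffOn hO hx hg
    (ContinuousLinearEquiv.unitsEquivAut ℝ (Units.mk0 _ hd)) (this.hasFDerivAt_equiv hd)

end Inverse

/-! ### Derivatives of vector valued functions on manifolds -/

section Manifolds

variable {E : Type*} [NormedAddCommGroup E] [NormedSpace ℝ E]
  {M : Type*} [TopologicalSpace M] [ChartedSpace E M]
  {V : Type*} [NormedAddCommGroup V] [NormedSpace ℝ V]
  {F : Type*} [NormedAddCommGroup F] [NormedSpace ℝ F]

theorem mvfderiv_eq_fderiv_chart {g : M → V} {x : M}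
    (hg : MDifferentiableAt 𝓘(ℝ, E) 𝓘(ℝ, V) g x) :
    mvfderiv 𝓘(ℝ, E) g x = fderiv ℝ (g ∘ (chartAt E x).symm) (chartAt E x x) := by
  rw [hg.mvfderiv]
  simp [writtenInExtChartAt, mfld_simps]
  rfl

theorem mvfderiv_vectorSpace (g : F → V) (x : F) :
    mvfderiv 𝓘(ℝ, F) g x = fderiv ℝ g x := by
  ext v
  simp [mvfderiv, mfderiv_eq_fderiv]
  rfl

theorem mvfderiv_congr {g g' : M → V} {x : M} (h : g =ᶠ[𝓝 x] g') :
    mvfderiv 𝓘(ℝ, E) g x = mvfderiv 𝓘(ℝ, E) g' x := by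
  ext v
  simp only [mvfderiv, ContinuousLinearMap.comp_apply]
  rw [h.mfderiv_eq]
  rfl

theorem fderiv_comp_mfderiv {h : F → M} {g : M → V} {z : F}
    (hg : MDifferentiableAt 𝓘(ℝ, E) 𝓘(ℝ, V) g (h z))
    (hh : MDifferentiableAt 𝓘(ℝ, F) 𝓘(ℝ, E) h z) (w : F) :
    fderiv ℝ (g ∘ h) z w = mvfderiv 𝓘(ℝ, E) g (h z) (mfderiv 𝓘(ℝ, F) 𝓘(ℝ, E) h z w) := by
  rw [← mfderiv_eq_fderiv]
  exact mfderiv_comp_apply (I' := 𝓘(ℝ, E)) z hg hh w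

theorem mvfderiv_comp_fderiv {G : Type*} [NormedAddCommGroup G] [NormedSpace ℝ G]
    {k : V → G} {g : M → V} {x : M} (hk : DifferentiableAt ℝ k (g x))
    (hg : MDifferentiableAt 𝓘(ℝ, E) 𝓘(ℝ, V) g x) (v : TangentSpace 𝓘(ℝ, E) x) :
    mvfderiv 𝓘(ℝ, E) (k ∘ g) x v = fderiv ℝ k (g x) (mvfderiv 𝓘(ℝ, E) g x v) := by
  rw [← mfderiv_eq_fderiv]
  exact mfderiv_comp_apply (I' := 𝓘(ℝ, V)) x hk.mdifferentiableAt hg v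

theorem mvfderiv_prodMk {G : Type*} [NormedAddCommGroup G] [NormedSpace ℝ G]
    {g : M → V} {k : M → G} {x : M} (hg : MDifferentiableAt 𝓘(ℝ, E) 𝓘(ℝ, V) g x)
    (hk : MDifferentiableAt 𝓘(ℝ, E) 𝓘(ℝ, G) k x) (v : TangentSpace 𝓘(ℝ, E) x) :
    mvfderiv 𝓘(ℝ, E) (fun y ↦ (g y, k y)) x v
      = (mvfderiv 𝓘(ℝ, E) g x v, mvfderiv 𝓘(ℝ, E) k x v) := by
  have h := hg.prodMk_space hk
  have h1 := mvfderiv_comp_fderiv (k := Prod.fst) differentiableAt_fst h v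
  have h2 := mvfderiv_comp_fderiv (k := Prod.snd) differentiableAt_snd h v
  rw [fderiv_fst] at h1
  rw [fderiv_snd] at h2
  exact Prod.ext h1.symm h2.symm

/-- A map into a vector space, of class `C^∞`, is `C^∞` in a chart. -/
theorem contDiffOn_comp_chart_symm [IsManifold 𝓘(ℝ, E) ∞ M] {g : M → V} {O : Set M}
    (hg : ContMDiffOn 𝓘(ℝ, E) 𝓘(ℝ, V) ∞ g O) (x : M) :
    ContDiffOn ℝ ∞ (g ∘ (chartAt E x).symm)
      ((chartAt E x).target ∩ (chartAt E x).symm ⁻¹' O) := by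
  rw [← contMDiffOn_iff_contDiffOn]
  exact hg.comp ((contMDiffOn_chart_symm (I := 𝓘(ℝ, E)) (x := x)).mono inter_subset_left)
    fun y hy ↦ hy.2

/-- The inverse function theorem for a map from a manifold to a vector space. -/
theorem exists_openPartialHomeomorph_of_contMDiffOn [CompleteSpace E] [FiniteDimensional ℝ E]
    [IsManifold 𝓘(ℝ, E) ∞ M]
    {g : M → F} {O : Set M} (hO : IsOpen O) {x : M} (hx : x ∈ O)
    (hg : ContMDiffOn 𝓘(ℝ, E) 𝓘(ℝ, F) ∞ g O)
    (hbij : Function.Bijective (mvfderiv 𝓘(ℝ, E) g x)) :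
    ∃ Q : OpenPartialHomeomorph M F, x ∈ Q.source ∧ Q.source ⊆ O ∧ EqOn Q g Q.source ∧
      ContMDiffOn 𝓘(ℝ, F) 𝓘(ℝ, E) ∞ Q.symm Q.target := by
  set φ := chartAt E x
  have hgx : MDifferentiableAt 𝓘(ℝ, E) 𝓘(ℝ, F) g x :=
    (hg.contMDiffAt (hO.mem_nhds hx)).mdifferentiableAt (by simp)
  have hopen : IsOpen (φ.target ∩ φ.symm ⁻¹' O) := φ.isOpen_inter_preimage_symm hO
  have hxφ : φ x ∈ φ.target ∩ φ.symm ⁻¹' O := by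
    refine ⟨mem_chart_target E x, ?_⟩
    simpa [φ] using hx
  have hsm := contDiffOn_comp_chart_symm hg x
  have hd := ((hsm.contDiffAt (hopen.mem_nhds hxφ)).differentiableAt (by simp)).hasFDerivAt
  rw [mvfderiv_eq_fderiv_chart hgx] at hbij
  let L : E ≃L[ℝ] F := (LinearEquiv.ofBijective
    (fderiv ℝ (g ∘ φ.symm) (φ x) : E →ₗ[ℝ] F) hbij).toContinuousLinearEquiv
  obtain ⟨R, hxR, hRO, hRg, hRs⟩ := exists_openPartialHomeomorph_of_contDiffOn hopen hxφ hsm L hd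
  refine ⟨φ.trans R, ?_, ?_, ?_, ?_⟩
  · exact ⟨mem_chart_source E x, hxR⟩
  · intro y hy
    have h1 := hRO hy.2
    have h2 : φ.symm (φ y) = y := φ.left_inv hy.1
    have h3 := h1.2
    simp only [mem_preimage] at h3
    exact h2 ▸ h3
  · intro y hy
    have h2 : φ.symm (φ y) = y := φ.left_inv hy.1
    change R (φ y) = g y
    rw [hRg, Function.comp_apply, h2]
  · rw [← contMDiffOn_iff_contDiffOn] at hRs
    exact (contMDiffOn_chart_symm (I := 𝓘(ℝ, E)) (x := x)).comp (hRs.mono fun y hy ↦ hy.1)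
      fun y hy ↦ hy.2

end Manifolds

/-! ### The curvature of the coherent tangent bundle -/

theorem minSmoothness_two_le : minSmoothness ℝ 2 ≤ (∞ : WithTop ℕ∞) := by
  rw [minSmoothness_of_isRCLikeNormedField]
  exact WithTop.coe_le_coe.2 (le_top : (2 : ℕ∞) ≤ ⊤)

section Curvature

variable {E : Type*} [NormedAddCommGroup E] [NormedSpace ℝ E]
  {M : Type*} [TopologicalSpace M] [ChartedSpace E M]
  {V : Type*} [NormedAddCommGroup V] [InnerProductSpace ℝ V]

/-- The part of `u` that is orthogonal to the unit vector `n`. -/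
noncomputable def tangentialPart (n u : V) : V := u - (inner ℝ u n : ℝ) • n

theorem tangentialPart_neg (n u : V) : tangentialPart (-n) u = tangentialPart n u := by
  simp [tangentialPart, inner_neg_right]

theorem hasFDerivAt_tangentialPart (z : V × V) :
    HasFDerivAt (fun y : V × V ↦ tangentialPart y.2 y.1)
      (ContinuousLinearMap.fst ℝ V V - ((inner ℝ z.1 z.2 : ℝ) • ContinuousLinearMap.snd ℝ V V +
        ((fderivInnerCLM ℝ z).comp
          ((ContinuousLinearMap.fst ℝ V V).prod (ContinuousLinearMap.snd ℝ V V))).smulRight z.2))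
      z := by
  have h1 : HasFDerivAt (fun y : V × V ↦ y.1) (ContinuousLinearMap.fst ℝ V V) z := hasFDerivAt_fst
  have h2 : HasFDerivAt (fun y : V × V ↦ y.2) (ContinuousLinearMap.snd ℝ V V) z := hasFDerivAt_snd
  exact h1.sub ((h1.inner ℝ h2).smul h2)

theorem inner_mvfderiv_eq_neg {g k : M → V} {p : M} (h : ∀ᶠ q in 𝓝 p, inner ℝ (g q) (k q) = (0 : ℝ))
    (hg : MDifferentiableAt 𝓘(ℝ, E) 𝓘(ℝ, V) g p) (hk : MDifferentiableAt 𝓘(ℝ, E) 𝓘(ℝ, V) k p)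
    (v : TangentSpace 𝓘(ℝ, E) p) :
    inner ℝ (mvfderiv 𝓘(ℝ, E) g p v) (k p) = -(inner ℝ (g p) (mvfderiv 𝓘(ℝ, E) k p v) : ℝ) := by
  have h1 : HasFDerivAt (fun y : V × V ↦ (inner ℝ y.1 y.2 : ℝ)) _ (g p, k p) :=
    (hasFDerivAt_fst (𝕜 := ℝ) (E := V) (F := V)).inner ℝ hasFDerivAt_snd
  have h2 := mvfderiv_comp_fderiv (k := fun y : V × V ↦ (inner ℝ y.1 y.2 : ℝ))
    (g := fun q ↦ (g q, k q)) h1.differentiableAt (hg.prodMk_space hk) v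
  have h3 : (fun y : V × V ↦ (inner ℝ y.1 y.2 : ℝ)) ∘ (fun q ↦ (g q, k q)) =ᶠ[𝓝 p] fun _ ↦ 0 := h
  rw [mvfderiv_congr h3, mvfderiv_const, h1.fderiv, mvfderiv_prodMk hg hk] at h2
  simp [fderivInnerCLM_apply] at h2
  linarith

theorem inner_mvfderiv_self {N : M → V} {p : M} (hN1 : ∀ᶠ q in 𝓝 p, ‖N q‖ = 1)
    (hN : MDifferentiableAt 𝓘(ℝ, E) 𝓘(ℝ, V) N p) (v : TangentSpace 𝓘(ℝ, E) p) :
    inner ℝ (mvfderiv 𝓘(ℝ, E) N p v) (N p) = (0 : ℝ) := by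
  have h0 : HasFDerivAt (fun y : V ↦ (inner ℝ y y : ℝ)) _ (N p) :=
    (hasFDerivAt_id (𝕜 := ℝ) (N p)).inner ℝ (hasFDerivAt_id (N p))
  have h2 := mvfderiv_comp_fderiv (k := fun y : V ↦ (inner ℝ y y : ℝ)) h0.differentiableAt hN v
  have h3 : (fun y : V ↦ (inner ℝ y y : ℝ)) ∘ N =ᶠ[𝓝 p] fun _ ↦ 1 := by
    filter_upwards [hN1] with q hq
    simp [hq]
  rw [mvfderiv_congr h3, mvfderiv_const, h0.fderiv] at h2
  simp [fderivInnerCLM_apply] at h2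
  have h4 := real_inner_comm (N p) (mvfderiv 𝓘(ℝ, E) N p v)
  linarith

/-- The Gauss formula: `D_X D_Y ξ` is the tangential part of the second derivative of `ξ`, minus
the normal component `-⟪ξ, dN(Y)⟫` of `dξ(Y)` times `dN(X)`. The tangential part is an even
function of the normal, so that a smooth local unit normal `N` may replace `ν`. -/
theorem conn_conn_apply {ν : M → M → V} {N : M → V} {p : M}
    (hν : ∀ᶠ q in 𝓝 p, ν q q = N q ∨ ν q q = -N q)
    (hN : MDifferentiableAt 𝓘(ℝ, E) 𝓘(ℝ, V) N p) (hN1 : ∀ᶠ q in 𝓝 p, ‖N q‖ = 1)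
    {X Y : ∀ p : M, TangentSpace 𝓘(ℝ, E) p} {ξ : M → V}
    (hξ : MDifferentiableAt 𝓘(ℝ, E) 𝓘(ℝ, V) ξ p)
    (hξN : ∀ᶠ q in 𝓝 p, inner ℝ (ξ q) (N q) = (0 : ℝ))
    (hη : MDifferentiableAt 𝓘(ℝ, E) 𝓘(ℝ, V) (fun q ↦ mvfderiv 𝓘(ℝ, E) ξ q (Y q)) p) :
    conn E ν X (conn E ν Y ξ) p =
      tangentialPart (N p) (mvfderiv 𝓘(ℝ, E) (fun q ↦ mvfderiv 𝓘(ℝ, E) ξ q (Y q)) p (X p)) +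
      (inner ℝ (ξ p) (mvfderiv 𝓘(ℝ, E) N p (Y p)) : ℝ) • mvfderiv 𝓘(ℝ, E) N p (X p) := by
  set η : M → V := fun q ↦ mvfderiv 𝓘(ℝ, E) ξ q (Y q) with hη_def
  have hconn : ∀ (Z : ∀ p : M, TangentSpace 𝓘(ℝ, E) p) (ζ : M → V),
      ∀ᶠ q in 𝓝 p, conn E ν Z ζ q = tangentialPart (N q) (mvfderiv 𝓘(ℝ, E) ζ q (Z q)) := by
    intro Z ζ
    filter_upwards [hν] with q hq
    change tangentialPart (ν q q) _ = _
    rcases hq with hq | hq <;> rw [hq]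
    rw [tangentialPart_neg]
  have e1 : conn E ν Y ξ =ᶠ[𝓝 p] (fun y : V × V ↦ tangentialPart y.2 y.1) ∘ fun q ↦ (η q, N q) :=
    hconn Y ξ
  have hNN : inner ℝ (mvfderiv 𝓘(ℝ, E) N p (X p)) (N p) = (0 : ℝ) :=
    inner_mvfderiv_self hN1 hN (X p)
  have hn1 : inner ℝ (N p) (N p) = (1 : ℝ) := by
    rw [real_inner_self_eq_norm_sq, hN1.self_of_nhds, one_pow]
  have hηN : inner ℝ (η p) (N p) = -(inner ℝ (ξ p) (mvfderiv 𝓘(ℝ, E) N p (Y p)) : ℝ) :=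
    inner_mvfderiv_eq_neg hξN hξ hN (Y p)
  rw [(hconn X _).self_of_nhds, mvfderiv_congr e1,
    mvfderiv_comp_fderiv (hasFDerivAt_tangentialPart _).differentiableAt (hη.prodMk_space hN),
    (hasFDerivAt_tangentialPart _).fderiv, mvfderiv_prodMk hη hN]
  simp only [tangentialPart, sub_apply, add_apply, FunLike.coe_smul, Pi.smul_apply,
    ContinuousLinearMap.smulRight_apply,
    ContinuousLinearMap.coe_fst', ContinuousLinearMap.coe_snd', inner_sub_left, inner_add_left,
    real_inner_smul_left, hn1, hNN, hηN]
  module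

end Curvature

section Flat

variable {E : Type*} [NormedAddCommGroup E] [NormedSpace ℝ E] [CompleteSpace E]
  {M : Type*} [TopologicalSpace M] [ChartedSpace E M] [IsManifold 𝓘(ℝ, E) ∞ M]
  {V : Type*} [NormedAddCommGroup V] [InnerProductSpace ℝ V]

/-- Coordinate vector fields: a chart pulls constant vector fields back to smooth vector fields that
commute at the centre of the chart, and whose second derivatives commute there. -/
theorem exists_commuting_vectorField (p : M) (v w : TangentSpace 𝓘(ℝ, E) p) :
    ∃ X Y : ∀ p : M, TangentSpace 𝓘(ℝ, E) p, X p = v ∧ Y p = w ∧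
      ContMDiffOn 𝓘(ℝ, E) 𝓘(ℝ, E).tangent ∞ (fun p ↦ (⟨p, X p⟩ : TangentBundle 𝓘(ℝ, E) M))
        (chartAt E p).source ∧
      ContMDiffOn 𝓘(ℝ, E) 𝓘(ℝ, E).tangent ∞ (fun p ↦ (⟨p, Y p⟩ : TangentBundle 𝓘(ℝ, E) M))
        (chartAt E p).source ∧
      VectorField.mlieBracket 𝓘(ℝ, E) X Y p = 0 ∧
      ∀ (ξ : M → V) (O : Set M), IsOpen O → p ∈ O → ContMDiffOn 𝓘(ℝ, E) 𝓘(ℝ, V) ∞ ξ O →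
        MDifferentiableAt 𝓘(ℝ, E) 𝓘(ℝ, V) (fun q ↦ mvfderiv 𝓘(ℝ, E) ξ q (X q)) p ∧
        MDifferentiableAt 𝓘(ℝ, E) 𝓘(ℝ, V) (fun q ↦ mvfderiv 𝓘(ℝ, E) ξ q (Y q)) p ∧
        mvfderiv 𝓘(ℝ, E) (fun q ↦ mvfderiv 𝓘(ℝ, E) ξ q (Y q)) p v =
          mvfderiv 𝓘(ℝ, E) (fun q ↦ mvfderiv 𝓘(ℝ, E) ξ q (X q)) p w := by
  set φ : M → E := fun q ↦ extChartAt 𝓘(ℝ, E) p q with hφ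
  have hps : p ∈ (chartAt E p).source := mem_chart_source E p
  have hinv : ∀ q ∈ (chartAt E p).source, (mfderiv 𝓘(ℝ, E) 𝓘(ℝ, E) φ q).IsInvertible :=
    fun q hq ↦ isInvertible_mfderiv_extChartAt (by simpa [mfld_simps] using hq)
  have hφs : ∀ q ∈ (chartAt E p).source, ContMDiffAt 𝓘(ℝ, E) 𝓘(ℝ, E) ∞ φ q :=
    fun q hq ↦ contMDiffAt_extChartAt' hq
  let D (u : E) : ∀ p : E, TangentSpace 𝓘(ℝ, E) p := fun _ ↦ u
  have hD : ∀ (u : E) (z : E), ContMDiffAt 𝓘(ℝ, E) 𝓘(ℝ, E).tangent ∞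
      (fun p ↦ (⟨p, D u p⟩ : TangentBundle 𝓘(ℝ, E) E)) z := fun u z ↦ by
    rw [contMDiffAt_vectorSpace_iff_contDiffAt]
    exact contDiffAt_const
  let P (u : E) : ∀ p : M, TangentSpace 𝓘(ℝ, E) p :=
    VectorField.mpullback 𝓘(ℝ, E) 𝓘(ℝ, E) φ (D u)
  have hφP : ∀ u, ∀ q ∈ (chartAt E p).source, mfderiv 𝓘(ℝ, E) 𝓘(ℝ, E) φ q (P u q) = u := by
    intro u q hq
    exact (hinv q hq).self_apply_inverse _
  have hPs : ∀ u, ContMDiffOn 𝓘(ℝ, E) 𝓘(ℝ, E).tangent ∞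
      (fun p ↦ (⟨p, P u p⟩ : TangentBundle 𝓘(ℝ, E) M)) (chartAt E p).source := by
    intro u q hq
    exact (ContMDiffAt.mpullback_vectorField_preimage (hD u (φ q)) (hφs q hq) (hinv q hq)
      (by simp)).contMDiffWithinAt
  have hPp : ∀ u : TangentSpace 𝓘(ℝ, E) p, P (mfderiv 𝓘(ℝ, E) 𝓘(ℝ, E) φ p u) p = u :=
    fun u ↦ (hinv p hps).inverse_apply_self u
  set a : E := mfderiv 𝓘(ℝ, E) 𝓘(ℝ, E) φ p v with ha
  set b : E := mfderiv 𝓘(ℝ, E) 𝓘(ℝ, E) φ p w with hb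
  refine ⟨P a, P b, hPp v, hPp w, hPs a, hPs b, ?_, ?_⟩
  · have : IsManifold 𝓘(ℝ, E) (minSmoothness ℝ 2) M := .of_le minSmoothness_two_le
    have h := VectorField.mpullback_mlieBracket (f := φ) (x₀ := p) (V := D a) (W := D b)
      ((hD a _).mdifferentiableAt (by simp)) ((hD b _).mdifferentiableAt (by simp))
      (hφs p hps) minSmoothness_two_le
    rw [← h, VectorField.mpullback_apply]
    have h0 : VectorField.mlieBracket 𝓘(ℝ, E) (D a) (D b) (φ p) = 0 := by
      rw [← VectorField.mlieBracketWithin_univ, VectorField.mlieBracketWithin_eq_lieBracketWithin]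
      simp only [VectorField.lieBracketWithin, D]
      simp
      rfl
    rw [h0, map_zero]
  · intro ξ O hO hp hξ
    set ψ := (chartAt E p).symm with hψ
    have hopen := (chartAt E p).isOpen_inter_preimage_symm hO
    have hsm := contDiffOn_comp_chart_symm hξ p
    have hφp : φ p ∈ (chartAt E p).target ∩ ψ ⁻¹' O := by
      refine ⟨by simp [hφ, mfld_simps], ?_⟩
      simpa [hφ, hψ, mfld_simps] using hp
    have hnhds := hopen.mem_nhds hφp
    have hloc : ∀ u, (fun q ↦ mvfderiv 𝓘(ℝ, E) ξ q (P u q)) =ᶠ[𝓝 p]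
        (fun z ↦ fderiv ℝ (ξ ∘ ψ) z u) ∘ φ := by
      intro u
      filter_upwards [(chartAt E p).open_source.mem_nhds hps, hO.mem_nhds hp] with q hq hqO
      have e : (ξ ∘ ψ) ∘ φ =ᶠ[𝓝 q] ξ := by
        filter_upwards [(chartAt E p).open_source.mem_nhds hq] with y hy
        simp only [Function.comp_apply, hφ, hψ]
        congr 1
        simpa [mfld_simps] using (chartAt E p).left_inv hy
      have hφq : φ q ∈ (chartAt E p).target ∩ ψ ⁻¹' O := by
        have : φ q = chartAt E p q := by simp [hφ, mfld_simps]
        rw [this]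
        refine ⟨(chartAt E p).map_source hq, ?_⟩
        simpa [hψ, (chartAt E p).left_inv hq] using hqO
      have hd : DifferentiableAt ℝ (ξ ∘ ψ) (φ q) :=
        (hsm.contDiffAt (hopen.mem_nhds hφq)).differentiableAt (by simp)
      have h1 := mvfderiv_comp_fderiv (k := ξ ∘ ψ) (g := φ) hd
        ((hφs q hq).mdifferentiableAt (by simp)) (P u q)
      rw [mvfderiv_congr e] at h1
      rw [h1]
      change fderiv ℝ (ξ ∘ ψ) (φ q) (mfderiv 𝓘(ℝ, E) 𝓘(ℝ, E) φ q (P u q)) = _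
      rw [hφP u q hq]
      rfl
    have hct : ContDiffAt ℝ ∞ (ξ ∘ ψ) (φ p) := hsm.contDiffAt hnhds
    have hdd : DifferentiableAt ℝ (fderiv ℝ (ξ ∘ ψ)) (φ p) :=
      (hct.fderiv_right (m := ∞) (by simp)).differentiableAt (by simp)
    have hdu : ∀ u, HasFDerivAt (fun z ↦ fderiv ℝ (ξ ∘ ψ) z u)
        ((ContinuousLinearMap.apply ℝ V u).comp (fderiv ℝ (fderiv ℝ (ξ ∘ ψ)) (φ p))) (φ p) :=
      fun u ↦ (ContinuousLinearMap.apply ℝ V u).hasFDerivAt.comp (φ p) hdd.hasFDerivAt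
    have hφd : MDifferentiableAt 𝓘(ℝ, E) 𝓘(ℝ, E) φ p := (hφs p hps).mdifferentiableAt (by simp)
    have hdiff : ∀ u, MDifferentiableAt 𝓘(ℝ, E) 𝓘(ℝ, V)
        (fun q ↦ mvfderiv 𝓘(ℝ, E) ξ q (P u q)) p := fun u ↦
      (MDifferentiableAt.comp p (hdu u).differentiableAt.mdifferentiableAt
        hφd).congr_of_eventuallyEq (hloc u)
    refine ⟨hdiff a, hdiff b, ?_⟩
    rw [mvfderiv_congr (hloc a), mvfderiv_congr (hloc b),
      mvfderiv_comp_fderiv (hdu a).differentiableAt hφd,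
      mvfderiv_comp_fderiv (hdu b).differentiableAt hφd, (hdu a).fderiv, (hdu b).fderiv]
    have hs : IsSymmSndFDerivAt ℝ (ξ ∘ ψ) (φ p) := hct.isSymmSndFDerivAt (minSmoothness_two_le)
    exact hs.eq a b

/-- If the curvature of `ν^⊥` vanishes then `dν` has rank at most one: by the Gauss equation
`R^D(X, Y) ξ = ⟪ξ, dν(Y)⟫ dν(X) - ⟪ξ, dν(X)⟫ dν(Y)`, to be applied to a section `ξ` that takes the
value `dν(X)` at the given point. -/
theorem IsFlat.dGauss_rank_le_one {f : M → V} {U : Set M} {ν : M → M → V}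
    (hflat : IsFlat E U ν) (hν : IsUnitNormalField E f U ν) {p : M} (hp : p ∈ U)
    (v w : TangentSpace 𝓘(ℝ, E) p) :
    (inner ℝ (dGauss E ν p v) (dGauss E ν p w) : ℝ) • dGauss E ν p v =
      (inner ℝ (dGauss E ν p v) (dGauss E ν p v) : ℝ) • dGauss E ν p w := by
  obtain ⟨W, hW, hpW, hWU, hsm, hunit, -, hsign⟩ := hν p hp
  obtain ⟨X, Y, hX, hY, hXs, hYs, hXY, hsymm⟩ :=
    exists_commuting_vectorField (V := V) p v w
  set N := ν p with hN
  set O := W ∩ (chartAt E p).source with hO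
  have hOo : IsOpen O := hW.inter (chartAt E p).open_source
  have hpO : p ∈ O := ⟨hpW, mem_chart_source E p⟩
  set x₀ := dGauss E ν p v with hx₀
  -- a section of `ν^⊥` through `x₀`, which is orthogonal to `N p` already
  set ξ : M → V := fun q ↦ tangentialPart (N q) x₀ with hξ
  have hξs : ContMDiffOn 𝓘(ℝ, E) 𝓘(ℝ, V) ∞ ξ W := by
    have : ContDiff ℝ ∞ (fun y : V ↦ tangentialPart y x₀) := by
      unfold tangentialPart
      exact contDiff_const.sub ((contDiff_const.inner ℝ contDiff_id).smul contDiff_id)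
    exact this.contMDiff.comp_contMDiffOn hsm
  have hsg : ∀ q ∈ W, ν q q = N q ∨ ν q q = -N q := by
    intro q hq
    rcases hsign q hq with h | h
    · exact Or.inl h.self_of_nhds.symm
    · right
      rw [h.self_of_nhds, neg_neg]
  have hξN : ∀ q ∈ W, inner ℝ (ξ q) (N q) = (0 : ℝ) := by
    intro q hq
    simp [hξ, tangentialPart, inner_sub_left, real_inner_smul_left, hunit q hq]
  have hWn := hW.mem_nhds hpW
  have hNd : MDifferentiableAt 𝓘(ℝ, E) 𝓘(ℝ, V) N p :=
    (hsm.contMDiffAt hWn).mdifferentiableAt (by simp)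
  have hξd : MDifferentiableAt 𝓘(ℝ, E) 𝓘(ℝ, V) ξ p :=
    (hξs.contMDiffAt hWn).mdifferentiableAt (by simp)
  obtain ⟨hdX, hdY, hs⟩ := hsymm ξ W hW hpW hξs
  have hc := hflat O (fun q hq ↦ hWU hq.1) hOo X Y ξ (hXs.mono inter_subset_right)
    (hYs.mono inter_subset_right) (hξs.mono inter_subset_left) (by
      intro q hq
      rcases hsg q hq.1 with h | h
      · rw [h, hξN q hq.1]
      · rw [h, inner_neg_right, hξN q hq.1, neg_zero]) p hpO
  have hev1 : ∀ᶠ q in 𝓝 p, ν q q = N q ∨ ν q q = -N q := by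
    filter_upwards [hWn] using hsg
  have hev2 : ∀ᶠ q in 𝓝 p, ‖N q‖ = 1 := by
    filter_upwards [hWn] using hunit
  have hev3 : ∀ᶠ q in 𝓝 p, inner ℝ (ξ q) (N q) = (0 : ℝ) := by
    filter_upwards [hWn] using hξN
  have hx₀N : inner ℝ x₀ (N p) = (0 : ℝ) := inner_mvfderiv_self hev2 hNd v
  have hξp : ξ p = x₀ := by simp [hξ, tangentialPart, hx₀N]
  unfold curv at hc
  rw [conn_conn_apply hev1 hNd hev2 hξd hev3 hdY, conn_conn_apply hev1 hNd hev2 hξd hev3 hdX] at hc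
  have hbr : conn E ν (VectorField.mlieBracket 𝓘(ℝ, E) X Y) ξ p = 0 := by
    simp [conn, hXY]
  rw [hbr, hX, hY, hs, hξp, sub_zero, add_sub_add_left_eq_sub] at hc
  exact sub_eq_zero.mp hc

end Flat

section VectorSpace

variable {E : Type*} [NormedAddCommGroup E] [NormedSpace ℝ E]
  {V : Type*} [NormedAddCommGroup V] [InnerProductSpace ℝ V]

/-- A globally defined unit normal field with differential of rank at most one has flat orthogonal
complement: both terms of the Gauss equation are then `l X * l Y * ⟪ξ, b⟫` times `b`. -/
theorem isFlat_of_rank_le_one {U : Set E} (hU : IsOpen U) {N : E → V}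
    (hN : ContDiffOn ℝ ∞ N U) (hunit : ∀ x ∈ U, ‖N x‖ = 1)
    (hrank : ∀ x ∈ U, ∃ (l : E →ₗ[ℝ] ℝ) (b : V), ∀ v, fderiv ℝ N x v = l v • b) :
    IsFlat E U (fun _ : E ↦ N) := by
  intro W hWU hW X Y ξ hX hY hξ hξN p hp
  have hWn := hW.mem_nhds hp
  rw [contMDiffOn_vectorSpace_iff_contDiffOn] at hX hY
  rw [contMDiffOn_iff_contDiffOn] at hξ
  have hXd : DifferentiableAt ℝ X p := (hX.contDiffAt hWn).differentiableAt (by simp)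
  have hYd : DifferentiableAt ℝ Y p := (hY.contDiffAt hWn).differentiableAt (by simp)
  have hξc := hξ.contDiffAt hWn
  have hξd : DifferentiableAt ℝ ξ p := hξc.differentiableAt (by simp)
  have hdd : DifferentiableAt ℝ (fderiv ℝ ξ) p :=
    (hξc.fderiv_right (m := ∞) (by simp)).differentiableAt (by simp)
  have hNd : DifferentiableAt ℝ N p :=
    (hN.contDiffAt (hU.mem_nhds (hWU hp))).differentiableAt (by simp)
  have hη : ∀ Z : E → E, DifferentiableAt ℝ Z p →
      HasFDerivAt (fun q ↦ fderiv ℝ ξ q (Z q))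
        ((fderiv ℝ ξ p).comp (fderiv ℝ Z p) + (fderiv ℝ (fderiv ℝ ξ) p).flip (Z p)) p :=
    fun Z hZ ↦ hdd.hasFDerivAt.clm_apply hZ.hasFDerivAt
  have hηm : ∀ Z : E → E, (fun q ↦ mvfderiv 𝓘(ℝ, E) ξ q (Z q)) = fun q ↦ fderiv ℝ ξ q (Z q) := by
    intro Z
    funext q
    rw [mvfderiv_vectorSpace]
    rfl
  have hconn := fun (X Y : E → E) (hYd : DifferentiableAt ℝ Y p) ↦
    conn_conn_apply (E := E) (ν := fun _ : E ↦ N) (N := N) (p := p) (X := X) (Y := Y) (ξ := ξ)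
      (.of_forall fun _ ↦ Or.inl rfl) hNd.mdifferentiableAt
      (by filter_upwards [hWn] with q hq using hunit q (hWU hq)) hξd.mdifferentiableAt
      (by filter_upwards [hWn] with q hq using hξN q hq)
      (by rw [hηm Y]; exact (hη Y hYd).differentiableAt.mdifferentiableAt)
  obtain ⟨l, b, hl⟩ := hrank p (hWU hp)
  have hbr : VectorField.mlieBracket 𝓘(ℝ, E) X Y p = fderiv ℝ Y p (X p) - fderiv ℝ X p (Y p) := by
    rw [← VectorField.mlieBracketWithin_univ, VectorField.mlieBracketWithin_eq_lieBracketWithin]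
    change fderivWithin ℝ (Y : E → E) univ p (X p) - fderivWithin ℝ (X : E → E) univ p (Y p) = _
    have hu : ∀ Z : E → E, fderivWithin ℝ Z univ p = fderiv ℝ Z p := fun Z ↦
      congrFun fderivWithin_univ p
    exact congrArg₂ (fun a b : E ↦ a - b) (congrArg (fun L : E →L[ℝ] E ↦ L (X p)) (hu Y))
      (congrArg (fun L : E →L[ℝ] E ↦ L (Y p)) (hu X))
  have hs : IsSymmSndFDerivAt ℝ ξ p := hξc.isSymmSndFDerivAt (minSmoothness_two_le)
  have hbc : conn E (fun _ : E ↦ N) (VectorField.mlieBracket 𝓘(ℝ, E) X Y) ξ p =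
      tangentialPart (N p) (fderiv ℝ ξ p (fderiv ℝ Y p (X p) - fderiv ℝ X p (Y p))) := by
    unfold conn
    rw [hbr, mvfderiv_vectorSpace]
    rfl
  have h1 : mvfderiv 𝓘(ℝ, E) (fun q ↦ mvfderiv 𝓘(ℝ, E) ξ q (Y q)) p (X p) =
      fderiv ℝ ξ p (fderiv ℝ Y p (X p)) + fderiv ℝ (fderiv ℝ ξ) p (X p) (Y p) := by
    rw [hηm Y, mvfderiv_vectorSpace, (hη Y hYd).fderiv]
    rfl
  have h2 : mvfderiv 𝓘(ℝ, E) (fun q ↦ mvfderiv 𝓘(ℝ, E) ξ q (X q)) p (Y p) =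
      fderiv ℝ ξ p (fderiv ℝ X p (Y p)) + fderiv ℝ (fderiv ℝ ξ) p (X p) (Y p) := by
    rw [hηm X, mvfderiv_vectorSpace, (hη X hXd).fderiv, hs.eq (X p) (Y p)]
    rfl
  have h3 : ∀ v : E, mvfderiv 𝓘(ℝ, E) N p v = l v • b := by
    intro v
    rw [mvfderiv_vectorSpace]
    exact hl v
  unfold curv
  have hX' := h3 (X p)
  have hY' := h3 (Y p)
  rw [hconn X Y hYd, hconn Y X hXd, hbc, h1, h2, hX', hY']
  simp only [map_sub, tangentialPart, inner_sub_left, inner_add_left, real_inner_smul_right]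
  module

end VectorSpace

/-! ### The map defined by a curve in the sphere -/

section RepMap

variable {V : Type*} [NormedAddCommGroup V] [InnerProductSpace ℝ V] {m : ℕ} {I : Set ℝ} {γ : ℝ → V}
  {e : Fin m → ℝ → V} {a : ℝ → ℝ}

theorem contDiffOn_deriv {g : ℝ → V} (hI : IsOpen I) (hg : ContDiffOn ℝ ∞ g I) :
    ContDiffOn ℝ ∞ (deriv g) I :=
  ((contDiffOn_infty_iff_deriv_of_isOpen hI).1 hg).2

theorem hasDerivAt_of_contDiffOn {g : ℝ → V} (hI : IsOpen I) (hg : ContDiffOn ℝ ∞ g I) {t : ℝ}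
    (ht : t ∈ I) : HasDerivAt g (deriv g t) t :=
  ((hg.contDiffAt (hI.mem_nhds ht)).differentiableAt (by simp)).hasDerivAt

theorem inner_deriv_self {g : ℝ → V} (hI : IsOpen I) (hg : ContDiffOn ℝ ∞ g I)
    (h1 : ∀ t ∈ I, ‖g t‖ = 1) {t : ℝ} (ht : t ∈ I) : inner ℝ (deriv g t) (g t) = (0 : ℝ) := by
  have hd := hasDerivAt_of_contDiffOn hI hg ht
  have h2 := hd.inner ℝ hd
  have h3 : (fun s ↦ (inner ℝ (g s) (g s) : ℝ)) =ᶠ[𝓝 t] fun _ ↦ 1 := by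
    filter_upwards [hI.mem_nhds ht] with s hs
    simp [h1 s hs]
  have h4 := h2.unique ((hasDerivAt_const t (1 : ℝ)).congr_of_eventuallyEq h3)
  rw [real_inner_comm] at h4
  linarith

theorem inner_deriv_add {g k : ℝ → V} {η : ℝ → ℝ} (hI : IsOpen I) (hg : ContDiffOn ℝ ∞ g I)
    (hk : ContDiffOn ℝ ∞ k I) (h : ∀ t ∈ I, inner ℝ (g t) (k t) = η t) {t : ℝ} (ht : t ∈ I) :
    (inner ℝ (g t) (deriv k t) + inner ℝ (deriv g t) (k t) : ℝ) = deriv η t := by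
  have h2 := (hasDerivAt_of_contDiffOn hI hg ht).inner ℝ (hasDerivAt_of_contDiffOn hI hk ht)
  have h3 : η =ᶠ[𝓝 t] (fun s ↦ (inner ℝ (g s) (k s) : ℝ)) := by
    filter_upwards [hI.mem_nhds ht] with s hs
    rw [h s hs]
  exact ((h2.congr_of_eventuallyEq h3).deriv).symm

theorem IsRepData.inner_deriv_frame (h : IsRepData I γ e a) {t : ℝ} (ht : t ∈ I) (j : Fin m) :
    inner ℝ (deriv (e j) t) (γ t) = (0 : ℝ) := by
  have h1 := inner_deriv_add (η := fun _ ↦ 0) h.isOpen (h.smooth_frame j) h.smooth_curve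
    (fun s hs ↦ h.tangent_sphere s hs j) ht
  rw [h.perp t ht j, deriv_const, zero_add] at h1
  exact h1

theorem IsRepData.inner_deriv_curve (h : IsRepData I γ e a) {t : ℝ} (ht : t ∈ I) :
    inner ℝ (deriv γ t) (γ t) = (0 : ℝ) :=
  inner_deriv_self h.isOpen h.smooth_curve h.sphere ht

theorem IsRepData.hasFDerivAt_curve_fst (h : IsRepData I γ e a)
    {x : ℝ × EuclideanSpace ℝ (Fin m)} (hx : x.1 ∈ I) :
    HasFDerivAt (fun x : ℝ × EuclideanSpace ℝ (Fin m) ↦ γ x.1)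
      ((ContinuousLinearMap.fst ℝ ℝ (EuclideanSpace ℝ (Fin m))).smulRight (deriv γ x.1)) x := by
  have h1 := (hasDerivAt_of_contDiffOn h.isOpen h.smooth_curve hx).hasFDerivAt.comp x
    (hasFDerivAt_fst (𝕜 := ℝ) (E := ℝ) (F := EuclideanSpace ℝ (Fin m)))
  refine h1.congr_fderiv ?_
  ext v <;> simp

theorem IsRepData.eq_zero_of_sum_eq_zero (h : IsRepData I γ e a) {t : ℝ} (ht : t ∈ I)
    {u : EuclideanSpace ℝ (Fin m)} (hu : ∑ j, u j • e j t = 0) : u = 0 := by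
  ext j
  simpa using Fintype.linearIndependent_iff.1 (h.orthonormal t ht).linearIndependent (fun j ↦ u j)
    hu j

theorem IsRepData.deriv_ne_zero (h : IsRepData I γ e a) {t : ℝ} (ht : t ∈ I) : deriv γ t ≠ 0 := by
  rw [← norm_ne_zero_iff, h.arcLength t ht]
  exact one_ne_zero

theorem IsRepData.mvfderiv_curve_fst (h : IsRepData I γ e a)
    {x : ℝ × EuclideanSpace ℝ (Fin m)} (hx : x.1 ∈ I) (v : ℝ × EuclideanSpace ℝ (Fin m)) :
    mvfderiv 𝓘(ℝ, ℝ × EuclideanSpace ℝ (Fin m)) (fun x ↦ γ x.1) x v = v.1 • deriv γ x.1 := by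
  rw [mvfderiv_vectorSpace]
  exact congrArg (fun L : (ℝ × EuclideanSpace ℝ (Fin m)) →L[ℝ] V ↦ L v)
    (h.hasFDerivAt_curve_fst hx).fderiv

variable [CompleteSpace V]

theorem IsRepData.hasDerivAt_integral (h : IsRepData I γ e a) {t : ℝ} (ht : t ∈ I) :
    HasDerivAt (fun t ↦ ∫ τ in (0 : ℝ)..t, a τ • deriv γ τ) (a t • deriv γ t) t := by
  have hc : ContinuousOn (fun τ ↦ a τ • deriv γ τ) I :=
    h.smooth_fun.continuousOn.smul (contDiffOn_deriv h.isOpen h.smooth_curve).continuousOn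
  have hsub : uIcc 0 t ⊆ I := h.ordConnected.uIcc_subset h.zero_mem ht
  exact intervalIntegral.integral_hasDerivAt_right (hc.mono hsub).intervalIntegrable
    (hc.stronglyMeasurableAtFilter h.isOpen t ht) (hc.continuousAt (h.isOpen.mem_nhds ht))

theorem IsRepData.contDiffOn_integral (h : IsRepData I γ e a) :
    ContDiffOn ℝ ∞ (fun t ↦ ∫ τ in (0 : ℝ)..t, a τ • deriv γ τ) I := by
  rw [contDiffOn_infty_iff_deriv_of_isOpen h.isOpen]
  refine ⟨fun t ht ↦ (h.hasDerivAt_integral ht).differentiableAt.differentiableWithinAt, ?_⟩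
  exact (h.smooth_fun.smul (contDiffOn_deriv h.isOpen h.smooth_curve)).congr
    fun t ht ↦ (h.hasDerivAt_integral ht).deriv

theorem IsRepData.contDiffOn_repMap (h : IsRepData I γ e a) :
    ContDiffOn ℝ ∞ (repMap γ e a) (I ×ˢ univ) := by
  have hf : MapsTo (Prod.fst : ℝ × EuclideanSpace ℝ (Fin m) → ℝ) (I ×ˢ univ) I := fun x hx ↦ hx.1
  refine (h.contDiffOn_integral.comp contDiff_fst.contDiffOn hf).add
    (ContDiffOn.sum fun j _ ↦ ContDiffOn.smul ?_
      ((h.smooth_frame j).comp contDiff_fst.contDiffOn hf))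
  exact ((EuclideanSpace.proj (𝕜 := ℝ) j).contDiff.comp contDiff_snd).contDiffOn

theorem IsRepData.fderiv_repMap (h : IsRepData I γ e a)
    {x : ℝ × EuclideanSpace ℝ (Fin m)} (hx : x.1 ∈ I) (v : ℝ × EuclideanSpace ℝ (Fin m)) :
    fderiv ℝ (repMap γ e a) x v =
      v.1 • (a x.1 • deriv γ x.1 + ∑ j, x.2 j • deriv (e j) x.1) + ∑ j, v.2 j • e j x.1 := by
  have h1 : HasFDerivAt (fun x : ℝ × EuclideanSpace ℝ (Fin m) ↦
      ∫ τ in (0 : ℝ)..x.1, a τ • deriv γ τ) _ x :=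
    (h.hasDerivAt_integral hx).hasFDerivAt.comp x hasFDerivAt_fst
  have h2 : ∀ j : Fin m, HasFDerivAt (fun x : ℝ × EuclideanSpace ℝ (Fin m) ↦ x.2 j • e j x.1) _ x :=
    fun j ↦ HasFDerivAt.smul
      ((EuclideanSpace.proj (𝕜 := ℝ) j).hasFDerivAt.comp x hasFDerivAt_snd)
      ((hasDerivAt_of_contDiffOn h.isOpen (h.smooth_frame j) hx).hasFDerivAt.comp x hasFDerivAt_fst)
  have h3 : HasFDerivAt (repMap γ e a) _ x := h1.add (HasFDerivAt.fun_sum fun j _ ↦ h2 j)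
  rw [h3.fderiv]
  simp [Finset.sum_add_distrib, Finset.smul_sum, smul_smul, mul_comm]
  abel

theorem IsRepData.isFrontal (h : IsRepData I γ e a) (c : V) :
    IsFrontal (ℝ × EuclideanSpace ℝ (Fin m)) (fun x ↦ c + repMap γ e a x) (I ×ˢ univ)
      (fun _ x ↦ γ x.1) := by
  have hf : MapsTo (Prod.fst : ℝ × EuclideanSpace ℝ (Fin m) → ℝ) (I ×ˢ univ) I := fun x hx ↦ hx.1
  refine ⟨(contDiffOn_const.add h.contDiffOn_repMap).contMDiffOn, fun p hp ↦
    ⟨I ×ˢ univ, h.isOpen.prod isOpen_univ, hp, subset_rfl,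
      (h.smooth_curve.comp contDiff_fst.contDiffOn hf).contMDiffOn,
      fun q hq ↦ h.sphere _ hq.1, fun q hq v ↦ ?_, fun q hq ↦ Or.inl (EventuallyEq.refl _ _)⟩⟩
  have key : ∀ v : ℝ × EuclideanSpace ℝ (Fin m),
      inner ℝ (fderiv ℝ (repMap γ e a) q v) (γ q.1) = (0 : ℝ) := fun v ↦ by
    rw [h.fderiv_repMap hq.1]
    simp [inner_add_left, real_inner_smul_left, sum_inner, h.inner_deriv_curve hq.1,
      h.inner_deriv_frame hq.1, h.tangent_sphere _ hq.1]
  rw [mvfderiv_vectorSpace, fderiv_const_add]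
  exact key v

theorem IsRepData.mvfderiv_repMap (h : IsRepData I γ e a) (c : V)
    {x : ℝ × EuclideanSpace ℝ (Fin m)} (hx : x.1 ∈ I) (v : ℝ × EuclideanSpace ℝ (Fin m)) :
    mvfderiv 𝓘(ℝ, ℝ × EuclideanSpace ℝ (Fin m)) (fun x ↦ c + repMap γ e a x) x v =
      v.1 • (a x.1 • deriv γ x.1 + ∑ j, x.2 j • deriv (e j) x.1) + ∑ j, v.2 j • e j x.1 := by
  rw [mvfderiv_vectorSpace, fderiv_const_add]
  exact h.fderiv_repMap hx v

/-- The curve `γ` is a unit normal along the rulings `t = const`. Its differential vanishes exactly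
on the rulings, on which the differential of the map is injective. -/
theorem IsRepData.isFlatFront (h : IsRepData I γ e a) (c : V) :
    IsFlatFront (ℝ × EuclideanSpace ℝ (Fin m)) (fun x ↦ c + repMap γ e a x) (I ×ˢ univ)
      (fun _ x ↦ γ x.1) := by
  have hf : MapsTo (Prod.fst : ℝ × EuclideanSpace ℝ (Fin m) → ℝ) (I ×ˢ univ) I := fun x hx ↦ hx.1
  have hopen : IsOpen (I ×ˢ (univ : Set (EuclideanSpace ℝ (Fin m)))) := h.isOpen.prod isOpen_univ
  refine ⟨⟨h.isFrontal c, fun p hp ↦ ?_⟩, ?_⟩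
  · rw [injective_iff_map_eq_zero]
    intro v hv
    rw [mvfderiv_prodMk
      ((h.isFrontal c).smooth.contMDiffAt (hopen.mem_nhds hp) |>.mdifferentiableAt (by simp))
      (h.hasFDerivAt_curve_fst hp.1).differentiableAt.mdifferentiableAt] at hv
    obtain ⟨h1, h2⟩ := Prod.ext_iff.1 hv
    have h3 := (h.mvfderiv_curve_fst hp.1 v).symm.trans h2
    have h4 := (h.mvfderiv_repMap c hp.1 v).symm.trans h1
    change v.1 • deriv γ p.1 = 0 at h3
    have hv1 : v.1 = 0 := (smul_eq_zero.1 h3).resolve_right (h.deriv_ne_zero hp.1)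
    rw [hv1, zero_smul, zero_add] at h4
    exact Prod.ext hv1 (h.eq_zero_of_sum_eq_zero hp.1 h4)
  · refine isFlat_of_rank_le_one hopen (h.smooth_curve.comp contDiff_fst.contDiffOn hf)
      (fun x hx ↦ h.sphere _ hx.1) fun x hx ↦ ⟨LinearMap.fst ℝ ℝ _, deriv γ x.1, fun v ↦ ?_⟩
    exact congrArg (fun L : (ℝ × EuclideanSpace ℝ (Fin m)) →L[ℝ] V ↦ L v)
      (h.hasFDerivAt_curve_fst hx.1).fderiv

/-- A relation `δ₁ df = δ₂ dν` gives `δ₁ = 0` on a ruling, where `dν = 0`, and then `δ₂ = 0`. There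
are no rulings for `m = 0`, and every point is umbilic. -/
theorem IsRepData.not_isUmbilic (h : IsRepData I γ e a) (hm : 0 < m) (c : V)
    {x : ℝ × EuclideanSpace ℝ (Fin m)} (hx : x.1 ∈ I) :
    ¬ IsUmbilic (ℝ × EuclideanSpace ℝ (Fin m)) (fun x ↦ c + repMap γ e a x)
      (fun _ x ↦ γ x.1) x := by
  rintro ⟨δ₁, δ₂, hδ, heq⟩
  have key : ∀ v : ℝ × EuclideanSpace ℝ (Fin m),
      δ₁ • (v.1 • (a x.1 • deriv γ x.1 + ∑ j, x.2 j • deriv (e j) x.1) + ∑ j, v.2 j • e j x.1) =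
        δ₂ • v.1 • deriv γ x.1 := by
    intro v
    rw [← h.mvfderiv_repMap c hx v, ← h.mvfderiv_curve_fst hx v]
    exact congrArg (fun L : (ℝ × EuclideanSpace ℝ (Fin m)) →L[ℝ] V ↦ L v) heq
  have h1 : δ₁ = 0 := by
    have h2 := key (0, EuclideanSpace.single ⟨0, hm⟩ 1)
    have h3 : ∑ j, (EuclideanSpace.single (⟨0, hm⟩ : Fin m) (1 : ℝ)) j • e j x.1 =
        e ⟨0, hm⟩ x.1 := by
      rw [Finset.sum_eq_single ⟨0, hm⟩] <;> simp +contextual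
    simp only [zero_smul, zero_add, smul_zero, h3] at h2
    refine (smul_eq_zero.1 h2).resolve_right fun h4 ↦ ?_
    have h5 := (h.orthonormal _ hx).1 ⟨0, hm⟩
    simp [h4] at h5
  have h2 : δ₂ = 0 := by
    have h3 := key (1, 0)
    rw [h1, zero_smul] at h3
    simpa [h.deriv_ne_zero hx] using h3.symm
  exact hδ (by rw [h1, h2])

end RepMap

/-! ### Curves in the sphere: arc length, parallel frames -/

section Curves

variable {V : Type*} [NormedAddCommGroup V] [InnerProductSpace ℝ V] [CompleteSpace V]

theorem exists_Ioo_neg_subset {O : Set ℝ} (hO : IsOpen O) (h0 : (0 : ℝ) ∈ O) :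
    ∃ ε > 0, Ioo (-ε) ε ⊆ O := by
  obtain ⟨ε, hε, h⟩ := Metric.isOpen_iff.1 hO 0 h0
  refine ⟨ε, hε, ?_⟩
  rwa [Real.ball_eq_Ioo, zero_sub, zero_add] at h

omit [CompleteSpace V] in
theorem eq_of_hasDerivAt_Ioo {W : Type*} [NormedAddCommGroup W] [NormedSpace ℝ W] {ε : ℝ}
    {x y d : ℝ → W}
    (hx : ∀ t ∈ Ioo (-ε) ε, HasDerivAt x (d t) t) (hy : ∀ t ∈ Ioo (-ε) ε, HasDerivAt y (d t) t)
    (h0 : x 0 = y 0) {t : ℝ} (ht : t ∈ Ioo (-ε) ε) : x t = y t := by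
  have hd : ∀ s ∈ Ioo (-ε) ε, HasDerivAt (x - y) 0 s := fun s hs ↦ by
    simpa using (hx s hs).sub (hy s hs)
  have h := isOpen_Ioo.is_const_of_deriv_eq_zero isPreconnected_Ioo
    (fun s hs ↦ (hd s hs).differentiableAt.differentiableWithinAt) (fun s hs ↦ (hd s hs).deriv) ht
    (show (0 : ℝ) ∈ Ioo (-ε) ε by constructor <;> linarith [ht.1, ht.2])
  simp only [Pi.sub_apply, h0, sub_self] at h
  exact sub_eq_zero.1 h

/-- Local existence and smoothness for the equation `v' = (ψ - ⟪v, k⟫) u`. With `u = γ'` and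
`k = γ''` it preserves, for `ψ = 0`, the orthogonality to `γ` and `γ'`, and its solutions are
the parallel normal vector fields of `γ`. -/
theorem exists_contDiffOn_hasDerivAt {I : Set ℝ} (hI : IsOpen I) (h0 : (0 : ℝ) ∈ I) {ψ : ℝ → ℝ}
    {k u : ℝ → V} (hψ : ContDiffOn ℝ ∞ ψ I) (hk : ContDiffOn ℝ ∞ k I) (hu : ContDiffOn ℝ ∞ u I)
    (v₀ : V) :
    ∃ ε > 0, Ioo (-ε) ε ⊆ I ∧ ∃ v : ℝ → V, v 0 = v₀ ∧ ContDiffOn ℝ ∞ v (Ioo (-ε) ε) ∧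
      ∀ t ∈ Ioo (-ε) ε, HasDerivAt v ((ψ t - inner ℝ (v t) (k t)) • u t) t := by
  have hIn := hI.mem_nhds h0
  -- an autonomous system, with time as an additional unknown, is needed for the existence theorem
  set F : ℝ × V → ℝ × V := fun z ↦ (1, (ψ z.1 - inner ℝ z.2 (k z.1)) • u z.1) with hF
  have hFs : ContDiffAt ℝ 1 F (0, v₀) := by
    have h1 : ContDiffAt ℝ 1 (fun z : ℝ × V ↦ ψ z.1) (0, v₀) :=
      ((hψ.contDiffAt hIn).of_le (by simp)).comp (x := ((0 : ℝ), v₀)) contDiffAt_fst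
    have h2 : ContDiffAt ℝ 1 (fun z : ℝ × V ↦ k z.1) (0, v₀) :=
      ((hk.contDiffAt hIn).of_le (by simp)).comp (x := ((0 : ℝ), v₀)) contDiffAt_fst
    have h3 : ContDiffAt ℝ 1 (fun z : ℝ × V ↦ u z.1) (0, v₀) :=
      ((hu.contDiffAt hIn).of_le (by simp)).comp (x := ((0 : ℝ), v₀)) contDiffAt_fst
    exact contDiffAt_const.prodMk ((h1.sub (contDiffAt_snd.inner ℝ h2)).smul h3)
  obtain ⟨α, hα0, ε₁, hε₁, hα⟩ :=
    hFs.exists_forall_mem_closedBall_exists_eq_forall_mem_Ioo_hasDerivAt₀ 0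
  rw [zero_sub, zero_add] at hα
  obtain ⟨ε₂, hε₂, hI₂⟩ := exists_Ioo_neg_subset hI h0
  have hα1 : ∀ t ∈ Ioo (-ε₁) ε₁, HasDerivAt (fun t ↦ (α t).1) 1 t := fun t ht ↦
    (hasFDerivAt_fst (𝕜 := ℝ) (E := ℝ) (F := V)).comp_hasDerivAt t (hα t ht)
  have hα2 : ∀ t ∈ Ioo (-ε₁) ε₁, HasDerivAt (fun t ↦ (α t).2) (F (α t)).2 t := fun t ht ↦
    (hasFDerivAt_snd (𝕜 := ℝ) (E := ℝ) (F := V)).comp_hasDerivAt t (hα t ht)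
  have hαt : ∀ t ∈ Ioo (-ε₁) ε₁, (α t).1 = t := by
    intro t ht
    exact eq_of_hasDerivAt_Ioo (y := id) hα1 (fun s _ ↦ hasDerivAt_id s) (by simp [hα0]) ht
  set ε := min ε₁ ε₂ with hε
  have hεpos : 0 < ε := lt_min hε₁ hε₂
  have hs1 : Ioo (-ε) ε ⊆ Ioo (-ε₁) ε₁ :=
    Ioo_subset_Ioo (neg_le_neg (min_le_left _ _)) (min_le_left _ _)
  have hs2 : Ioo (-ε) ε ⊆ I :=
    (Ioo_subset_Ioo (neg_le_neg (min_le_right _ _)) (min_le_right _ _)).trans hI₂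
  have hd : ∀ t ∈ Ioo (-ε) ε,
      HasDerivAt (fun t ↦ (α t).2) ((ψ t - inner ℝ (α t).2 (k t)) • u t) t := by
    intro t ht
    have h := hα2 t (hs1 ht)
    simp only [hF, hαt t (hs1 ht)] at h
    exact h
  refine ⟨ε, hεpos, hs2, fun t ↦ (α t).2, by simp [hα0], ?_, hd⟩
  rw [contDiffOn_infty]
  -- each derivative is gained from the equation itself
  intro n
  induction n with
  | zero =>
    rw [Nat.cast_zero, contDiffOn_zero]
    exact fun t ht ↦ (hd t ht).continuousAt.continuousWithinAt
  | succ n ih =>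
    rw [Nat.cast_succ, contDiffOn_succ_iff_deriv_of_isOpen isOpen_Ioo]
    refine ⟨fun t ht ↦ (hd t ht).differentiableAt.differentiableWithinAt, by simp, ?_⟩
    have hle : ((n : ℕ∞) : WithTop ℕ∞) ≤ (∞ : WithTop ℕ∞) := WithTop.coe_le_coe.2 le_top
    refine ContDiffOn.congr ?_ fun t ht ↦ (hd t ht).deriv
    exact (((hψ.mono hs2).of_le hle).sub (ih.inner ℝ ((hk.mono hs2).of_le hle))).smul
      ((hu.mono hs2).of_le hle)

omit [CompleteSpace V] in
/-- A regular curve can be reparametrized by arc length: the parameter change is the inverse of the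
arc length function. -/
theorem exists_arcLength {J : Set ℝ} (hJ : IsOpen J) {s₀ : ℝ} (hs₀ : s₀ ∈ J) {g : ℝ → V}
    (hg : ContDiffOn ℝ ∞ g J) (hg' : ∀ s ∈ J, deriv g s ≠ 0) :
    ∃ R : OpenPartialHomeomorph ℝ ℝ, s₀ ∈ R.source ∧ R.source ⊆ J ∧ R s₀ = 0 ∧
      ContDiffOn ℝ ∞ R.symm R.target ∧
      ∀ t ∈ R.target, HasDerivAt R.symm (‖deriv g (R.symm t)‖⁻¹) t ∧
        HasDerivAt (g ∘ R.symm) (‖deriv g (R.symm t)‖⁻¹ • deriv g (R.symm t)) t := by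
  obtain ⟨r, hr, hrJ⟩ := Metric.isOpen_iff.1 hJ s₀ hs₀
  have hc : ContDiffOn ℝ ∞ (fun s ↦ ‖deriv g s‖) J := (contDiffOn_deriv hJ hg).norm ℝ hg'
  set l : ℝ → ℝ := fun s ↦ ∫ τ in s₀..s, ‖deriv g τ‖ with hl
  have hs₀b := Metric.mem_ball_self (x := s₀) hr
  have hd : ∀ s ∈ Metric.ball s₀ r, HasDerivAt l ‖deriv g s‖ s := by
    intro s hs
    have hsub : uIcc s₀ s ⊆ J := by
      refine Subset.trans ?_ hrJ
      rw [Real.ball_eq_Ioo] at hs ⊢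
      rw [Real.ball_eq_Ioo] at hs₀b
      exact ordConnected_Ioo.uIcc_subset hs₀b hs
    exact intervalIntegral.integral_hasDerivAt_right (hc.continuousOn.mono hsub).intervalIntegrable
      (hc.continuousOn.stronglyMeasurableAtFilter hJ s (hrJ hs))
      (hc.continuousOn.continuousAt (hJ.mem_nhds (hrJ hs)))
  have hls : ContDiffOn ℝ ∞ l (Metric.ball s₀ r) := by
    rw [contDiffOn_infty_iff_deriv_of_isOpen Metric.isOpen_ball]
    exact ⟨fun s hs ↦ (hd s hs).differentiableAt.differentiableWithinAt,
      (hc.mono hrJ).congr fun s hs ↦ (hd s hs).deriv⟩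
  obtain ⟨R, hR, hRs, hRl, hRsm⟩ := exists_openPartialHomeomorph_of_deriv_ne_zero
    Metric.isOpen_ball hs₀b hls (by rw [(hd s₀ hs₀b).deriv]; exact norm_ne_zero_iff.2 (hg' _ hs₀))
  refine ⟨R, hR, hRs.trans hrJ, by simp [hRl, hl], hRsm, fun t ht ↦ ?_⟩
  have hst : R.symm t ∈ Metric.ball s₀ r := hRs (R.map_target ht)
  have h1 := R.hasDerivAt_symm ht (norm_ne_zero_iff.2 (hg' _ (hrJ hst)))
    (by rw [hRl]; exact hd _ hst)
  exact ⟨h1, (hasDerivAt_of_contDiffOn hJ hg (hrJ hst)).scomp t h1⟩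

omit [CompleteSpace V] in
/-- Solutions of `v' = (η'' - ⟪v, γ''⟫) γ'` have prescribed inner products with `γ` and `γ'`. -/
theorem inner_eq_of_hasDerivAt {I : Set ℝ} (hI : IsOpen I) {γ : ℝ → V} (hγ : ContDiffOn ℝ ∞ γ I)
    (h1 : ∀ t ∈ I, ‖γ t‖ = 1) (h2 : ∀ t ∈ I, ‖deriv γ t‖ = 1) {η : ℝ → ℝ}
    (hη : ContDiffOn ℝ ∞ η I) {ε : ℝ} (hεI : Ioo (-ε) ε ⊆ I) {v : ℝ → V}
    (hv : ∀ t ∈ Ioo (-ε) ε, HasDerivAt v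
      ((deriv (deriv η) t - inner ℝ (v t) (deriv (deriv γ) t)) • deriv γ t) t)
    (hv0 : inner ℝ (v 0) (γ 0) = η 0) (hv1 : inner ℝ (v 0) (deriv γ 0) = deriv η 0) {t : ℝ}
    (ht : t ∈ Ioo (-ε) ε) : inner ℝ (v t) (γ t) = η t ∧ inner ℝ (v t) (deriv γ t) = deriv η t := by
  have hγ' := contDiffOn_deriv hI hγ
  have hη' := contDiffOn_deriv hI hη
  have key : ∀ t ∈ Ioo (-ε) ε, inner ℝ (v t) (deriv γ t) = deriv η t := by
    intro t ht
    refine eq_of_hasDerivAt_Ioo (x := fun t ↦ (inner ℝ (v t) (deriv γ t) : ℝ)) (fun s hs ↦ ?_)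
      (fun s hs ↦ hasDerivAt_of_contDiffOn hI hη' (hεI hs)) hv1 ht
    refine ((hv s hs).inner ℝ (hasDerivAt_of_contDiffOn hI hγ' (hεI hs))).congr_deriv ?_
    rw [real_inner_smul_left, real_inner_self_eq_norm_sq, h2 s (hεI hs)]
    ring
  refine ⟨?_, key t ht⟩
  refine eq_of_hasDerivAt_Ioo (x := fun t ↦ (inner ℝ (v t) (γ t) : ℝ)) (fun s hs ↦ ?_)
    (fun s hs ↦ hasDerivAt_of_contDiffOn hI hη (hεI hs)) hv0 ht
  refine ((hv s hs).inner ℝ (hasDerivAt_of_contDiffOn hI hγ (hεI hs))).congr_deriv ?_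
  rw [real_inner_smul_left, inner_deriv_self hI hγ h1 (hεI hs), key s hs]
  ring

omit [CompleteSpace V] in
theorem exists_orthonormal_perp {m : ℕ} (hV : Module.finrank ℝ V = m + 2) {x y : V}
    (hx : ‖x‖ = 1) (hy : ‖y‖ = 1) (hxy : inner ℝ y x = (0 : ℝ)) :
    ∃ b : Fin m → V, Orthonormal ℝ b ∧
      ∀ j, inner ℝ (b j) x = (0 : ℝ) ∧ inner ℝ (b j) y = (0 : ℝ) := by
  have hfd : FiniteDimensional ℝ V := Module.finite_of_finrank_pos (by omega)
  have ho : Orthonormal ℝ ![x, y] := by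
    constructor
    · intro i
      fin_cases i <;> simp [hx, hy]
    · intro i j hij
      fin_cases i <;> fin_cases j <;> simp_all [real_inner_comm]
  set K := Submodule.span ℝ (range ![x, y]) with hK
  have hK2 : Module.finrank ℝ K = 2 := by
    simpa using finrank_span_eq_card ho.linearIndependent
  have hKo : Module.finrank ℝ Kᗮ = m := by
    have := K.finrank_add_finrank_orthogonal
    omega
  let b := (stdOrthonormalBasis ℝ Kᗮ).reindex (finCongr hKo)
  refine ⟨fun j ↦ (b j : V), b.orthonormal.comp_linearIsometry Kᗮ.subtypeₗᵢ, fun j ↦ ?_⟩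
  have h := fun z hz ↦ K.inner_left_of_mem_orthogonal (u := z) (v := (b j : V)) hz (b j).2
  exact ⟨h x (Submodule.subset_span ⟨0, rfl⟩), h y (Submodule.subset_span ⟨1, rfl⟩)⟩

omit [CompleteSpace V] in
theorem IsRepData.eq_sum_of_inner_eq_zero {m : ℕ} (hV : Module.finrank ℝ V = m + 2) {I : Set ℝ}
    {γ : ℝ → V} {e : Fin m → ℝ → V} {a : ℝ → ℝ} (h : IsRepData I γ e a) {t : ℝ} (ht : t ∈ I) {v : V}
    (h0 : inner ℝ v (γ t) = (0 : ℝ)) (h1 : inner ℝ v (deriv γ t) = (0 : ℝ)) :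
    v = ∑ j, (inner ℝ v (e j t) : ℝ) • e j t := by
  have hfd : FiniteDimensional ℝ V := Module.finite_of_finrank_pos (by omega)
  let b : Fin 2 ⊕ Fin m → V := Sum.elim ![γ t, deriv γ t] fun j ↦ e j t
  have hγγ := h.inner_deriv_curve ht
  have ho : Orthonormal ℝ b := by
    constructor
    · rintro (i | j)
      · fin_cases i <;> simp [b, h.sphere t ht, h.arcLength t ht]
      · exact (h.orthonormal t ht).1 j
    · rintro (i | i) (j | j) hij
      · fin_cases i <;> fin_cases j <;> simp_all [b, real_inner_comm]
      · fin_cases i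
        · exact (real_inner_comm _ _).trans (h.tangent_sphere t ht j)
        · exact (real_inner_comm _ _).trans (h.perp t ht j)
      · fin_cases j
        · exact h.tangent_sphere t ht i
        · exact h.perp t ht i
      · exact (h.orthonormal t ht).2 fun hc ↦ hij (by rw [hc])
  let B := (basisOfOrthonormalOfCardEqFinrank ho
    (by simp [hV, add_comm])).toOrthonormalBasis (by simpa using ho)
  have hB : ⇑B = b := by simp [B]
  have hs := B.sum_repr' v
  rw [hB] at hs
  simp only [Fintype.sum_sum_type, Fin.sum_univ_two, b, Sum.elim_inl, Sum.elim_inr,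
    Matrix.cons_val_zero, Matrix.cons_val_one] at hs
  rw [real_inner_comm, h0, real_inner_comm, h1, zero_smul, zero_smul, zero_add, zero_add] at hs
  refine hs.symm.trans (Finset.sum_congr rfl fun j _ ↦ ?_)
  rw [real_inner_comm]

/-- A unit speed curve in the sphere carries a parallel orthonormal normal frame, and for every
smooth function `η` there is a curve `A` with `A' = a γ'` that meets, at each time `t`, the affine
subspace `⟪y, γ⟫ = η`, `⟪y, γ'⟫ = η'` of codimension two. -/
theorem exists_isRepData {m : ℕ} (hV : Module.finrank ℝ V = m + 2) {I : Set ℝ} (hI : IsOpen I)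
    (h0 : (0 : ℝ) ∈ I) {γ : ℝ → V} (hγ : ContDiffOn ℝ ∞ γ I) (h1 : ∀ t ∈ I, ‖γ t‖ = 1)
    (h2 : ∀ t ∈ I, ‖deriv γ t‖ = 1) {η : ℝ → ℝ} (hη : ContDiffOn ℝ ∞ η I) {y₀ : V}
    (hy0 : inner ℝ y₀ (γ 0) = η 0) (hy1 : inner ℝ y₀ (deriv γ 0) = deriv η 0) :
    ∃ ε > 0, Ioo (-ε) ε ⊆ I ∧ ∃ (e : Fin m → ℝ → V) (a : ℝ → ℝ), IsRepData (Ioo (-ε) ε) γ e a ∧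
      ∀ t ∈ Ioo (-ε) ε,
        inner ℝ (y₀ + ∫ τ in (0 : ℝ)..t, a τ • deriv γ τ) (γ t) = η t ∧
        inner ℝ (y₀ + ∫ τ in (0 : ℝ)..t, a τ • deriv γ τ) (deriv γ t) = deriv η t := by
  have hγ' := contDiffOn_deriv hI hγ
  have hγ'' := contDiffOn_deriv hI hγ'
  have hη'' := contDiffOn_deriv hI (contDiffOn_deriv hI hη)
  obtain ⟨b, hb, hbp⟩ := exists_orthonormal_perp hV (h1 0 h0) (h2 0 h0)
    (inner_deriv_self hI hγ h1 h0)
  obtain ⟨δ, hδ, hδI, A, hA0, hAs, hA⟩ := exists_contDiffOn_hasDerivAt hI h0 hη'' hγ'' hγ' y₀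
  have hfr := fun j ↦ exists_contDiffOn_hasDerivAt hI h0
    (contDiffOn_const (c := (0 : ℝ))) hγ'' hγ' (b j)
  choose δ' hδ' hδI' e he0 hes he using hfr
  have hev : ∀ᶠ ε in 𝓝[>] (0 : ℝ), ε < δ ∧ ∀ j, ε < δ' j :=
    (eventually_nhdsWithin_of_eventually_nhds (gt_mem_nhds hδ)).and
      (eventually_all.2 fun j ↦ eventually_nhdsWithin_of_eventually_nhds (gt_mem_nhds (hδ' j)))
  obtain ⟨ε, ⟨hεδ, hεδ'⟩, hε⟩ := (hev.and self_mem_nhdsWithin).exists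
  replace hε : 0 < ε := hε
  have hs : Ioo (-ε) ε ⊆ Ioo (-δ) δ := Ioo_subset_Ioo (neg_le_neg hεδ.le) hεδ.le
  have hs' : ∀ j, Ioo (-ε) ε ⊆ Ioo (-δ' j) (δ' j) :=
    fun j ↦ Ioo_subset_Ioo (neg_le_neg (hεδ' j).le) (hεδ' j).le
  have hεI := hs.trans hδI
  have hperp : ∀ j, ∀ t ∈ Ioo (-ε) ε,
      inner ℝ (e j t) (γ t) = (0 : ℝ) ∧ inner ℝ (e j t) (deriv γ t) = (0 : ℝ) := by
    intro j t ht
    have := inner_eq_of_hasDerivAt hI hγ h1 h2 (η := fun _ ↦ 0) contDiffOn_const hεI (v := e j)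
      (fun s hs ↦ by simpa using he j s (hs' j hs)) (by rw [he0, (hbp j).1])
      (by rw [he0, (hbp j).2, deriv_const]) ht
    rwa [deriv_const] at this
  set a : ℝ → ℝ := fun t ↦ deriv (deriv η) t - inner ℝ (A t) (deriv (deriv γ) t) with ha
  have hrep : IsRepData (Ioo (-ε) ε) γ e a := by
    refine ⟨isOpen_Ioo, ordConnected_Ioo, ⟨by linarith, hε⟩, hγ.mono hεI, fun t ht ↦ h1 t (hεI ht),
      fun t ht ↦ h2 t (hεI ht), fun j ↦ (hes j).mono (hs' j), ?_, fun t ht j ↦ (hperp j t ht).1,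
      fun t ht j ↦ (hperp j t ht).2,
      (hη''.mono hεI).sub ((hAs.mono hs).inner ℝ (hγ''.mono hεI))⟩
    intro t ht
    have hin : ∀ i j, inner ℝ (e i t) (e j t) = (inner ℝ (b i) (b j) : ℝ) := by
      intro i j
      refine eq_of_hasDerivAt_Ioo (x := fun t ↦ (inner ℝ (e i t) (e j t) : ℝ))
        (y := fun _ ↦ inner ℝ (b i) (b j)) (d := fun _ ↦ 0) (fun s hs ↦ ?_)
        (fun s _ ↦ hasDerivAt_const s _) (by simp [he0]) ht
      refine ((he i s (hs' i hs)).inner ℝ (he j s (hs' j hs))).congr_deriv ?_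
      rw [real_inner_smul_left, real_inner_smul_right, (hperp i s hs).2,
        real_inner_comm (e j s) (deriv γ s), (hperp j s hs).2]
      simp
    rw [orthonormal_iff_ite] at hb ⊢
    exact fun i j ↦ (hin i j).trans (hb i j)
  refine ⟨ε, hε, hεI, e, a, hrep, fun t ht ↦ ?_⟩
  have hAt : y₀ + ∫ τ in (0 : ℝ)..t, a τ • deriv γ τ = A t :=
    eq_of_hasDerivAt_Ioo (x := fun t ↦ y₀ + ∫ τ in (0 : ℝ)..t, a τ • deriv γ τ)
      (fun s hs ↦ (hrep.hasDerivAt_integral hs).const_add y₀) (fun s h ↦ hA s (hs h))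
      (by simp [hA0]) ht
  rw [hAt]
  exact inner_eq_of_hasDerivAt hI hγ h1 h2 hη hεI (fun s h ↦ hA s (hs h)) (by rw [hA0, hy0])
    (by rw [hA0, hy1]) ht

omit [CompleteSpace V] in
/-- A smooth left inverse of the curve `γ`, for short times, that does not change when the point of
the sphere is replaced by its antipode: a function of the quotient
`⟪v, γ' 0⟫ / ⟪v, γ 0⟫`. -/
theorem IsRepData.exists_leftInverse {m : ℕ} {I : Set ℝ}
    {γ : ℝ → V} {e : Fin m → ℝ → V} {a : ℝ → ℝ} (h : IsRepData I γ e a) :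
    ∃ ε > 0, Ioo (-ε) ε ⊆ I ∧ ∃ (T : V → ℝ) (O : Set V), IsOpen O ∧ ContDiffOn ℝ ∞ T O ∧
      (∀ v ∈ O, -v ∈ O) ∧ (∀ v, T (-v) = T v) ∧ ∀ t ∈ Ioo (-ε) ε, γ t ∈ O ∧ T (γ t) = t := by
  set ρ : V → ℝ := fun v ↦ inner ℝ v (deriv γ 0) / inner ℝ v (γ 0) with hρ
  set Z : Set V := {v | inner ℝ v (γ 0) ≠ (0 : ℝ)} with hZ
  have hZo : IsOpen Z := isOpen_ne_fun (by fun_prop) (by fun_prop)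
  have hρs : ContDiffOn ℝ ∞ ρ Z :=
    (contDiff_id.inner ℝ contDiff_const).contDiffOn.div
      (contDiff_id.inner ℝ contDiff_const).contDiffOn fun v hv ↦ hv
  have hIo : IsOpen (I ∩ γ ⁻¹' Z) := h.smooth_curve.continuousOn.isOpen_inter_preimage h.isOpen hZo
  have h0Z : (0 : ℝ) ∈ I ∩ γ ⁻¹' Z := by
    refine ⟨h.zero_mem, ?_⟩
    simp [hZ, h.sphere 0 h.zero_mem]
  have hgs : ContDiffOn ℝ ∞ (ρ ∘ γ) (I ∩ γ ⁻¹' Z) :=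
    hρs.comp (h.smooth_curve.mono inter_subset_left) fun t ht ↦ ht.2
  have hgd : deriv (ρ ∘ γ) 0 ≠ 0 := by
    have hd := hasDerivAt_of_contDiffOn h.isOpen h.smooth_curve h.zero_mem
    have h1 := (hd.inner ℝ (hasDerivAt_const 0 (deriv γ 0))).div
      (hd.inner ℝ (hasDerivAt_const 0 (γ 0))) h0Z.2
    have h2 : HasDerivAt (ρ ∘ γ) 1 0 := by
      refine h1.congr_deriv ?_
      simp [h.inner_deriv_curve h.zero_mem, h.sphere 0 h.zero_mem, h.arcLength 0 h.zero_mem]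
    rw [h2.deriv]
    exact one_ne_zero
  obtain ⟨R, hR0, hRs, hRg, hRsm⟩ := exists_openPartialHomeomorph_of_deriv_ne_zero hIo h0Z hgs hgd
  obtain ⟨ε, hε, hεR⟩ := exists_Ioo_neg_subset R.open_source hR0
  have hρn : ∀ v, ρ (-v) = ρ v := fun v ↦ by simp [hρ, inner_neg_left]
  refine ⟨ε, hε, fun t ht ↦ (hRs (hεR ht)).1, R.symm ∘ ρ, Z ∩ ρ ⁻¹' R.target,
    hρs.continuousOn.isOpen_inter_preimage hZo R.open_target,
    hRsm.comp (hρs.mono inter_subset_left) fun v hv ↦ hv.2, ?_, fun v ↦ ?_, fun t ht ↦ ?_⟩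
  · rintro v ⟨h1, h2⟩
    refine ⟨by simpa [hZ, inner_neg_left] using h1, ?_⟩
    rwa [mem_preimage, hρn]
  · rw [Function.comp_apply, Function.comp_apply, hρn]
  · have hRt : R t = ρ (γ t) := by rw [hRg]; rfl
    refine ⟨⟨(hRs (hεR ht)).2, ?_⟩, ?_⟩
    · rw [mem_preimage, ← hRt]
      exact R.map_source (hεR ht)
    · rw [Function.comp_apply, ← hRt]
      exact R.left_inv (hεR ht)

end Curves

/-! ### Lifting paths through a local homeomorphism -/

section Lifting

variable {E X : Type*} [TopologicalSpace E] [T2Space E] [TopologicalSpace X] [T2Space X]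

/-- A path can be lifted through a local homeomorphism as soon as every partial lift converges at
the end of its interval of definition. -/
theorem exists_lift_Icc {p : E → X} (hp : IsLocalHomeomorph p) {c : ℝ → X} (hc : Continuous c)
    {e₀ : E} (h0 : p e₀ = c 0)
    (hlim : ∀ s ∈ Ioc (0 : ℝ) 1, ∀ g : ℝ → E, ContinuousOn g (Ico 0 s) →
      (∀ r ∈ Ico 0 s, p (g r) = c r) → g 0 = e₀ → ∃ x, Tendsto g (𝓝[<] s) (𝓝 x)) :
    ∃ g : ℝ → E, ContinuousOn g (Icc 0 1) ∧ (∀ r ∈ Icc (0 : ℝ) 1, p (g r) = c r) ∧ g 0 = e₀ := by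
  let P (s : ℝ) : Prop :=
    ∃ g : ℝ → E, ContinuousOn g (Icc 0 s) ∧ (∀ r ∈ Icc (0 : ℝ) s, p (g r) = c r) ∧ g 0 = e₀
  have hP0 : P 0 := by
    refine ⟨fun _ ↦ e₀, continuousOn_const, fun r hr ↦ ?_, rfl⟩
    obtain rfl : r = 0 := le_antisymm hr.2 hr.1
    exact h0
  have hPmono : ∀ s s', s' ≤ s → P s → P s' := by
    rintro s s' h ⟨g, hg, hg1, hg0⟩
    exact ⟨g, hg.mono (Icc_subset_Icc_right h), fun r hr ↦ hg1 r ⟨hr.1, hr.2.trans h⟩, hg0⟩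
  have hPstep : ∀ s, 0 ≤ s → P s → ∃ s' > s, P s' := by
    rintro s hs ⟨g, hg, hg1, hg0⟩
    obtain ⟨q, hq, hpq⟩ := hp (g s)
    have hcs : c s ∈ q.target := by
      rw [← hg1 s ⟨hs, le_rfl⟩, hpq]
      exact q.map_source hq
    obtain ⟨ε, hε, hball⟩ := Metric.isOpen_iff.1 (q.open_target.preimage hc) s hcs
    have hsub : ∀ r ∈ Icc s (s + ε / 2), c r ∈ q.target := fun r hr ↦ by
      refine hball ?_
      rw [Metric.mem_ball, Real.dist_eq, abs_of_nonneg (by linarith [hr.1])]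
      linarith [hr.2]
    refine ⟨s + ε / 2, by linarith, fun r ↦ if r ≤ s then g r else q.symm (c r), ?_, ?_, ?_⟩
    · rw [← Icc_union_Icc_eq_Icc hs (by linarith : s ≤ s + ε / 2)]
      refine ContinuousOn.union_of_isClosed (hg.congr fun r hr ↦ if_pos hr.2) ?_ isClosed_Icc
        isClosed_Icc
      refine ContinuousOn.congr (f := fun r ↦ q.symm (c r))
        (q.continuousOn_symm.comp hc.continuousOn hsub) fun r hr ↦ ?_
      change (if r ≤ s then g r else q.symm (c r)) = q.symm (c r)
      split_ifs with h
      · obtain rfl : r = s := le_antisymm h hr.1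
        rw [← hg1 r ⟨hs, le_rfl⟩, hpq, q.left_inv hq]
      · rfl
    · intro r hr
      change p (if r ≤ s then g r else q.symm (c r)) = c r
      split_ifs with h
      · exact hg1 r ⟨hr.1, h⟩
      · rw [hpq, q.right_inv (hsub r ⟨(not_le.1 h).le, hr.2⟩)]
    · change (if (0 : ℝ) ≤ s then g 0 else q.symm (c 0)) = e₀
      rw [if_pos hs, hg0]
  -- the supremum of the times up to which the path can be lifted is attained
  set T : Set ℝ := {s | s ∈ Icc (0 : ℝ) 1 ∧ P s} with hT
  have hT0 : (0 : ℝ) ∈ T := ⟨⟨le_rfl, zero_le_one⟩, hP0⟩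
  have hTb : BddAbove T := ⟨1, fun s hs ↦ hs.1.2⟩
  set σ := sSup T with hσ
  have hσ0 : 0 ≤ σ := le_csSup hTb hT0
  have hσ1 : σ ≤ 1 := csSup_le ⟨0, hT0⟩ fun s hs ↦ hs.1.2
  have hPlt : ∀ r < σ, P r := fun r hr ↦ by
    obtain ⟨s, hs, hrs⟩ := exists_lt_of_lt_csSup ⟨0, hT0⟩ hr
    exact hPmono s r hrs.le hs.2
  have hPσ : P σ := by
    rcases hσ0.eq_or_lt with h | hpos
    · rw [← h]
      exact hP0
    have : Nonempty E := ⟨e₀⟩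
    choose! G hGc hGp hG0 using hPlt
    -- lifts are unique, so the lifts over `[0, r]` for `r < σ` fit together
    have huniq : ∀ r s, 0 ≤ r → r ≤ s → s < σ → G s r = G r r := by
      intro r s hr hrs hs
      refine (T2Space.isSeparatedMap p).eqOn_of_comp_eqOn hp.isLocallyInjective
        (isPreconnected_Icc (a := (0 : ℝ)) (b := r))
        ((hGc s hs).mono (Icc_subset_Icc_right hrs)) (hGc r (hrs.trans_lt hs)) (fun u hu ↦ ?_)
        (left_mem_Icc.2 hr) ((hG0 s hs).trans (hG0 r (hrs.trans_lt hs)).symm) (right_mem_Icc.2 hr)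
      exact (hGp s hs u ⟨hu.1, hu.2.trans hrs⟩).trans (hGp r (hrs.trans_lt hs) u hu).symm
    set g : ℝ → E := fun r ↦ G r r with hg
    have hgc : ContinuousOn g (Ico 0 σ) := by
      intro r hr
      have hm : (r + σ) / 2 < σ := by linarith [hr.2]
      have h1 : ContinuousWithinAt g (Icc 0 ((r + σ) / 2)) r :=
        (hGc _ hm r ⟨hr.1, by linarith [hr.2]⟩).congr (fun u hu ↦ (huniq u _ hu.1 hu.2 hm).symm)
          (huniq r _ hr.1 (by linarith [hr.2]) hm).symm
      refine h1.mono_of_mem_nhdsWithin ?_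
      filter_upwards [self_mem_nhdsWithin,
        mem_nhdsWithin_of_mem_nhds (Iio_mem_nhds (show r < (r + σ) / 2 by linarith [hr.2]))]
        with u hu hu'
      exact ⟨hu.1, le_of_lt hu'⟩
    obtain ⟨x, hx⟩ := hlim σ ⟨hpos, hσ1⟩ g hgc (fun r hr ↦ hGp r hr.2 r ⟨hr.1, le_rfl⟩)
      (hG0 0 hpos)
    have hne : (𝓝[<] σ).NeBot := inferInstance
    have hpx : p x = c σ := by
      have h1 : Tendsto (fun r ↦ p (g r)) (𝓝[<] σ) (𝓝 (p x)) :=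
        (hp.continuous.tendsto x).comp hx
      have h2 : Tendsto (fun r ↦ p (g r)) (𝓝[<] σ) (𝓝 (c σ)) := by
        refine ((hc.tendsto σ).mono_left nhdsWithin_le_nhds).congr' ?_
        filter_upwards [Ico_mem_nhdsLT hpos] with r hr
        exact (hGp r hr.2 r ⟨hr.1, le_rfl⟩).symm
      exact tendsto_nhds_unique h1 h2
    refine ⟨Function.update g σ x, ?_, fun r hr ↦ ?_, ?_⟩
    · rw [continuousOn_update_iff, Icc_sdiff_right]
      exact ⟨hgc, fun _ ↦ hx.mono_left (nhdsWithin_mono _ Ico_subset_Iio_self)⟩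
    · rcases hr.2.eq_or_lt with rfl | h
      · rw [Function.update_self, hpx]
      · rw [Function.update_of_ne h.ne]
        exact hGp r h r ⟨hr.1, le_rfl⟩
    · rw [Function.update_of_ne hpos.ne]
      exact hG0 0 hpos
  rcases hσ1.eq_or_lt with h | h
  · rw [← h]
    exact hPσ
  · obtain ⟨s', hs', hPs'⟩ := hPstep σ hσ0 hPσ
    have h1 : min s' 1 ∈ T :=
      ⟨⟨le_min (hσ0.trans hs'.le) zero_le_one, min_le_right _ _⟩,
        hPmono s' _ (min_le_left _ _) hPs'⟩
    exact absurd (le_csSup hTb h1) (not_le.2 (lt_min hs' h))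

/-- If the rays `r ↦ (t, r • w)` lift through a local homeomorphism in the sense of
`exists_lift_Icc`, then a section over `I × {0}` extends to a continuous section over all of
`I × W`. -/
theorem exists_section [Nonempty E] {W : Type*} [NormedAddCommGroup W] [NormedSpace ℝ W] {I : Set ℝ}
    {p : E → ℝ × W} (hp : IsLocalHomeomorph p) {σ : ℝ → E} (hσ : ContinuousOn σ I)
    (hσp : ∀ t ∈ I, p (σ t) = (t, 0))
    (hlim : ∀ t ∈ I, ∀ w : W, ∀ s ∈ Ioc (0 : ℝ) 1, ∀ g : ℝ → E, ContinuousOn g (Ico 0 s) →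
      (∀ r ∈ Ico 0 s, p (g r) = (t, r • w)) → g 0 = σ t → ∃ x, Tendsto g (𝓝[<] s) (𝓝 x)) :
    ∃ Φ : ℝ × W → E, ContinuousOn Φ (I ×ˢ univ) ∧ (∀ x ∈ I ×ˢ (univ : Set W), p (Φ x) = x) ∧
      ∀ t ∈ I, Φ (t, 0) = σ t := by
  have hex : ∀ x : ℝ × W, x.1 ∈ I → ∃ g : ℝ → E, ContinuousOn g (Icc 0 1) ∧
      (∀ r ∈ Icc (0 : ℝ) 1, p (g r) = (x.1, r • x.2)) ∧ g 0 = σ x.1 := fun x hx ↦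
    exists_lift_Icc hp (c := fun r ↦ (x.1, r • x.2)) (by fun_prop) (by simp [hσp _ hx])
      (hlim x.1 hx x.2)
  choose! g hgc hgp hg0 using hex
  have hsep : IsSeparatedMap p := T2Space.isSeparatedMap p
  let F : C(unitInterval × (I ×ˢ (univ : Set W) : Set (ℝ × W)), ℝ × W) :=
    ⟨fun z ↦ ((z.2 : ℝ × W).1, (z.1 : ℝ) • (z.2 : ℝ × W).2), by fun_prop⟩
  -- the lifts of a continuous family of paths depend continuously on the parameter
  have hG := hp.continuous_lift hsep F (g := fun z ↦ g (z.2 : ℝ × W) (z.1 : ℝ))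
    (funext fun z ↦ hgp _ z.2.2.1 _ z.1.2)
    (by
      have : ∀ y : (I ×ˢ (univ : Set W) : Set (ℝ × W)),
          g (y : ℝ × W) ((0 : unitInterval) : ℝ) = σ (y : ℝ × W).1 := fun y ↦ hg0 _ y.2.1
      simp only [this]
      exact hσ.comp_continuous (by fun_prop) fun y ↦ y.2.1)
    (fun y ↦ (hgc _ y.2.1).comp_continuous continuous_subtype_val fun s ↦ s.2)
  refine ⟨fun x ↦ g x 1, ?_, fun x hx ↦ ?_, fun t ht ↦ ?_⟩
  · rw [continuousOn_iff_continuous_domRestrict]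
    exact hG.comp (by fun_prop : Continuous fun y : (I ×ˢ (univ : Set W) : Set (ℝ × W)) ↦
      ((1 : unitInterval), y))
  · rw [hgp x hx.1 1 ⟨zero_le_one, le_rfl⟩, one_smul]
  · rw [← hg0 (t, 0) ht]
    refine hsep.constOn_of_comp hp.isLocallyInjective (isPreconnected_Icc (a := (0 : ℝ)) (b := 1))
      (hgc (t, 0) ht) (fun r hr r' hr' ↦ ?_) ⟨zero_le_one, le_rfl⟩ ⟨le_rfl, zero_le_one⟩
    rw [hgp (t, 0) ht r hr, hgp (t, 0) ht r' hr', smul_zero, smul_zero]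

end Lifting

/-! ### The local structure of a flat frontal near a point with `dν ≠ 0` -/

section Local

variable {E : Type*} [NormedAddCommGroup E] [NormedSpace ℝ E]
  {M : Type*} [TopologicalSpace M] [ChartedSpace E M]
  {V : Type*} [NormedAddCommGroup V] [InnerProductSpace ℝ V] {f : M → V} {ν : M → M → V}

/-- The local unit normal field `ν x`, compared with the values at `q` of the local fields `ν q`. -/
theorem IsUnitNormalField.exists_isOpen (h : IsUnitNormalField E f univ ν) (x : M) :
    ∃ W : Set M, IsOpen W ∧ x ∈ W ∧ ContMDiffOn 𝓘(ℝ, E) 𝓘(ℝ, V) ∞ (ν x) W ∧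
      ∀ q ∈ W, ‖ν x q‖ = 1 ∧ (∀ v, inner ℝ (mvfderiv 𝓘(ℝ, E) f q v) (ν x q) = (0 : ℝ)) ∧
        (ν q q = ν x q ∨ ν q q = -ν x q) ∧
        ∃ s : ℝ, (s = 1 ∨ s = -1) ∧ ∀ v, mvfderiv 𝓘(ℝ, E) (ν x) q v = s • dGauss E ν q v := by
  obtain ⟨W, hW, hxW, -, hs, h1, hperp, hsign⟩ := h x (mem_univ x)
  refine ⟨W, hW, hxW, hs, fun q hq ↦ ⟨h1 q hq, hperp q hq, ?_, ?_⟩⟩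
  · rcases hsign q hq with h | h
    · exact Or.inl h.self_of_nhds.symm
    · right
      rw [h.self_of_nhds, neg_neg]
  · rcases hsign q hq with h | h
    · exact ⟨1, Or.inl rfl, fun v ↦ by rw [mvfderiv_congr h, one_smul]; rfl⟩
    · refine ⟨-1, Or.inr rfl, fun v ↦ ?_⟩
      rw [mvfderiv_congr h, neg_one_smul]
      exact congrArg (fun L : TangentSpace 𝓘(ℝ, E) q →L[ℝ] V ↦ L v)
        (mvfderiv_neg (I := 𝓘(ℝ, E)) (g := ν q) (x := q))

variable [IsManifold 𝓘(ℝ, E) ∞ M]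

theorem mvfderiv_chartAt (x : M) (v : TangentSpace 𝓘(ℝ, E) x) :
    mvfderiv 𝓘(ℝ, E) (chartAt E x) x v = v := by
  have hd : MDifferentiableAt 𝓘(ℝ, E) 𝓘(ℝ, E) (chartAt E x) x :=
    ((contMDiffOn_chart (n := ∞)).contMDiffAt ((chartAt E x).open_source.mem_nhds
      (mem_chart_source E x))).mdifferentiableAt (by simp)
  rw [mvfderiv_eq_fderiv_chart hd]
  have h : (chartAt E x) ∘ (chartAt E x).symm =ᶠ[𝓝 (chartAt E x x)] id :=
    (chartAt E x).eventually_right_inverse (mem_chart_target E x)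
  rw [h.fderiv_eq, fderiv_id]
  rfl

variable [FiniteDimensional ℝ E] [CompleteSpace E]

/-- A submersion to the line is, near a point, the first coordinate of a chart. -/
theorem exists_chart_fst_eq {O : Set M} (hO : IsOpen O) {x : M} (hx : x ∈ O) {τ : M → ℝ}
    (hτ : ContMDiffOn 𝓘(ℝ, E) 𝓘(ℝ, ℝ) ∞ τ O) {u : TangentSpace 𝓘(ℝ, E) x}
    (hu : mvfderiv 𝓘(ℝ, E) τ x u = 1) :
    ∃ (K : Submodule ℝ E) (Q : OpenPartialHomeomorph M (ℝ × K)), x ∈ Q.source ∧ Q.source ⊆ O ∧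
      (∀ y ∈ Q.source, (Q y).1 = τ y) ∧ ContMDiffOn 𝓘(ℝ, ℝ × K) 𝓘(ℝ, E) ∞ Q.symm Q.target := by
  set L : E →L[ℝ] ℝ := mvfderiv 𝓘(ℝ, E) τ x with hL
  let u' : E := u
  have hu' : L u' = 1 := hu
  let K : Submodule ℝ E := LinearMap.ker (L : E →ₗ[ℝ] ℝ)
  let P : E →L[ℝ] K := (ContinuousLinearMap.id ℝ E - L.smulRight u').codRestrict K fun v ↦ by
    change L (v - L v • u') = 0
    rw [map_sub, map_smul, hu', smul_eq_mul, mul_one, sub_self]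
  have hPv : ∀ v, (P v : E) = v - L v • u' := fun v ↦ rfl
  set φ := chartAt E x
  have hxO : x ∈ O ∩ φ.source := ⟨hx, mem_chart_source E x⟩
  have hOo : IsOpen (O ∩ φ.source) := hO.inter φ.open_source
  have hφ : ContMDiffOn 𝓘(ℝ, E) 𝓘(ℝ, E) ∞ φ φ.source := contMDiffOn_chart
  have hPφ : ContMDiffOn 𝓘(ℝ, E) 𝓘(ℝ, K) ∞ (P ∘ φ) φ.source :=
    P.contDiff.contMDiff.comp_contMDiffOn hφ
  have hG : ContMDiffOn 𝓘(ℝ, E) 𝓘(ℝ, ℝ × K) ∞ (fun y ↦ (τ y, (P ∘ φ) y)) (O ∩ φ.source) :=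
    (hτ.mono inter_subset_left).prodMk_space (hPφ.mono inter_subset_right)
  have hdτ : MDifferentiableAt 𝓘(ℝ, E) 𝓘(ℝ, ℝ) τ x :=
    (hτ.contMDiffAt (hO.mem_nhds hx)).mdifferentiableAt (by simp)
  have hdP : MDifferentiableAt 𝓘(ℝ, E) 𝓘(ℝ, K) (P ∘ φ) x :=
    (hPφ.contMDiffAt (φ.open_source.mem_nhds hxO.2)).mdifferentiableAt (by simp)
  have hdφ : MDifferentiableAt 𝓘(ℝ, E) 𝓘(ℝ, E) φ x :=
    (hφ.contMDiffAt (φ.open_source.mem_nhds hxO.2)).mdifferentiableAt (by simp)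
  have hval : ∀ v : E, mvfderiv 𝓘(ℝ, E) (fun y ↦ (τ y, (P ∘ φ) y)) x v = (L v, P v) := by
    intro v
    refine (mvfderiv_prodMk hdτ hdP v).trans (Prod.ext rfl ?_)
    refine (mvfderiv_comp_fderiv P.differentiableAt hdφ v).trans ?_
    rw [P.fderiv]
    exact congrArg P (mvfderiv_chartAt x v)
  have hbij : Function.Bijective (mvfderiv 𝓘(ℝ, E) (fun y ↦ (τ y, (P ∘ φ) y)) x) := by
    constructor
    · rw [injective_iff_map_eq_zero]
      intro v hv
      obtain ⟨h1, h2⟩ := Prod.ext_iff.1 ((hval v).symm.trans hv)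
      have h3 := hPv v
      rw [show P v = 0 from h2, show L v = 0 from h1] at h3
      rw [zero_smul] at h3
      exact (sub_zero v).symm.trans h3.symm
    · rintro ⟨s, k⟩
      have hk : L k = 0 := k.2
      refine ⟨(s • u' + (k : E) : E), (hval _).trans (Prod.ext ?_ (Subtype.ext ?_))⟩
      · simp [hu', hk]
      · simp [hPv, hu', hk]
  obtain ⟨Q, hxQ, hQO, hQG, hQs⟩ := exists_openPartialHomeomorph_of_contMDiffOn hOo hxO hG hbij
  exact ⟨K, Q, hxQ, hQO.trans inter_subset_left, fun y hy ↦ by rw [hQG hy], hQs⟩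

theorem eq_of_fderiv_eq_zero_of_mem_ball {K Y : Type*} [NormedAddCommGroup K] [NormedSpace ℝ K]
    [NormedAddCommGroup Y] [NormedSpace ℝ Y] (G : K → Y) {k₀ : K} {r : ℝ}
    (hd : ∀ k ∈ Metric.ball k₀ r, DifferentiableAt ℝ G k)
    (h0 : ∀ k ∈ Metric.ball k₀ r, fderiv ℝ G k = 0) : ∀ k ∈ Metric.ball k₀ r, G k = G k₀ :=
  fun _ hk ↦ Metric.isOpen_ball.is_const_of_fderiv_eq_zero (𝕜 := ℝ)
    (convex_ball k₀ r).isPreconnected (fun k hk ↦ (hd k hk).differentiableWithinAt) h0 hk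
    (Metric.mem_ball_self (Metric.pos_of_mem_ball hk))

/-- Near a point where `dν ≠ 0`, a flat frontal is foliated by the level sets of
`τ = ⟪ν, b⟫`: the unit normal is a function `g` of `τ`, and `f` maps the level sets into the affine
subspaces of codimension two that are given by `⟪y, g⟫ = h`, `⟪y, g'⟫ = h'`. -/
theorem exists_local_product (hf : IsFrontal E f univ ν) (hflat : IsFlat E univ ν) {x : M}
    {u : TangentSpace 𝓘(ℝ, E) x} (hu : dGauss E ν x u ≠ 0) :
    ∃ (N : Set M) (J : Set ℝ) (b : V) (g : ℝ → V) (h : ℝ → ℝ), IsOpen N ∧ x ∈ N ∧ IsOpen J ∧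
      ContDiffOn ℝ ∞ g J ∧ ContDiffOn ℝ ∞ h J ∧ (∀ s ∈ J, ‖g s‖ = 1) ∧
      (∀ s ∈ J, inner ℝ (g s) b = s) ∧
      ∀ y ∈ N, (ν y y = ν x y ∨ ν y y = -ν x y) ∧ inner ℝ (ν x y) b ∈ J ∧
        ν x y = g (inner ℝ (ν x y) b) ∧ inner ℝ (f y) (ν x y) = h (inner ℝ (ν x y) b) ∧
        inner ℝ (f y) (deriv g (inner ℝ (ν x y) b)) = deriv h (inner ℝ (ν x y) b) ∧
        map (fun z ↦ (inner ℝ (ν x z) b : ℝ)) (𝓝 y) = 𝓝 (inner ℝ (ν x y) b) := by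
  obtain ⟨W, hW, hxW, hsm, hprop⟩ := hf.normal.exists_isOpen x
  set N := ν x with hN
  have hfs : ContMDiffOn 𝓘(ℝ, E) 𝓘(ℝ, V) ∞ f W := hf.smooth.mono (subset_univ _)
  set w := dGauss E ν x u with hw
  have hww : (inner ℝ w w : ℝ) ≠ 0 := inner_self_ne_zero.2 hu
  -- normalized so that `τ = ⟪ν x, b⟫` has derivative `1` along `u`
  set b : V := (inner ℝ w w : ℝ)⁻¹ • w with hb
  have hτk : HasFDerivAt (fun v : V ↦ (inner ℝ v b : ℝ)) (innerSL ℝ b) (N x) := by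
    refine (innerSL ℝ b).hasFDerivAt.congr_of_eventuallyEq (.of_forall fun v ↦ ?_)
    exact real_inner_comm _ _
  set τ : M → ℝ := fun y ↦ inner ℝ (N y) b with hτ
  have hτs : ContMDiffOn 𝓘(ℝ, E) 𝓘(ℝ, ℝ) ∞ τ W :=
    (contDiff_id.inner ℝ (contDiff_const (c := b))).contMDiff.comp_contMDiffOn hsm
  have hNd : MDifferentiableAt 𝓘(ℝ, E) 𝓘(ℝ, V) N x :=
    (hsm.contMDiffAt (hW.mem_nhds hxW)).mdifferentiableAt (by simp)
  have hτu : mvfderiv 𝓘(ℝ, E) τ x u = 1 := by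
    refine (mvfderiv_comp_fderiv hτk.differentiableAt hNd u).trans ?_
    rw [hτk.fderiv, innerSL_apply_apply]
    change inner ℝ b w = 1
    rw [hb, real_inner_smul_left, inv_mul_cancel₀ hww]
  obtain ⟨K, Q, hxQ, hQW, hQτ, hQs⟩ := exists_chart_fst_eq hW hxW hτs hτu
  have hsymmW : MapsTo Q.symm Q.target W := fun z hz ↦ hQW (Q.map_target hz)
  have hNs : ContDiffOn ℝ ∞ (N ∘ Q.symm) Q.target := (hsm.comp hQs hsymmW).contDiffOn
  have hFs : ContDiffOn ℝ ∞ (f ∘ Q.symm) Q.target := (hfs.comp hQs hsymmW).contDiffOn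
  have hQd : ∀ z ∈ Q.target, MDifferentiableAt 𝓘(ℝ, ℝ × K) 𝓘(ℝ, E) Q.symm z := fun z hz ↦
    (hQs.contMDiffAt (Q.open_target.mem_nhds hz)).mdifferentiableAt (by simp)
  have hdN : ∀ z ∈ Q.target, ∀ v, fderiv ℝ (N ∘ Q.symm) z v =
      mvfderiv 𝓘(ℝ, E) N (Q.symm z) (mfderiv 𝓘(ℝ, ℝ × K) 𝓘(ℝ, E) Q.symm z v) := fun z hz v ↦
    fderiv_comp_mfderiv ((hsm.contMDiffAt (hW.mem_nhds (hsymmW hz))).mdifferentiableAt (by simp))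
      (hQd z hz) v
  have hdF : ∀ z ∈ Q.target, ∀ v,
      inner ℝ (fderiv ℝ (f ∘ Q.symm) z v) ((N ∘ Q.symm) z) = (0 : ℝ) := by
    intro z hz v
    rw [fderiv_comp_mfderiv
      ((hfs.contMDiffAt (hW.mem_nhds (hsymmW hz))).mdifferentiableAt (by simp))
      (hQd z hz) v]
    exact (hprop _ (hsymmW hz)).2.1 _
  have hτQ : ∀ z ∈ Q.target, inner ℝ ((N ∘ Q.symm) z) b = z.1 := fun z hz ↦ by
    have := hQτ _ (Q.map_target hz)
    rw [Q.right_inv hz] at this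
    exact this.symm
  have hτd : ∀ z ∈ Q.target, ∀ v, inner ℝ (fderiv ℝ (N ∘ Q.symm) z v) b = v.1 := by
    intro z hz v
    have h1 := ((hNs.contDiffAt (Q.open_target.mem_nhds hz)).differentiableAt (by simp)).hasFDerivAt
    have h2 := h1.inner ℝ (hasFDerivAt_const b z)
    have h3 : (fun z ↦ (inner ℝ ((N ∘ Q.symm) z) b : ℝ)) =ᶠ[𝓝 z] Prod.fst := by
      filter_upwards [Q.open_target.mem_nhds hz] using hτQ
    have h4 := h2.unique (hasFDerivAt_fst.congr_of_eventuallyEq h3)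
    have h5 := congrArg (fun L : ℝ × K →L[ℝ] ℝ ↦ L v) h4
    simpa [fderivInnerCLM_apply] using h5
  -- `dN` has rank one and does not vanish in the direction of `τ`, so it vanishes on the leaves
  have hrank : ∀ z ∈ Q.target, ∀ k : K, fderiv ℝ (N ∘ Q.symm) z (0, k) = 0 := by
    intro z hz k
    obtain ⟨s, hs, hsd⟩ := (hprop _ (hsymmW hz)).2.2.2
    have h1 := hτd z hz (1, 0)
    have h2 := hτd z hz (0, k)
    have h3 := hflat.dGauss_rank_le_one hf.normal (mem_univ (Q.symm z))
      (mfderiv 𝓘(ℝ, ℝ × K) 𝓘(ℝ, E) Q.symm z (1, 0)) (mfderiv 𝓘(ℝ, ℝ × K) 𝓘(ℝ, E) Q.symm z (0, k))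
    rw [hdN z hz, hsd] at h1 h2 ⊢
    set d1 := dGauss E ν (Q.symm z) (mfderiv 𝓘(ℝ, ℝ × K) 𝓘(ℝ, E) Q.symm z (1, 0))
    set d2 := dGauss E ν (Q.symm z) (mfderiv 𝓘(ℝ, ℝ × K) 𝓘(ℝ, E) Q.symm z (0, k))
    have hs0 : s ≠ 0 := by rcases hs with rfl | rfl <;> norm_num
    rw [real_inner_smul_left] at h1 h2
    simp only [mul_eq_zero, hs0, false_or] at h2
    have hd1 : inner ℝ d1 b ≠ (0 : ℝ) := right_ne_zero_of_mul (h1.trans_ne one_ne_zero)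
    have hd1' : (inner ℝ d1 d1 : ℝ) ≠ 0 := inner_self_ne_zero.2 fun h0 ↦ hd1 (by simp [h0])
    have h4 := congrArg (fun y ↦ (inner ℝ y b : ℝ)) h3
    simp only [real_inner_smul_left, h2, mul_zero, mul_eq_zero, hd1, or_false] at h4
    rw [h4, zero_smul] at h3
    rw [(smul_eq_zero.1 h3.symm).resolve_left hd1', smul_zero]
  obtain ⟨r, hr, hrQ⟩ := Metric.isOpen_iff.1 Q.open_target (Q x) (Q.map_source hxQ)
  set s₀ := (Q x).1
  set k₀ := (Q x).2
  have hball : ∀ s k, (s, k) ∈ Metric.ball (Q x) r ↔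
      s ∈ Metric.ball s₀ r ∧ k ∈ Metric.ball k₀ r := by
    intro s k
    rw [← mem_prod (p := (s, k)), ball_prod_same]
  have hk₀ : k₀ ∈ Metric.ball k₀ r := Metric.mem_ball_self hr
  have hpd : ∀ (G : ℝ × K → V), ContDiffOn ℝ ∞ G Q.target → ∀ s ∈ Metric.ball s₀ r,
      ∀ k ∈ Metric.ball k₀ r, HasFDerivAt (fun k ↦ G (s, k))
        ((fderiv ℝ G (s, k)).comp (ContinuousLinearMap.inr ℝ ℝ K)) k := by
    intro G hG s hs k hk
    have hz := hrQ ((hball s k).2 ⟨hs, hk⟩)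
    exact ((hG.contDiffAt (Q.open_target.mem_nhds hz)).differentiableAt
      (by simp)).hasFDerivAt.comp k (hasFDerivAt_prodMk_right s k)
  set g : ℝ → V := fun s ↦ (N ∘ Q.symm) (s, k₀) with hg
  set h : ℝ → ℝ := fun s ↦ inner ℝ ((f ∘ Q.symm) (s, k₀)) (g s) with hh
  have hNg : ∀ s ∈ Metric.ball s₀ r, ∀ k ∈ Metric.ball k₀ r, (N ∘ Q.symm) (s, k) = g s := by
    intro s hs
    refine eq_of_fderiv_eq_zero_of_mem_ball (fun k ↦ (N ∘ Q.symm) (s, k))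
      (fun k hk ↦ (hpd _ hNs s hs k hk).differentiableAt) fun k hk ↦ ?_
    rw [(hpd _ hNs s hs k hk).fderiv]
    ext k'
    exact hrank _ (hrQ ((hball s k).2 ⟨hs, hk⟩)) k'
  -- along a leaf the normal is constant and orthogonal to `df`
  have hfh : ∀ s ∈ Metric.ball s₀ r, ∀ k ∈ Metric.ball k₀ r,
      inner ℝ ((f ∘ Q.symm) (s, k)) (g s) = h s := by
    intro s hs
    have hd : ∀ k ∈ Metric.ball k₀ r, HasFDerivAt
        (fun k ↦ (inner ℝ ((f ∘ Q.symm) (s, k)) (g s) : ℝ)) _ k := fun k hk ↦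
      (hpd _ hFs s hs k hk).inner ℝ (hasFDerivAt_const (g s) k)
    refine eq_of_fderiv_eq_zero_of_mem_ball (fun k ↦ (inner ℝ ((f ∘ Q.symm) (s, k)) (g s) : ℝ))
      (fun k hk ↦ (hd k hk).differentiableAt) fun k hk ↦ ?_
    rw [(hd k hk).fderiv]
    ext k'
    have := hdF _ (hrQ ((hball s k).2 ⟨hs, hk⟩)) (0, k')
    rw [hNg s hs k hk] at this
    simpa [fderivInnerCLM_apply] using this
  have hmk : ∀ k ∈ Metric.ball k₀ r, MapsTo (fun s : ℝ ↦ (s, k)) (Metric.ball s₀ r) Q.target :=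
    fun k hk s hs ↦ hrQ ((hball s k).2 ⟨hs, hk⟩)
  have hgs : ContDiffOn ℝ ∞ g (Metric.ball s₀ r) :=
    hNs.comp (contDiff_id.prodMk contDiff_const).contDiffOn (hmk k₀ hk₀)
  have hhs : ContDiffOn ℝ ∞ h (Metric.ball s₀ r) :=
    (hFs.comp (contDiff_id.prodMk contDiff_const).contDiffOn (hmk k₀ hk₀)).inner ℝ hgs
  -- the derivative of this identity across the leaves, where again `df` is orthogonal to `g`
  have hfh' : ∀ s ∈ Metric.ball s₀ r, ∀ k ∈ Metric.ball k₀ r,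
      inner ℝ ((f ∘ Q.symm) (s, k)) (deriv g s) = deriv h s := by
    intro s hs k hk
    have hz := hrQ ((hball s k).2 ⟨hs, hk⟩)
    have h1 := inner_deriv_add (g := fun s ↦ (f ∘ Q.symm) (s, k)) (k := g) (η := h)
      Metric.isOpen_ball (hFs.comp (contDiff_id.prodMk contDiff_const).contDiffOn (hmk k hk)) hgs
      (fun s hs ↦ hfh s hs k hk) hs
    have h2 : HasDerivAt (fun s ↦ (f ∘ Q.symm) (s, k)) (fderiv ℝ (f ∘ Q.symm) (s, k) (1, 0)) s :=
      ((hFs.contDiffAt (Q.open_target.mem_nhds hz)).differentiableAt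
        (by simp)).hasFDerivAt.comp_hasDerivAt s ((hasDerivAt_id s).prodMk (hasDerivAt_const s k))
    rw [h2.deriv, ← hNg s hs k hk, hdF _ hz, add_zero] at h1
    exact h1
  refine ⟨Q.source ∩ Q ⁻¹' Metric.ball (Q x) r, Metric.ball s₀ r, b, g, h,
    Q.isOpen_inter_preimage Metric.isOpen_ball, ⟨hxQ, Metric.mem_ball_self hr⟩, Metric.isOpen_ball,
    hgs, hhs, fun s hs ↦ (hprop _ (hsymmW (hmk k₀ hk₀ hs))).1, fun s hs ↦ hτQ _ (hmk k₀ hk₀ hs),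
    fun y hy ↦ ?_⟩
  obtain ⟨hyQ, hyB⟩ := hy
  obtain ⟨hs, hk⟩ := (hball (Q y).1 (Q y).2).1 hyB
  have hyτ : (inner ℝ (N y) b : ℝ) = (Q y).1 := (hQτ y hyQ).symm
  have hyy : Q.symm ((Q y).1, (Q y).2) = y := Q.left_inv hyQ
  have e1 := hNg _ hs _ hk
  have e2 := hfh _ hs _ hk
  have e3 := hfh' _ hs _ hk
  simp only [Function.comp_apply, hyy] at e1 e2 e3
  refine ⟨(hprop y (hQW hyQ)).2.2.1, by rw [hyτ]; exact hs, by rw [hyτ]; exact e1,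
    by rw [hyτ, e1]; exact e2, by rw [hyτ]; exact e3, ?_⟩
  have hτ1 : (fun z ↦ (inner ℝ (N z) b : ℝ)) =ᶠ[𝓝 y] Prod.fst ∘ Q := by
    filter_upwards [Q.open_source.mem_nhds hyQ] with z hz
    exact (hQτ z hz).symm
  rw [map_congr hτ1, ← map_map, Q.map_nhds_eq hyQ, map_fst_nhds, hyτ]

end Local

/-! ### The sheet swept out by a curve in the sphere -/

section Sheet

variable {V : Type*} [NormedAddCommGroup V] [InnerProductSpace ℝ V]
  {m : ℕ} {I : Set ℝ} {γ : ℝ → V} {e : Fin m → ℝ → V} {a : ℝ → ℝ} {c : V} {T : V → ℝ} {O : Set V}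

/-- `T` is a smooth function on the open set `O` that recovers the parameter `t ∈ I` from either of
the points `γ t` and `-γ t`. -/
structure IsCurveParameter (I : Set ℝ) (γ : ℝ → V) (T : V → ℝ) (O : Set V) : Prop where
  isOpen : IsOpen O
  smooth : ContDiffOn ℝ ∞ T O
  neg_mem : ∀ v ∈ O, -v ∈ O
  apply_neg : ∀ v, T (-v) = T v
  mem : ∀ t ∈ I, γ t ∈ O
  apply_curve : ∀ t ∈ I, T (γ t) = t

/-- The coordinates `(t, w)` of the contact element `(n, y)`, where `y ∈ V` and `n` is a unit normal
(up to sign): `t` is read off from the normal, and `w` consists of the components of `y` in the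
frame at `t`. -/
noncomputable def contactCoord (γ : ℝ → V) (e : Fin m → ℝ → V) (a : ℝ → ℝ) (c : V) (T : V → ℝ)
    (z : V × V) : ℝ × EuclideanSpace ℝ (Fin m) :=
  (T z.1, WithLp.toLp 2 fun j ↦
    inner ℝ (z.2 - c - ∫ τ in (0 : ℝ)..(T z.1), a τ • deriv γ τ) (e j (T z.1)))

theorem IsCurveParameter.contactCoord_neg (hT : IsCurveParameter I γ T O) (n y : V) :
    contactCoord γ e a c T (-n, y) = contactCoord γ e a c T (n, y) := by
  simp only [contactCoord, hT.apply_neg]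

theorem IsCurveParameter.contactCoord_repMap (hT : IsCurveParameter I γ T O)
    (h : IsRepData I γ e a) {z : ℝ × EuclideanSpace ℝ (Fin m)} (hz : z.1 ∈ I) :
    contactCoord γ e a c T (γ z.1, c + repMap γ e a z) = z := by
  refine Prod.ext (hT.apply_curve _ hz) ?_
  ext j
  simp only [contactCoord, hT.apply_curve _ hz, repMap, add_sub_cancel_left]
  rw [(h.orthonormal _ hz).inner_left_fintype]
  rfl

theorem IsCurveParameter.contDiffOn_contactCoord [CompleteSpace V] (hT : IsCurveParameter I γ T O)
    (h : IsRepData I γ e a) :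
    ContDiffOn ℝ ∞ (contactCoord γ e a c T) ((O ∩ T ⁻¹' I) ×ˢ (univ : Set V)) := by
  have hT1 : ContDiffOn ℝ ∞ (fun z : V × V ↦ T z.1) ((O ∩ T ⁻¹' I) ×ˢ (univ : Set V)) :=
    hT.smooth.comp contDiff_fst.contDiffOn fun z hz ↦ hz.1.1
  have hTI : MapsTo (fun z : V × V ↦ T z.1) ((O ∩ T ⁻¹' I) ×ˢ (univ : Set V)) I :=
    fun z hz ↦ hz.1.2
  refine hT1.prodMk ?_
  rw [contDiffOn_euclidean]
  intro j
  exact ((contDiff_snd.sub contDiff_const).contDiffOn.sub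
    (h.contDiffOn_integral.comp hT1 hTI)).inner ℝ ((h.smooth_frame j).comp hT1 hTI)

variable {E : Type*} [NormedAddCommGroup E] [NormedSpace ℝ E]
  {M : Type*} [TopologicalSpace M] [ChartedSpace E M] {f : M → V} {ν : M → M → V}

/-- The points of `M` whose contact element is one of the surface that is parametrized by
`c + repMap γ e a`. -/
def sheet (f : M → V) (ν : M → M → V) (I : Set ℝ) (γ : ℝ → V) (e : Fin m → ℝ → V) (a : ℝ → ℝ)
    (c : V) : Set M :=
  {x | ∃ z : ℝ × EuclideanSpace ℝ (Fin m), z.1 ∈ I ∧ (ν x x = γ z.1 ∨ ν x x = -γ z.1) ∧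
    f x = c + repMap γ e a z}

/-- The coordinates `(t, w)` of the contact element of `f` at a point of `M`. -/
noncomputable def sheetCoord (f : M → V) (ν : M → M → V) (γ : ℝ → V) (e : Fin m → ℝ → V) (a : ℝ → ℝ)
    (c : V) (T : V → ℝ) (x : M) : ℝ × EuclideanSpace ℝ (Fin m) :=
  contactCoord γ e a c T (ν x x, f x)

omit [ChartedSpace E M] [TopologicalSpace M] in
theorem IsCurveParameter.sheetCoord_spec (hT : IsCurveParameter I γ T O) (h : IsRepData I γ e a)
    {x : M} (hx : x ∈ sheet f ν I γ e a c) :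
    (sheetCoord f ν γ e a c T x).1 ∈ I ∧
    (ν x x = γ (sheetCoord f ν γ e a c T x).1 ∨ ν x x = -γ (sheetCoord f ν γ e a c T x).1) ∧
    f x = c + repMap γ e a (sheetCoord f ν γ e a c T x) := by
  obtain ⟨z, hz, hν, hf⟩ := hx
  have : sheetCoord f ν γ e a c T x = z := by
    unfold sheetCoord
    rcases hν with hν | hν
    · rw [hν, hf, hT.contactCoord_repMap h hz]
    · rw [hν, hf, hT.contactCoord_neg, hT.contactCoord_repMap h hz]
  rw [this]
  exact ⟨hz, hν, hf⟩

omit [ChartedSpace E M] [TopologicalSpace M] in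
theorem IsRepData.mem_sheet (hV : Module.finrank ℝ V = m + 2) (h : IsRepData I γ e a)
    {x : M} {z : ℝ × EuclideanSpace ℝ (Fin m)}
    (hz : z.1 ∈ I) (hν : ν x x = γ z.1 ∨ ν x x = -γ z.1)
    (h0 : inner ℝ (f x - (c + repMap γ e a z)) (γ z.1) = (0 : ℝ))
    (h1 : inner ℝ (f x - (c + repMap γ e a z)) (deriv γ z.1) = (0 : ℝ)) :
    x ∈ sheet f ν I γ e a c := by
  have hs := h.eq_sum_of_inner_eq_zero hV hz h0 h1
  refine ⟨(z.1, z.2 + WithLp.toLp 2 fun j ↦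
    inner ℝ (f x - (c + repMap γ e a z)) (e j z.1)), hz, hν, ?_⟩
  rw [sub_eq_iff_eq_add] at hs
  refine hs.trans ?_
  simp only [repMap, PiLp.add_apply, add_smul, Finset.sum_add_distrib]
  abel

variable [CompleteSpace V]

/-- Near a point of the sheet, the local unit normal field `ν x` agrees with the curve up to a
sign that does not depend on the point. -/
theorem IsCurveParameter.exists_sign (hT : IsCurveParameter I γ T O) (h : IsRepData I γ e a)
    {x y : M} {W : Set M} (hW : IsOpen W) (hyW : y ∈ W)
    (hν : ContMDiffOn 𝓘(ℝ, E) 𝓘(ℝ, V) ∞ (ν x) W)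
    (hsign : ∀ q ∈ W, ν q q = ν x q ∨ ν q q = -ν x q)
    (hf : ContMDiffOn 𝓘(ℝ, E) 𝓘(ℝ, V) ∞ f univ) (hy : y ∈ interior (sheet f ν I γ e a c)) :
    ContMDiffAt 𝓘(ℝ, E) 𝓘(ℝ, ℝ × EuclideanSpace ℝ (Fin m)) ∞ (sheetCoord f ν γ e a c T) y ∧
    ∃ s : ℝ, (s = 1 ∨ s = -1) ∧ ∀ᶠ q in 𝓝 y, ν x q = s • γ (sheetCoord f ν γ e a c T q).1 := by
  set p := sheetCoord f ν γ e a c T with hp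
  have hWU : W ∩ interior (sheet f ν I γ e a c) ∈ 𝓝 y :=
    (hW.inter isOpen_interior).mem_nhds ⟨hyW, hy⟩
  have hpm : ∀ q ∈ W ∩ interior (sheet f ν I γ e a c), (p q).1 ∈ I ∧
      (ν x q = γ (p q).1 ∨ ν x q = -γ (p q).1) := by
    intro q hq
    obtain ⟨h1, h2, -⟩ := hT.sheetCoord_spec h (interior_subset hq.2)
    refine ⟨h1, ?_⟩
    rcases hsign q hq.1 with h3 | h3 <;> rcases h2 with h4 | h4
    · exact Or.inl (h3.symm.trans h4)
    · exact Or.inr (h3.symm.trans h4)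
    · exact Or.inr (by rw [← h4, h3, neg_neg])
    · exact Or.inl (neg_injective (h3.symm.trans h4))
  have hpc : ∀ q ∈ W, p q = contactCoord γ e a c T (ν x q, f q) := by
    intro q hq
    change contactCoord γ e a c T (ν q q, f q) = _
    rcases hsign q hq with h3 | h3
    · rw [h3]
    · rw [h3, hT.contactCoord_neg]
  have hps : ContMDiffOn 𝓘(ℝ, E) 𝓘(ℝ, ℝ × EuclideanSpace ℝ (Fin m)) ∞ p
      (W ∩ interior (sheet f ν I γ e a c)) := by
    have h1 : ContMDiffOn 𝓘(ℝ, E) 𝓘(ℝ, V × V) ∞ (fun q ↦ (ν x q, f q))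
        (W ∩ interior (sheet f ν I γ e a c)) :=
      (hν.mono inter_subset_left).prodMk_space (hf.mono (subset_univ _))
    refine ((hT.contDiffOn_contactCoord (c := c) h).contMDiffOn.comp h1 fun q hq ↦ ?_).congr
      fun q hq ↦ hpc q hq.1
    obtain ⟨h2, h3⟩ := hpm q hq
    refine ⟨?_, mem_univ _⟩
    rcases h3 with h3 | h3
    · change ν x q ∈ _
      rw [h3]
      exact ⟨hT.mem _ h2, by rwa [mem_preimage, hT.apply_curve _ h2]⟩
    · change ν x q ∈ _
      rw [h3]
      exact ⟨hT.neg_mem _ (hT.mem _ h2), by rwa [mem_preimage, hT.apply_neg, hT.apply_curve _ h2]⟩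
  have hpy := hps.contMDiffAt hWU
  refine ⟨hpy, ?_⟩
  obtain ⟨hyI, hyν⟩ := hpm y ⟨hyW, hy⟩
  obtain ⟨s, hs, hsy⟩ : ∃ s : ℝ, (s = 1 ∨ s = -1) ∧ ν x y = s • γ (p y).1 := by
    rcases hyν with h1 | h1
    · exact ⟨1, Or.inl rfl, by rw [h1, one_smul]⟩
    · exact ⟨-1, Or.inr rfl, by rw [h1, neg_one_smul]⟩
  refine ⟨s, hs, ?_⟩
  have hγc : ContinuousAt (fun q ↦ γ (p q).1) y :=
    ContinuousAt.comp (f := fun q ↦ (p q).1)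
      (h.smooth_curve.continuousOn.continuousAt (h.isOpen.mem_nhds hyI)) hpy.continuousAt.fst
  have hc : ContinuousAt (fun q ↦ (inner ℝ (ν x q) (s • γ (p q).1) : ℝ)) y :=
    (hν.continuousOn.continuousAt (hW.mem_nhds hyW)).inner (hγc.const_smul s)
  have hss : s * s = 1 := by rcases hs with rfl | rfl <;> norm_num
  have hpos : (0 : ℝ) < inner ℝ (ν x y) (s • γ (p y).1) := by
    rw [hsy, real_inner_smul_left, real_inner_smul_right, ← mul_assoc, hss,
      real_inner_self_eq_norm_sq, h.sphere _ hyI]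
    norm_num
  -- near `y` the two unit vectors, equal up to sign, have positive inner product
  filter_upwards [hc.eventually (lt_mem_nhds hpos), hWU] with q hq hqW
  obtain ⟨hqI, hqν⟩ := hpm q hqW
  rcases hqν with h1 | h1 <;> rcases hs with rfl | rfl
  · rw [h1, one_smul]
  · rw [h1] at hq
    simp [h.sphere _ hqI] at hq
    linarith
  · rw [h1] at hq
    simp [inner_neg_left, h.sphere _ hqI] at hq
    linarith
  · rw [h1, neg_one_smul]

/-- The differential of the coordinates of the sheet is bijective, since the Legendrian lift
`(f, ν)` is an immersion that factors through them. -/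
theorem IsCurveParameter.bijective_mvfderiv [FiniteDimensional ℝ E]
    (hE : Module.finrank ℝ E = m + 1) (hT : IsCurveParameter I γ T O) (h : IsRepData I γ e a)
    (hf : IsFront E f univ ν) {y : M} (hy : y ∈ interior (sheet f ν I γ e a c)) :
    Function.Bijective (mvfderiv 𝓘(ℝ, E) (sheetCoord f ν γ e a c T) y) := by
  obtain ⟨W, hW, hyW, hsm, hprop⟩ := hf.normal.exists_isOpen y
  obtain ⟨hpy, s, hs, hsy⟩ := hT.exists_sign h hW hyW hsm (fun q hq ↦ (hprop q hq).2.2.1)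
    hf.smooth hy
  set p := sheetCoord f ν γ e a c T with hp
  have hpI : (p y).1 ∈ I := (hT.sheetCoord_spec h (interior_subset hy)).1
  have hpd := hpy.mdifferentiableAt (by simp)
  have hfd : MDifferentiableAt 𝓘(ℝ, E) 𝓘(ℝ, V) f y :=
    (hf.smooth.contMDiffAt univ_mem).mdifferentiableAt (by simp)
  have hνd : MDifferentiableAt 𝓘(ℝ, E) 𝓘(ℝ, V) (ν y) y :=
    (hsm.contMDiffAt (hW.mem_nhds hyW)).mdifferentiableAt (by simp)
  have hFd : DifferentiableAt ℝ (fun z ↦ c + repMap γ e a z) (p y) :=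
    (((contDiffOn_const.add h.contDiffOn_repMap).contDiffAt
      ((h.isOpen.prod isOpen_univ).mem_nhds ⟨hpI, mem_univ _⟩))).differentiableAt (by simp)
  have hγd : DifferentiableAt ℝ (fun z : ℝ × EuclideanSpace ℝ (Fin m) ↦ s • γ z.1) (p y) :=
    (h.hasFDerivAt_curve_fst hpI).differentiableAt.const_smul s
  have hfp : f =ᶠ[𝓝 y] (fun z ↦ c + repMap γ e a z) ∘ p := by
    filter_upwards [isOpen_interior.mem_nhds hy] with q hq
    exact (hT.sheetCoord_spec h (interior_subset hq)).2.2
  have hνp : ν y =ᶠ[𝓝 y] (fun z : ℝ × EuclideanSpace ℝ (Fin m) ↦ s • γ z.1) ∘ p := hsy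
  have hinj : Function.Injective (mvfderiv 𝓘(ℝ, E) p y) := by
    rw [injective_iff_map_eq_zero]
    intro v hv
    refine (injective_iff_map_eq_zero _).1 (hf.immersion y (mem_univ y)) v ?_
    rw [mvfderiv_prodMk hfd hνd, mvfderiv_congr hfp, mvfderiv_congr hνp,
      mvfderiv_comp_fderiv hFd hpd, mvfderiv_comp_fderiv hγd hpd, hv, map_zero, map_zero]
    rfl
  have hfr : Module.finrank ℝ (TangentSpace 𝓘(ℝ, E) y) =
      Module.finrank ℝ (ℝ × EuclideanSpace ℝ (Fin m)) := by
    change Module.finrank ℝ E = _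
    simp [hE, add_comm]
  have hfin : FiniteDimensional ℝ (TangentSpace 𝓘(ℝ, E) y) := ‹FiniteDimensional ℝ E›
  exact ⟨hinj, (LinearMap.injective_iff_surjective_of_finrank_eq_finrank (f :=
    (mvfderiv 𝓘(ℝ, E) p y : TangentSpace 𝓘(ℝ, E) y →ₗ[ℝ] _)) hfr).1 hinj⟩

theorem IsCurveParameter.contMDiffOn_sheetCoord (hT : IsCurveParameter I γ T O)
    (h : IsRepData I γ e a) (hf : IsFrontal E f univ ν) :
    ContMDiffOn 𝓘(ℝ, E) 𝓘(ℝ, ℝ × EuclideanSpace ℝ (Fin m)) ∞ (sheetCoord f ν γ e a c T)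
      (interior (sheet f ν I γ e a c)) := by
  intro y hy
  obtain ⟨W, hW, hyW, hsm, hprop⟩ := hf.normal.exists_isOpen y
  exact (hT.exists_sign h hW hyW hsm (fun q hq ↦ (hprop q hq).2.2.1)
    hf.smooth hy).1.contMDiffWithinAt

/-- The coordinates of the sheet are local diffeomorphisms. -/
theorem IsCurveParameter.exists_localInverse [FiniteDimensional ℝ E] [CompleteSpace E]
    [IsManifold 𝓘(ℝ, E) ∞ M]
    (hE : Module.finrank ℝ E = m + 1) (hT : IsCurveParameter I γ T O) (h : IsRepData I γ e a)
    (hf : IsFront E f univ ν) {y : M} (hy : y ∈ interior (sheet f ν I γ e a c)) :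
    ∃ Q : OpenPartialHomeomorph M (ℝ × EuclideanSpace ℝ (Fin m)), y ∈ Q.source ∧
      Q.source ⊆ interior (sheet f ν I γ e a c) ∧ EqOn Q (sheetCoord f ν γ e a c T) Q.source ∧
      ContMDiffOn 𝓘(ℝ, ℝ × EuclideanSpace ℝ (Fin m)) 𝓘(ℝ, E) ∞ Q.symm Q.target :=
  exists_openPartialHomeomorph_of_contMDiffOn isOpen_interior hy
    (hT.contMDiffOn_sheetCoord h hf.toIsFrontal) (hT.bijective_mvfderiv hE h hf hy)

/-- At each point of the sheet there is a tangent vector in the direction of the first coordinate.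
-/
theorem IsCurveParameter.exists_tangent [FiniteDimensional ℝ E]
    (hE : Module.finrank ℝ E = m + 1) (hT : IsCurveParameter I γ T O) (h : IsRepData I γ e a)
    (hf : IsFront E f univ ν) {x y : M} (hy : y ∈ interior (sheet f ν I γ e a c))
    {W : Set M} (hW : IsOpen W) (hyW : y ∈ W) (hν : ContMDiffOn 𝓘(ℝ, E) 𝓘(ℝ, V) ∞ (ν x) W)
    (hsign : ∀ q ∈ W, ν q q = ν x q ∨ ν q q = -ν x q) :
    ∃ (v : TangentSpace 𝓘(ℝ, E) y) (s : ℝ), (s = 1 ∨ s = -1) ∧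
      mvfderiv 𝓘(ℝ, E) f y v =
        fderiv ℝ (repMap γ e a) (sheetCoord f ν γ e a c T y) (1, 0) ∧
      mvfderiv 𝓘(ℝ, E) (ν x) y v = s • deriv γ (sheetCoord f ν γ e a c T y).1 := by
  obtain ⟨hpy, s, hs, hsy⟩ := hT.exists_sign h hW hyW hν hsign hf.smooth hy
  obtain ⟨v, hv⟩ := (hT.bijective_mvfderiv hE h hf hy).2 (1, 0)
  set p := sheetCoord f ν γ e a c T with hp
  have hpI : (p y).1 ∈ I := (hT.sheetCoord_spec h (interior_subset hy)).1
  have hpd := hpy.mdifferentiableAt (by simp)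
  have hFd : DifferentiableAt ℝ (fun z ↦ c + repMap γ e a z) (p y) :=
    (((contDiffOn_const.add h.contDiffOn_repMap).contDiffAt
      ((h.isOpen.prod isOpen_univ).mem_nhds ⟨hpI, mem_univ _⟩))).differentiableAt (by simp)
  have hγd := (h.hasFDerivAt_curve_fst hpI).const_smul s
  have hfp : f =ᶠ[𝓝 y] (fun z ↦ c + repMap γ e a z) ∘ p := by
    filter_upwards [isOpen_interior.mem_nhds hy] with q hq
    exact (hT.sheetCoord_spec h (interior_subset hq)).2.2
  have hνp : ν x =ᶠ[𝓝 y] (fun z : ℝ × EuclideanSpace ℝ (Fin m) ↦ s • γ z.1) ∘ p := hsy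
  refine ⟨v, s, hs, ?_, ?_⟩
  · rw [mvfderiv_congr hfp, mvfderiv_comp_fderiv hFd hpd, hv, fderiv_const_add]
  · rw [mvfderiv_congr hνp]
    refine (mvfderiv_comp_fderiv (k := fun z : ℝ × EuclideanSpace ℝ (Fin m) ↦ s • γ z.1)
      hγd.differentiableAt hpd v).trans ?_
    rw [hv]
    refine (congrArg (fun L : (ℝ × EuclideanSpace ℝ (Fin m)) →L[ℝ] V ↦ L (1, 0))
      hγd.fderiv).trans ?_
    simp

end Sheet

/-! ### Rays in the sheet, and their end points -/

section Limits

/-- A function converges along a countably generated filter if it converges, to limits that might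
depend on the sequence, along all sequences. -/
theorem exists_tendsto_of_forall_seq {A B : Type*} [TopologicalSpace B] [T2Space B] {l : Filter A}
    [l.NeBot] [l.IsCountablyGenerated] {g : A → B}
    (hg : ∀ r : ℕ → A, Tendsto r atTop l → ∃ x, Tendsto (g ∘ r) atTop (𝓝 x)) :
    ∃ x, Tendsto g l (𝓝 x) := by
  obtain ⟨r₀, hr₀⟩ := exists_seq_tendsto l
  obtain ⟨x, hx⟩ := hg r₀ hr₀
  refine ⟨x, tendsto_of_seq_tendsto fun r hr ↦ ?_⟩
  obtain ⟨y, hy⟩ := hg r hr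
  have h2 : Tendsto (fun n : ℕ ↦ n / 2) atTop atTop := Nat.tendsto_div_const_atTop (by norm_num)
  -- the two sequences are interleaved
  obtain ⟨z, hz⟩ := hg (fun n ↦ if Even n then r₀ (n / 2) else r (n / 2))
    ((hr₀.comp h2).if' (hr.comp h2))
  have hxz : x = z := by
    refine tendsto_nhds_unique hx ((hz.comp
      (tendsto_atTop_mono (fun n ↦ show n ≤ 2 * n by omega) tendsto_id)).congr fun n ↦ ?_)
    simp
  have hyz : y = z := by
    refine tendsto_nhds_unique hy ((hz.comp
      (tendsto_atTop_mono (fun n ↦ show n ≤ 2 * n + 1 by omega) tendsto_id)).congr fun n ↦ ?_)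
    have h1 : (2 * n + 1) / 2 = n := by omega
    simp [h1]
  rw [hxz, ← hyz]
  exact hy

variable {V : Type*} [NormedAddCommGroup V] [InnerProductSpace ℝ V]
  {E : Type*} [NormedAddCommGroup E] [NormedSpace ℝ E]
  {M : Type*} [TopologicalSpace M] [ChartedSpace E M] {f : M → V} {ν : M → M → V}

/-- If `df` is injective and `dN = 0` at `x`, then near `x` the vectors with bounded image
under `df` have small image under `dN`. -/
theorem eventually_norm_mvfderiv_lt_one [FiniteDimensional ℝ E] [IsManifold 𝓘(ℝ, E) ∞ M] {N : M → V}
    {x : M} {W : Set M} (hW : IsOpen W) (hxW : x ∈ W)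
    (hf : ContMDiffOn 𝓘(ℝ, E) 𝓘(ℝ, V) ∞ f W) (hN : ContMDiffOn 𝓘(ℝ, E) 𝓘(ℝ, V) ∞ N W)
    (hinj : Function.Injective (mvfderiv 𝓘(ℝ, E) f x)) (h0 : ∀ v, mvfderiv 𝓘(ℝ, E) N x v = 0)
    (B : ℝ) : ∀ᶠ y in 𝓝 x, ∀ v, ‖mvfderiv 𝓘(ℝ, E) f y v‖ ≤ B → ‖mvfderiv 𝓘(ℝ, E) N y v‖ < 1 := by
  set φ := chartAt E x
  have hxφ : x ∈ φ.source := mem_chart_source E x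
  have hopen : IsOpen (φ.target ∩ φ.symm ⁻¹' W) := φ.isOpen_inter_preimage_symm hW
  have hmem : ∀ y ∈ φ.source ∩ W, φ y ∈ φ.target ∩ φ.symm ⁻¹' W := fun y hy ↦
    ⟨φ.map_source hy.1, by rw [mem_preimage, φ.left_inv hy.1]; exact hy.2⟩
  -- the derivatives at all points near `x`, read in the chart at `x`
  have key : ∀ k : M → V, ContMDiffOn 𝓘(ℝ, E) 𝓘(ℝ, V) ∞ k W → ∀ y ∈ φ.source ∩ W, ∀ v,
      mvfderiv 𝓘(ℝ, E) k y v = fderiv ℝ (k ∘ φ.symm) (φ y) (mvfderiv 𝓘(ℝ, E) φ y v) := by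
    intro k hk y hy v
    have h1 : k =ᶠ[𝓝 y] (k ∘ φ.symm) ∘ φ := by
      filter_upwards [φ.open_source.mem_nhds hy.1] with z hz
      rw [Function.comp_apply, Function.comp_apply, φ.left_inv hz]
    rw [mvfderiv_congr h1]
    exact mvfderiv_comp_fderiv
      (((contDiffOn_comp_chart_symm hk x).contDiffAt (hopen.mem_nhds (hmem y hy))).differentiableAt
        (by simp))
      (((contMDiffOn_chart (n := ∞)).contMDiffAt (φ.open_source.mem_nhds hy.1)).mdifferentiableAt
        (by simp)) v
  have hcont : ∀ k : M → V, ContMDiffOn 𝓘(ℝ, E) 𝓘(ℝ, V) ∞ k W →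
      ContinuousAt (fun y ↦ fderiv ℝ (k ∘ φ.symm) (φ y)) x := fun k hk ↦
    ContinuousAt.comp (g := fderiv ℝ (k ∘ φ.symm))
      (((contDiffOn_comp_chart_symm hk x).continuousOn_fderiv_of_isOpen hopen
        (by simp)).continuousAt (hopen.mem_nhds (hmem x ⟨hxφ, hxW⟩))) (φ.continuousAt hxφ)
  have hcen : ∀ k : M → V, ContMDiffOn 𝓘(ℝ, E) 𝓘(ℝ, V) ∞ k W →
      mvfderiv 𝓘(ℝ, E) k x = fderiv ℝ (k ∘ φ.symm) (φ x) := fun k hk ↦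
    mvfderiv_eq_fderiv_chart ((hk.contMDiffAt (hW.mem_nhds hxW)).mdifferentiableAt (by simp))
  set L : E →L[ℝ] V := fderiv ℝ (f ∘ φ.symm) (φ x) with hL
  rw [hcen f hf] at hinj
  obtain ⟨K, hK, hLK⟩ := (L : E →ₗ[ℝ] V).exists_antilipschitzWith (LinearMap.ker_eq_bot.2 hinj)
  have hLv : ∀ v, ‖v‖ ≤ K * ‖L v‖ := fun v ↦ by
    have := hLK.le_mul_dist v 0
    rw [dist_zero_right, map_zero, dist_zero_right] at this
    exact this
  have hK' : (0 : ℝ) < K := hK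
  have hN0 : fderiv ℝ (N ∘ φ.symm) (φ x) = 0 := by
    rw [← hcen N hN]
    ext v
    exact h0 v
  have e1 := Metric.tendsto_nhds.1 (hcont f hf).tendsto (1 / (2 * K)) (by positivity)
  have e2 := Metric.tendsto_nhds.1 (hcont N hN).tendsto (1 / (2 * K * (|B| + 1))) (by positivity)
  filter_upwards [e1, e2, φ.open_source.mem_nhds hxφ, hW.mem_nhds hxW] with y h1 h2 h3 h4 v hv
  rw [key f hf y ⟨h3, h4⟩] at hv
  rw [key N hN y ⟨h3, h4⟩]
  set u : E := mvfderiv 𝓘(ℝ, E) φ y v with hu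
  rw [dist_eq_norm] at h1 h2
  rw [hN0, sub_zero] at h2
  have h5 : ‖L u‖ ≤ B + 1 / (2 * K) * ‖u‖ := by
    have h6 : ‖(fderiv ℝ (f ∘ φ.symm) (φ y) - L) u‖ ≤ 1 / (2 * K) * ‖u‖ :=
      (ContinuousLinearMap.le_opNorm _ _).trans (by gcongr)
    have h7 : L u = fderiv ℝ (f ∘ φ.symm) (φ y) u - (fderiv ℝ (f ∘ φ.symm) (φ y) - L) u := by
      simp
    rw [h7]
    exact (norm_sub_le _ _).trans (add_le_add hv h6)
  have h6 : ‖u‖ ≤ 2 * K * |B| := by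
    have h7 := hLv u
    have h8 : K * ‖L u‖ ≤ K * (|B| + 1 / (2 * K) * ‖u‖) := by
      gcongr
      exact h5.trans (by gcongr; exact le_abs_self B)
    have h9 : K * (|B| + 1 / (2 * K) * ‖u‖) = K * |B| + ‖u‖ / 2 := by
      field_simp
    linarith
  calc ‖fderiv ℝ (N ∘ φ.symm) (φ y) u‖ ≤ ‖fderiv ℝ (N ∘ φ.symm) (φ y)‖ * ‖u‖ :=
        ContinuousLinearMap.le_opNorm _ _
    _ ≤ 1 / (2 * K * (|B| + 1)) * (2 * K * |B|) := by gcongr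
    _ < 1 := by
        rw [one_div, inv_mul_eq_div, div_lt_one (by positivity)]
        nlinarith [abs_nonneg B]

theorem ofReal_liftNorm_smul (f : M → V) (ν : M → M → V) (x : M) (b : ℝ)
    (v : TangentSpace 𝓘(ℝ, E) x) :
    ENNReal.ofReal (liftNorm E f ν x (b • v)) = ‖b‖ₑ * ENNReal.ofReal (liftNorm E f ν x v) := by
  rw [← ofReal_norm, ← ENNReal.ofReal_mul (norm_nonneg _)]
  congr 1
  simp only [liftNorm, map_smul, norm_smul, mul_pow, ← mul_add]
  rw [Real.sqrt_mul (by positivity), Real.sqrt_sq (norm_nonneg _)]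

theorem liftDist_comm (f : M → V) (ν : M → M → V) (x y : M) :
    liftDist E f ν x y = liftDist E f ν y x := by
  unfold liftDist
  let _ : ∀ x : M, ENorm (TangentSpace 𝓘(ℝ, E) x) :=
    fun x ↦ ⟨fun v ↦ ENNReal.ofReal (liftNorm E f ν x v)⟩
  have _ : ∀ x : M, ENormSMulClass ℝ (TangentSpace 𝓘(ℝ, E) x) := fun x ↦
    ⟨ofReal_liftNorm_smul f ν x⟩
  exact Manifold.riemannianEDist_comm

variable {m : ℕ} {I : Set ℝ} {γ : ℝ → V} {e : Fin m → ℝ → V} {a : ℝ → ℝ} {c : V} {T : V → ℝ}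
  {O : Set V} [FiniteDimensional ℝ E] [CompleteSpace E] [IsManifold 𝓘(ℝ, E) ∞ M] [CompleteSpace V]

/-- Lifts of the rays `r ↦ (t, r w)` have constant speed `‖∑ j, w_j e_j t‖` for the lift metric. -/
theorem IsCurveParameter.liftDist_le
    (hE : Module.finrank ℝ E = m + 1) (hT : IsCurveParameter I γ T O) (h : IsRepData I γ e a)
    (hf : IsFront E f univ ν) {t : ℝ} {w : EuclideanSpace ℝ (Fin m)} {s : ℝ}
    {g : ℝ → M} (hg : ContinuousOn g (Ico 0 s))
    (hgU : ∀ r ∈ Ico 0 s, g r ∈ interior (sheet f ν I γ e a c))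
    (hgp : ∀ r ∈ Ico 0 s, sheetCoord f ν γ e a c T (g r) = (t, r • w)) {r₁ r₂ : ℝ} (h0 : 0 ≤ r₁)
    (h12 : r₁ ≤ r₂) (h2 : r₂ < s) :
    liftDist E f ν (g r₁) (g r₂) ≤ ENNReal.ofReal ((r₂ - r₁) * ‖∑ j, w j • e j t‖) := by
  have hgQ : ∀ r ∈ Ico 0 s, ContMDiffWithinAt 𝓘(ℝ, ℝ) 𝓘(ℝ, E) ∞ g (Ico 0 s) r := by
    intro r hr
    obtain ⟨Q, hQ, hQU, hQp, hQs⟩ := hT.exists_localInverse hE h hf (hgU r hr)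
    have hQr : Q (g r) = (t, r • w) := by rw [hQp hQ, hgp r hr]
    have h1 : ContMDiffAt 𝓘(ℝ, ℝ) 𝓘(ℝ, ℝ × EuclideanSpace ℝ (Fin m)) ∞
        (fun r : ℝ ↦ (t, r • w)) r :=
      (contDiffAt_const.prodMk (contDiffAt_id.smul contDiffAt_const)).contMDiffAt
    have h2 : ContMDiffAt 𝓘(ℝ, ℝ) 𝓘(ℝ, E) ∞ (Q.symm ∘ fun r : ℝ ↦ (t, r • w)) r := by
      refine ContMDiffAt.comp r (hQs.contMDiffAt (Q.open_target.mem_nhds ?_)) h1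
      rw [← hQr]
      exact Q.map_source hQ
    refine h2.contMDiffWithinAt.congr_of_eventuallyEq_of_mem ?_ hr
    filter_upwards [(hg r hr).eventually (Q.open_source.mem_nhds hQ), self_mem_nhdsWithin]
      with r' h3 h4
    rw [Function.comp_apply, ← hgp r' h4, ← hQp h3, Q.left_inv h3]
  have hsub : Icc r₁ r₂ ⊆ Ico 0 s := fun r hr ↦ ⟨h0.trans hr.1, hr.2.trans_lt h2⟩
  unfold liftDist
  let _ : ∀ x : M, ENorm (TangentSpace 𝓘(ℝ, E) x) :=
    fun x ↦ ⟨fun v ↦ ENNReal.ofReal (liftNorm E f ν x v)⟩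
  have _ : ∀ x : M, ENormSMulClass ℝ (TangentSpace 𝓘(ℝ, E) x) := fun x ↦
    ⟨ofReal_liftNorm_smul f ν x⟩
  have hgs : ContMDiffOn 𝓘(ℝ, ℝ) 𝓘(ℝ, E) 1 g (Icc r₁ r₂) := fun r hr ↦
    ((hgQ r (hsub hr)).mono hsub).of_le (by simp)
  refine (Manifold.riemannianEDist_le_pathELength hgs rfl rfl h12).trans ?_
  rw [Manifold.pathELength_eq_lintegral_mfderiv_Ioo]
  have hspeed : ∀ r ∈ Ioo r₁ r₂, ‖mfderiv 𝓘(ℝ, ℝ) 𝓘(ℝ, E) g r 1‖ₑ =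
      ENNReal.ofReal ‖∑ j, w j • e j t‖ := by
    intro r hr
    have hr' := hsub (Ioo_subset_Icc_self hr)
    have hnh : Ico 0 s ∈ 𝓝 r :=
      mem_of_superset (isOpen_Ioo.mem_nhds hr) (Ioo_subset_Icc_self.trans hsub)
    have hgd : MDifferentiableAt 𝓘(ℝ, ℝ) 𝓘(ℝ, E) g r :=
      ((hgQ r hr').contMDiffAt hnh).mdifferentiableAt (by simp)
    have hfd : MDifferentiableAt 𝓘(ℝ, E) 𝓘(ℝ, V) f (g r) :=
      (hf.smooth.contMDiffAt univ_mem).mdifferentiableAt (by simp)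
    obtain ⟨W, hW, hyW, hsm, hprop⟩ := hf.normal.exists_isOpen (g r)
    have hνd : MDifferentiableAt 𝓘(ℝ, E) 𝓘(ℝ, V) (ν (g r)) (g r) :=
      (hsm.contMDiffAt (hW.mem_nhds hyW)).mdifferentiableAt (by simp)
    obtain ⟨-, σ, hσ, hσy⟩ := hT.exists_sign h hW hyW hsm (fun q hq ↦ (hprop q hq).2.2.1)
      hf.smooth (hgU r hr')
    have e1 : mvfderiv 𝓘(ℝ, E) f (g r) (mfderiv 𝓘(ℝ, ℝ) 𝓘(ℝ, E) g r 1) = ∑ j, w j • e j t := by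
      refine (fderiv_comp_mfderiv hfd hgd (1 : ℝ)).symm.trans ?_
      have e2 : f ∘ g =ᶠ[𝓝 r] fun r ↦
          (c + ∫ τ in (0 : ℝ)..t, a τ • deriv γ τ) + r • ∑ j, w j • e j t := by
        filter_upwards [hnh] with r' hr'
        have e3 := (hT.sheetCoord_spec h (interior_subset (hgU r' hr'))).2.2
        rw [hgp r' hr'] at e3
        rw [Function.comp_apply, e3]
        simp [repMap, Finset.smul_sum, smul_smul, add_assoc]
      have e4 : HasDerivAt (fun r : ℝ ↦
          (c + ∫ τ in (0 : ℝ)..t, a τ • deriv γ τ) + r • ∑ j, w j • e j t)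
          (∑ j, w j • e j t) r := by
        simpa using ((hasDerivAt_id r).smul_const (∑ j, w j • e j t)).const_add
          (c + ∫ τ in (0 : ℝ)..t, a τ • deriv γ τ)
      rw [e2.fderiv_eq, fderiv_apply_one_eq_deriv, e4.deriv]
    have e5 : dGauss E ν (g r) (mfderiv 𝓘(ℝ, ℝ) 𝓘(ℝ, E) g r 1) = 0 := by
      refine (fderiv_comp_mfderiv hνd hgd (1 : ℝ)).symm.trans ?_
      have e2 : ν (g r) ∘ g =ᶠ[𝓝 r] fun _ ↦ σ • γ t := by
        filter_upwards [hnh, ((hg r hr').continuousAt hnh).eventually hσy] with r' hr' h3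
        rw [Function.comp_apply, h3, hgp r' hr']
      rw [e2.fderiv_eq, fderiv_const_apply]
      rfl
    change ENNReal.ofReal (liftNorm E f ν (g r) _) = _
    unfold liftNorm
    rw [e1, e5, norm_zero]
    simp
  rw [MeasureTheory.setLIntegral_congr_fun measurableSet_Ioo hspeed,
    MeasureTheory.setLIntegral_const, Real.volume_Ioo,
    ← ENNReal.ofReal_mul (norm_nonneg _), mul_comm]

/-- In a weakly complete front, lifts of rays converge. -/
theorem IsCurveParameter.exists_tendsto [T2Space M]
    (hE : Module.finrank ℝ E = m + 1) (hT : IsCurveParameter I γ T O) (h : IsRepData I γ e a)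
    (hf : IsFront E f univ ν) (hcomp : IsWeaklyComplete E f ν)
    {t : ℝ} {w : EuclideanSpace ℝ (Fin m)} {s : ℝ} (hs : 0 < s)
    {g : ℝ → M} (hg : ContinuousOn g (Ico 0 s))
    (hgU : ∀ r ∈ Ico 0 s, g r ∈ interior (sheet f ν I γ e a c))
    (hgp : ∀ r ∈ Ico 0 s, sheetCoord f ν γ e a c T (g r) = (t, r • w)) :
    ∃ x, Tendsto g (𝓝[<] s) (𝓝 x) := by
  refine exists_tendsto_of_forall_seq fun r hr ↦ hcomp _ fun ε hε ↦ ?_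
  set L := ‖∑ j, w j • e j t‖ with hL
  have h1 : Tendsto (fun δ : ℝ ↦ ENNReal.ofReal (δ * L)) (𝓝[>] 0) (𝓝 0) := by
    have : Tendsto (fun δ : ℝ ↦ ENNReal.ofReal (δ * L)) (𝓝 0) (𝓝 (ENNReal.ofReal (0 * L))) :=
      ENNReal.tendsto_ofReal (tendsto_id.mul_const L)
    rw [zero_mul, ENNReal.ofReal_zero] at this
    exact this.mono_left nhdsWithin_le_nhds
  obtain ⟨δ, hδε, hδ⟩ := ((h1.eventually (gt_mem_nhds hε)).and self_mem_nhdsWithin).exists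
  replace hδ : 0 < δ := hδ
  have h2 : ∀ᶠ u in 𝓝[<] s, u ∈ Ico 0 s ∧ s - δ < u := by
    filter_upwards [Ico_mem_nhdsLT hs, Ico_mem_nhdsLT (show s - δ / 2 < s by linarith)] with u h3 h4
    exact ⟨h3, by linarith [h4.1]⟩
  obtain ⟨N, hN⟩ := eventually_atTop.1 (hr.eventually h2)
  have hle : ∀ k l, N ≤ k → N ≤ l → r k ≤ r l → liftDist E f ν (g (r k)) (g (r l)) < ε := by
    intro k l hk hl hkl
    refine (hT.liftDist_le hE h hf hg hgU hgp (hN k hk).1.1 hkl (hN l hl).1.2).trans_lt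
      (lt_of_le_of_lt (ENNReal.ofReal_le_ofReal ?_) hδε)
    have h3 : 0 ≤ L := norm_nonneg _
    have h4 := (hN k hk).2
    have h5 := (hN l hl).1.2
    gcongr
    linarith
  refine ⟨N, fun k hk l hl ↦ ?_⟩
  rcases le_total (r k) (r l) with hkl | hkl
  · exact hle k l hk hl hkl
  · rw [liftDist_comm]
    exact hle l k hl hk hkl

end Limits

/-! ### The end points of rays belong to the sheet -/

section Closure

/-- A function with values in a finite set is eventually equal to its limit. -/
theorem eventually_eq_of_tendsto_of_finite {A B : Type*} [TopologicalSpace B] [T1Space B]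
    {l : Filter A} {u : A → B} {y : B} {S : Set B} (hS : S.Finite) (hu : Tendsto u l (𝓝 y))
    (h : ∀ᶠ r in l, u r ∈ S) : ∀ᶠ r in l, u r = y := by
  have h1 : (S \ {y})ᶜ ∈ 𝓝 y := (hS.sdiff.isClosed.isOpen_compl).mem_nhds (by simp)
  filter_upwards [hu h1, h] with r h2 h3
  by_contra h4
  exact h2 ⟨h3, h4⟩

variable {V : Type*} [NormedAddCommGroup V] [InnerProductSpace ℝ V] [CompleteSpace V]
  {E : Type*} [NormedAddCommGroup E] [NormedSpace ℝ E] [FiniteDimensional ℝ E] [CompleteSpace E]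
  {M : Type*} [TopologicalSpace M] [ChartedSpace E M] [IsManifold 𝓘(ℝ, E) ∞ M]
  {f : M → V} {ν : M → M → V} {m : ℕ} {I : Set ℝ} {γ : ℝ → V} {e : Fin m → ℝ → V} {a : ℝ → ℝ}
  {c : V} {T : V → ℝ} {O : Set V}

omit [IsManifold 𝓘(ℝ, E) ∞ M] [CompleteSpace E] in
/-- The sheet is saturated for the local foliation by the level sets of `⟪ν, b⟫`. -/
theorem IsCurveParameter.mem_sheet_of_inner_eq
    (hE : Module.finrank ℝ E = m + 1) (hV : Module.finrank ℝ V = m + 2)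
    (hT : IsCurveParameter I γ T O) (h : IsRepData I γ e a) (hf : IsFront E f univ ν)
    {x : M} {N W : Set M} {J : Set ℝ} {b : V} {g : ℝ → V} {k : ℝ → ℝ} (hN : IsOpen N)
    (hJ : IsOpen J) (hg : ContDiffOn ℝ ∞ g J)
    (hprod : ∀ y ∈ N, (ν y y = ν x y ∨ ν y y = -ν x y) ∧ inner ℝ (ν x y) b ∈ J ∧
        ν x y = g (inner ℝ (ν x y) b) ∧ inner ℝ (f y) (ν x y) = k (inner ℝ (ν x y) b) ∧
        inner ℝ (f y) (deriv g (inner ℝ (ν x y) b)) = deriv k (inner ℝ (ν x y) b) ∧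
        map (fun z ↦ (inner ℝ (ν x z) b : ℝ)) (𝓝 y) = 𝓝 (inner ℝ (ν x y) b))
    (hW : IsOpen W) (hν : ContMDiffOn 𝓘(ℝ, E) 𝓘(ℝ, V) ∞ (ν x) W) {y z : M} (hy : y ∈ N)
    (hz : z ∈ N ∩ W) (hzs : z ∈ interior (sheet f ν I γ e a c))
    (hyz : (inner ℝ (ν x y) b : ℝ) = inner ℝ (ν x z) b) : y ∈ sheet f ν I γ e a c := by
  set τ : M → ℝ := fun y ↦ inner ℝ (ν x y) b with hτ
  obtain ⟨hy1, hy2, hy3, hy4, hy5, -⟩ := hprod y hy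
  obtain ⟨hz1, hz2, hz3, hz4, hz5, -⟩ := hprod z hz.1
  rw [hyz] at hy3 hy4 hy5
  obtain ⟨hPI, hPν, hPf⟩ := hT.sheetCoord_spec h (interior_subset hzs)
  obtain ⟨v, s, hs, -, hv⟩ := hT.exists_tangent hE h hf hzs (hN.inter hW) hz
    (hν.mono inter_subset_right) fun q hq ↦ (hprod q hq.1).1
  set P := sheetCoord f ν γ e a c T z with hP
  have hyz' : ν x y = ν x z := hy3.trans hz3.symm
  have hσ : ∃ σ : ℝ, γ P.1 = σ • ν x z ∧ (ν x z = γ P.1 ∨ ν x z = -γ P.1) := by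
    rcases hz1 with h1 | h1 <;> rcases hPν with h2 | h2
    · exact ⟨1, by rw [one_smul, ← h1, h2], Or.inl (h1.symm.trans h2)⟩
    · exact ⟨-1, by rw [neg_one_smul, ← h1, h2, neg_neg], Or.inr (h1.symm.trans h2)⟩
    · exact ⟨-1, by rw [neg_one_smul, ← h1, h2], Or.inr (by rw [← h2, h1, neg_neg])⟩
    · exact ⟨1, by rw [one_smul]; exact neg_injective (h2.symm.trans h1),
        Or.inl (neg_injective (h1.symm.trans h2))⟩
  obtain ⟨σ, hσ, hσ'⟩ := hσ
  have hlam : ∃ l : ℝ, deriv γ P.1 = l • deriv g (τ z) := by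
    have hτd : MDifferentiableAt 𝓘(ℝ, E) 𝓘(ℝ, ℝ) τ z := by
      have : ContMDiffOn 𝓘(ℝ, E) 𝓘(ℝ, ℝ) ∞ τ W :=
        (contDiff_id.inner ℝ (contDiff_const (c := b))).contMDiff.comp_contMDiffOn hν
      exact (this.contMDiffAt (hW.mem_nhds hz.2)).mdifferentiableAt (by simp)
    have h1 : ν x =ᶠ[𝓝 z] g ∘ τ := by
      filter_upwards [hN.mem_nhds hz.1] with q hq
      exact (hprod q hq).2.2.1
    have hgd : HasDerivAt g (deriv g (τ z)) (τ z) := hasDerivAt_of_contDiffOn hJ hg hz2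
    rw [mvfderiv_congr h1, mvfderiv_comp_fderiv hgd.differentiableAt hτd,
      hgd.hasFDerivAt.fderiv] at hv
    have hv' : (mvfderiv 𝓘(ℝ, E) τ z v : ℝ) • deriv g (τ z) = s • deriv γ P.1 := hv
    have hss : s * s = 1 := by rcases hs with rfl | rfl <;> norm_num
    refine ⟨s * mvfderiv 𝓘(ℝ, E) τ z v, ?_⟩
    rw [mul_smul, hv', smul_smul, hss, one_smul]
  obtain ⟨l, hl⟩ := hlam
  refine h.mem_sheet hV (z := P) hPI ?_ ?_ ?_
  · rcases hy1 with h1 | h1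
    · rw [h1, hyz']
      exact hσ'
    · rw [h1, hyz']
      rcases hσ' with h2 | h2
      · exact Or.inr (by rw [h2])
      · exact Or.inl (by rw [h2, neg_neg])
  · rw [← hPf, hσ, real_inner_smul_right, inner_sub_left, hz4, ← hyz', hy4, hyz, sub_self, mul_zero]
  · rw [← hPf, hl, real_inner_smul_right, inner_sub_left, hz5, hy5, sub_self, mul_zero]

omit [CompleteSpace E] in
/-- The differential of the unit normal does not vanish at the end points of lifts of rays: along a
ray, the vectors in the direction of the first coordinate have unit image under `dν` and
bounded image under `df`. -/
theorem IsCurveParameter.exists_dGauss_ne_zero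
    (hE : Module.finrank ℝ E = m + 1) (hT : IsCurveParameter I γ T O) (h : IsRepData I γ e a)
    (hf : IsFront E f univ ν) {t : ℝ} (ht : t ∈ I) {w : EuclideanSpace ℝ (Fin m)} {s : ℝ}
    (hs : s ∈ Ioc (0 : ℝ) 1) {g : ℝ → M} {x : M}
    (hgU : ∀ r ∈ Ico 0 s, g r ∈ interior (sheet f ν I γ e a c))
    (hgp : ∀ r ∈ Ico 0 s, sheetCoord f ν γ e a c T (g r) = (t, r • w))
    (hx : Tendsto g (𝓝[<] s) (𝓝 x)) : ∃ u, dGauss E ν x u ≠ 0 := by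
  by_contra! h0
  obtain ⟨W, hW, hxW, hsm, hprop⟩ := hf.normal.exists_isOpen x
  have hfd : MDifferentiableAt 𝓘(ℝ, E) 𝓘(ℝ, V) f x :=
    (hf.smooth.contMDiffAt univ_mem).mdifferentiableAt (by simp)
  have hνd : MDifferentiableAt 𝓘(ℝ, E) 𝓘(ℝ, V) (ν x) x :=
    (hsm.contMDiffAt (hW.mem_nhds hxW)).mdifferentiableAt (by simp)
  have hinj : Function.Injective (mvfderiv 𝓘(ℝ, E) f x) := by
    rw [injective_iff_map_eq_zero]
    intro v hv
    refine (injective_iff_map_eq_zero _).1 (hf.immersion x (mem_univ x)) v ?_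
    rw [mvfderiv_prodMk hfd hνd, hv]
    exact Prod.ext rfl (h0 v)
  have hev := eventually_norm_mvfderiv_lt_one hW hxW (hf.smooth.mono (subset_univ W)) hsm hinj h0
    (‖a t • deriv γ t‖ + ∑ j, ‖w j • deriv (e j) t‖)
  obtain ⟨r, ⟨hr1, hr2⟩, hr3⟩ := ((hx.eventually (hev.and (hW.mem_nhds hxW))).and
    (Ico_mem_nhdsLT hs.1)).exists
  obtain ⟨v, σ, hσ, hv1, hv2⟩ := hT.exists_tangent hE h hf (hgU r hr3) hW hr2 hsm
    fun q hq ↦ (hprop q hq).2.2.1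
  rw [hgp r hr3] at hv1 hv2
  have h1 := hr1 v (by
    rw [hv1, h.fderiv_repMap ht]
    simp only [one_smul, PiLp.zero_apply, zero_smul, Finset.sum_const_zero, add_zero]
    refine (norm_add_le _ _).trans (add_le_add le_rfl ((norm_sum_le _ _).trans
      (Finset.sum_le_sum fun j _ ↦ ?_)))
    rw [PiLp.smul_apply, smul_eq_mul, mul_smul, norm_smul, Real.norm_eq_abs, abs_of_nonneg hr3.1]
    exact mul_le_of_le_one_left (norm_nonneg _) (hr3.2.le.trans hs.2))
  rw [hv2, norm_smul, h.arcLength t ht] at h1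
  rcases hσ with rfl | rfl <;> norm_num at h1

/-- The end points of lifts of rays belong to the interior of the sheet. -/
theorem IsCurveParameter.mem_interior_sheet
    (hE : Module.finrank ℝ E = m + 1) (hV : Module.finrank ℝ V = m + 2)
    (hT : IsCurveParameter I γ T O) (h : IsRepData I γ e a) (hf : IsFlatFront E f univ ν)
    {t : ℝ} (ht : t ∈ I) {w : EuclideanSpace ℝ (Fin m)} {s : ℝ}
    (hs : s ∈ Ioc (0 : ℝ) 1) {g : ℝ → M} {x : M}
    (hgU : ∀ r ∈ Ico 0 s, g r ∈ interior (sheet f ν I γ e a c))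
    (hgp : ∀ r ∈ Ico 0 s, sheetCoord f ν γ e a c T (g r) = (t, r • w))
    (hx : Tendsto g (𝓝[<] s) (𝓝 x)) : x ∈ interior (sheet f ν I γ e a c) := by
  obtain ⟨u, hu⟩ := hT.exists_dGauss_ne_zero hE h hf.toIsFront ht hs hgU hgp hx
  obtain ⟨N, J, b, n, k, hN, hxN, hJ, hn, hk, hn1, hnb, hprod⟩ :=
    exists_local_product hf.toIsFrontal hf.flat hu
  obtain ⟨W, hW, hxW, hsm, hprop⟩ := hf.normal.exists_isOpen x
  have hNW : N ∩ W ∈ 𝓝 x := (hN.inter hW).mem_nhds ⟨hxN, hxW⟩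
  have hνx : ContinuousAt (ν x) x := hsm.continuousOn.continuousAt (hW.mem_nhds hxW)
  -- the unit normal is constant along the ray, so the ray reaches the leaf through `x`
  have h1 : ∀ᶠ r in 𝓝[<] s, ν x (g r) ∈ ({γ t, -γ t} : Set V) := by
    filter_upwards [hx hNW, Ico_mem_nhdsLT hs.1] with r hr1 hr2
    have h3 := (hT.sheetCoord_spec h (interior_subset (hgU r hr2))).2.1
    rw [hgp r hr2] at h3
    rcases (hprod _ hr1.1).1 with h2 | h2 <;> rcases h3 with h3 | h3
    · exact Or.inl (h2.symm.trans h3)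
    · exact Or.inr (h2.symm.trans h3)
    · exact Or.inr (by rw [mem_singleton_iff, ← h3, h2, neg_neg])
    · exact Or.inl (neg_injective (h2.symm.trans h3))
  obtain ⟨r, ⟨hr1, hr2⟩, hr3⟩ := ((eventually_eq_of_tendsto_of_finite (Set.toFinite _)
    (hνx.tendsto.comp hx) h1).and (hx hNW) |>.and (Ico_mem_nhdsLT hs.1)).exists
  replace hr1 : ν x (g r) = ν x x := hr1
  have h2 : ∀ᶠ q in map (fun z ↦ (inner ℝ (ν x z) b : ℝ)) (𝓝 (g r)),
      ∃ z ∈ (N ∩ W) ∩ interior (sheet f ν I γ e a c), (inner ℝ (ν x z) b : ℝ) = q := by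
    rw [eventually_map]
    filter_upwards [((hN.inter hW).inter isOpen_interior).mem_nhds ⟨hr2, hgU r hr3⟩] with z hz
    exact ⟨z, hz, rfl⟩
  rw [(hprod _ hr2.1).2.2.2.2.2, hr1] at h2
  rw [mem_interior_iff_mem_nhds]
  have h3 : Tendsto (fun z ↦ (inner ℝ (ν x z) b : ℝ)) (𝓝 x) (𝓝 (inner ℝ (ν x x) b)) :=
    hνx.inner continuousAt_const
  filter_upwards [h3.eventually h2, hN.mem_nhds hxN] with y ⟨z, hz, hzy⟩ hyN
  exact hT.mem_sheet_of_inner_eq hE hV h hf.toIsFront hN hJ hn hprod hW hsm hyN hz.1 hz.2 hzy.symm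

end Closure

/-! ### The representation near a non-umbilic point -/

section Representation

theorem IsRepData.mono {V : Type*} [NormedAddCommGroup V] [InnerProductSpace ℝ V] {m : ℕ}
    {I I' : Set ℝ} {γ : ℝ → V} {e : Fin m → ℝ → V} {a : ℝ → ℝ} (h : IsRepData I γ e a)
    (hI' : IsOpen I') (hI'c : I'.OrdConnected) (h0 : (0 : ℝ) ∈ I') (hs : I' ⊆ I) :
    IsRepData I' γ e a where
  isOpen := hI'
  ordConnected := hI'c
  zero_mem := h0
  smooth_curve := h.smooth_curve.mono hs
  sphere t ht := h.sphere t (hs ht)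
  arcLength t ht := h.arcLength t (hs ht)
  smooth_frame j := (h.smooth_frame j).mono hs
  orthonormal t ht := h.orthonormal t (hs ht)
  tangent_sphere t ht := h.tangent_sphere t (hs ht)
  perp t ht := h.perp t (hs ht)
  smooth_fun := h.smooth_fun.mono hs

variable {V : Type*} [NormedAddCommGroup V] [InnerProductSpace ℝ V] [CompleteSpace V]
  {E : Type*} [NormedAddCommGroup E] [NormedSpace ℝ E] [FiniteDimensional ℝ E] [CompleteSpace E]
  {M : Type*} [TopologicalSpace M] [ChartedSpace E M] [IsManifold 𝓘(ℝ, E) ∞ M]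
  {f : M → V} {ν : M → M → V} {m : ℕ}

/-- Near a point where `dν ≠ 0`, a flat frontal is a sheet: its contact elements belong to the
surface parametrized by `f q + repMap γ e a`, for the curve `γ` of its unit normals. -/
theorem exists_mem_interior_sheet (hV : Module.finrank ℝ V = m + 2)
    (hf : IsFrontal E f univ ν) (hflat : IsFlat E univ ν) {q : M}
    {u : TangentSpace 𝓘(ℝ, E) q} (hu : dGauss E ν q u ≠ 0) :
    ∃ (I : Set ℝ) (γ : ℝ → V) (e : Fin m → ℝ → V) (a : ℝ → ℝ) (T : V → ℝ) (O : Set V),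
      IsRepData I γ e a ∧ IsCurveParameter I γ T O ∧
      q ∈ interior (sheet f ν I γ e a (f q)) ∧ sheetCoord f ν γ e a (f q) T q = (0, 0) := by
  obtain ⟨N, J, b, g, k, hN, hqN, hJ, hg, hk, hg1, hgb, hprod⟩ := exists_local_product hf hflat hu
  obtain ⟨-, hs₀, hq3, hq4, hq5, hq6⟩ := hprod q hqN
  set s₀ : ℝ := inner ℝ (ν q q) b with hs₀_def
  -- since `⟪g s, b⟫ = s`
  have hg' : ∀ s ∈ J, deriv g s ≠ 0 := by
    intro s hs h0
    have h1 := (hasDerivAt_of_contDiffOn hJ hg hs).inner ℝ (hasDerivAt_const s b)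
    have h2 : (fun s ↦ (inner ℝ (g s) b : ℝ)) =ᶠ[𝓝 s] id := by
      filter_upwards [hJ.mem_nhds hs] using hgb
    have h3 := h1.unique ((hasDerivAt_id s).congr_of_eventuallyEq h2)
    simp [h0] at h3
  obtain ⟨R, hs₀R, hRJ, hR0, hRs, hRd⟩ := exists_arcLength hJ hs₀ hg hg'
  have h0R : (0 : ℝ) ∈ R.target := by
    rw [← hR0]
    exact R.map_source hs₀R
  have hR0' : R.symm 0 = s₀ := by rw [← hR0, R.left_inv hs₀R]
  have hmaps : MapsTo R.symm R.target J := fun t ht ↦ hRJ (R.map_target ht)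
  -- `R` is the arc length of `g`, measured from the value `s₀` at `q`
  set γ : ℝ → V := g ∘ R.symm with hγ
  set η : ℝ → ℝ := k ∘ R.symm with hη
  have hγs : ContDiffOn ℝ ∞ γ R.target := hg.comp hRs hmaps
  have hηs : ContDiffOn ℝ ∞ η R.target := hk.comp hRs hmaps
  have hγd : ∀ t ∈ R.target, deriv γ t = ‖deriv g (R.symm t)‖⁻¹ • deriv g (R.symm t) :=
    fun t ht ↦ (hRd t ht).2.deriv
  have hηd : ∀ t ∈ R.target, deriv η t = deriv k (R.symm t) * ‖deriv g (R.symm t)‖⁻¹ :=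
    fun t ht ↦ ((hasDerivAt_of_contDiffOn hJ hk (hmaps ht)).comp t (hRd t ht).1).deriv
  have hγ1 : ∀ t ∈ R.target, ‖deriv γ t‖ = 1 := fun t ht ↦ by
    rw [hγd t ht, norm_smul, norm_inv, norm_norm,
      inv_mul_cancel₀ (norm_ne_zero_iff.2 (hg' _ (hmaps ht)))]
  obtain ⟨ε₁, hε₁, hsub₁, e, a, h₁, hA⟩ := exists_isRepData hV R.open_target h0R hγs
    (fun t ht ↦ hg1 _ (hmaps ht)) hγ1 hηs (y₀ := f q)
    (by rw [hγ, hη, Function.comp_apply, Function.comp_apply, hR0', ← hq3, hq4])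
    (by rw [hγd 0 h0R, hηd 0 h0R, hR0', real_inner_smul_right, hq5, mul_comm])
  obtain ⟨ε, hε, hsub, T, O, hO, hTs, hOn, hTn, hTγ⟩ := h₁.exists_leftInverse
  have h : IsRepData (Ioo (-ε) ε) γ e a :=
    h₁.mono isOpen_Ioo ordConnected_Ioo ⟨by linarith, hε⟩ hsub
  have hT : IsCurveParameter (Ioo (-ε) ε) γ T O :=
    ⟨hO, hTs, hOn, hTn, fun t ht ↦ (hTγ t ht).1, fun t ht ↦ (hTγ t ht).2⟩
  refine ⟨Ioo (-ε) ε, γ, e, a, T, O, h, hT, ?_, ?_⟩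
  · rw [mem_interior_iff_mem_nhds]
    have hmem : R.source ∩ R ⁻¹' Ioo (-ε) ε ∈ 𝓝 s₀ :=
      (R.isOpen_inter_preimage isOpen_Ioo).mem_nhds
        ⟨hs₀R, by rw [mem_preimage, hR0]; exact h.zero_mem⟩
    have hcont : Tendsto (fun z ↦ (inner ℝ (ν q z) b : ℝ)) (𝓝 q) (𝓝 s₀) := hq6.le
    filter_upwards [hN.mem_nhds hqN, hcont hmem] with y hyN hyR
    obtain ⟨hy1, -, hy3, hy4, hy5, -⟩ := hprod y hyN
    set s : ℝ := inner ℝ (ν q y) b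
    have hsR : R.symm (R s) = s := R.left_inv hyR.1
    have hRs' : R s ∈ R.target := R.map_source hyR.1
    have hγy : γ (R s) = ν q y := by rw [hγ, Function.comp_apply, hsR, hy3]
    obtain ⟨hA0, hA1⟩ := hA (R s) (hsub hyR.2)
    have hrep : repMap γ e a (R s, 0) = ∫ τ in (0 : ℝ)..(R s), a τ • deriv γ τ := by
      simp [repMap]
    refine h.mem_sheet hV (z := (R s, 0)) hyR.2 ?_ ?_ ?_
    · rw [hγy]
      exact hy1
    · rw [inner_sub_left, hrep, hA0, hγy, hy4, hη, Function.comp_apply, hsR, sub_self]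
    · rw [inner_sub_left, hrep, hA1, hγd _ hRs', hηd _ hRs', hsR, real_inner_smul_right, hy5,
        mul_comm, sub_self]
  · have hγ0 : γ 0 = ν q q := by rw [hγ, Function.comp_apply, hR0', ← hq3]
    have hf0 : f q = f q + repMap γ e a ((0, 0) : ℝ × EuclideanSpace ℝ (Fin m)) := by
      simp [repMap]
    have := hT.contactCoord_repMap (c := f q) h
      (z := ((0, 0) : ℝ × EuclideanSpace ℝ (Fin m))) h.zero_mem
    rw [← hf0, hγ0] at this
    exact this

/-- The representation of a weakly complete flat front near a point with `dν ≠ 0`. -/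
theorem exists_openPartialHomeomorph_repMap [T2Space M]
    (hE : Module.finrank ℝ E = m + 1) (hV : Module.finrank ℝ V = m + 2)
    (hf : IsFlatFront E f univ ν) (hcomp : IsWeaklyComplete E f ν) {q : M}
    {u : TangentSpace 𝓘(ℝ, E) q} (hu : dGauss E ν q u ≠ 0) :
    ∃ (I : Set ℝ) (γ : ℝ → V) (e : Fin m → ℝ → V) (a : ℝ → ℝ) (c : V)
      (Φ : OpenPartialHomeomorph (ℝ × EuclideanSpace ℝ (Fin m)) M),
      IsRepData I γ e a ∧ Φ.source = I ×ˢ univ ∧ q ∈ Φ.target ∧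
      ContMDiffOn 𝓘(ℝ, ℝ × EuclideanSpace ℝ (Fin m)) 𝓘(ℝ, E) ∞ Φ Φ.source ∧
      ContMDiffOn 𝓘(ℝ, E) 𝓘(ℝ, ℝ × EuclideanSpace ℝ (Fin m)) ∞ Φ.symm Φ.target ∧
      ∀ x ∈ Φ.source, f (Φ x) = c + repMap γ e a x := by
  obtain ⟨I, γ, e, a, T, O, h, hT, hqU, hpq⟩ :=
    exists_mem_interior_sheet hV hf.toIsFrontal hf.flat hu
  set U := interior (sheet f ν I γ e a (f q)) with hU
  set p := sheetCoord f ν γ e a (f q) T with hp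
  have hloc : ∀ y ∈ U, ∃ Q : OpenPartialHomeomorph M (ℝ × EuclideanSpace ℝ (Fin m)),
      y ∈ Q.source ∧ Q.source ⊆ U ∧ EqOn Q p Q.source ∧
      ContMDiffOn 𝓘(ℝ, ℝ × EuclideanSpace ℝ (Fin m)) 𝓘(ℝ, E) ∞ Q.symm Q.target :=
    fun y hy ↦ hT.exists_localInverse hE h hf.toIsFront hy
  have hpU : IsLocalHomeomorph (p ∘ ((↑) : U → M)) := by
    have h1 : IsLocalHomeomorphOn p U := IsLocalHomeomorphOn.mk p U fun y hy ↦ by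
      obtain ⟨Q, hyQ, -, hQp, -⟩ := hloc y hy
      exact ⟨Q, hyQ, hQp.symm⟩
    rw [isLocalHomeomorph_iff_isLocalHomeomorphOn_univ]
    exact h1.comp (isOpen_interior.isOpenEmbedding_subtypeVal.isLocalHomeomorph.isLocalHomeomorphOn)
      fun y _ ↦ y.2
  -- the section is started along the curve `w = 0`, through `q`
  obtain ⟨Q, hqQ, hQU, hQp, -⟩ := hloc q hqU
  have hQ0 : Q q = (0, 0) := by rw [hQp hqQ, hpq]
  have hcurve : Continuous fun t : ℝ ↦ ((t, 0) : ℝ × EuclideanSpace ℝ (Fin m)) := by fun_prop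
  obtain ⟨ε, hε, hεI⟩ := exists_Ioo_neg_subset (h.isOpen.inter (Q.open_target.preimage hcurve))
    ⟨h.zero_mem, by rw [mem_preimage, ← hQ0]; exact Q.map_source hqQ⟩
  have hne : Nonempty U := ⟨⟨q, hqU⟩⟩
  have hσ : ∀ t ∈ Ioo (-ε) ε, ∃ x : U, (x : M) = Q.symm (t, 0) := fun t ht ↦
    ⟨⟨_, hQU (Q.map_target (hεI ht).2)⟩, rfl⟩
  choose! σ hσ using hσ
  have hσc : ContinuousOn σ (Ioo (-ε) ε) := by
    rw [Topology.IsInducing.subtypeVal.continuousOn_iff]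
    exact (Q.continuousOn_symm.comp hcurve.continuousOn fun t ht ↦ (hεI ht).2).congr hσ
  have hσp : ∀ t ∈ Ioo (-ε) ε, (p ∘ ((↑) : U → M)) (σ t) = (t, 0) := fun t ht ↦ by
    rw [Function.comp_apply, hσ t ht, ← hQp (Q.map_target (hεI ht).2), Q.right_inv (hεI ht).2]
  obtain ⟨Ψ, hΨc, hΨp, hΨ0⟩ := exists_section hpU hσc hσp
    fun t ht w s hs g hg hgp _ ↦ by
      have hgM : ContinuousOn (fun r ↦ (g r : M)) (Ico 0 s) :=
        continuous_subtype_val.comp_continuousOn hg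
      obtain ⟨x, hx⟩ := hT.exists_tendsto hE h hf.toIsFront hcomp hs.1 hgM
        (fun r _ ↦ (g r).2) hgp
      exact ⟨⟨x, hT.mem_interior_sheet hE hV h hf (hεI ht).1 hs (fun r _ ↦ (g r).2) hgp hx⟩,
        tendsto_subtype_rng.2 hx⟩
  set S : Set (ℝ × EuclideanSpace ℝ (Fin m)) := Ioo (-ε) ε ×ˢ univ with hS
  have hSo : IsOpen S := isOpen_Ioo.prod isOpen_univ
  set Φ : ℝ × EuclideanSpace ℝ (Fin m) → M := fun x ↦ (Ψ x : M) with hΦ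
  have hΦc : ContinuousOn Φ S := continuous_subtype_val.comp_continuousOn hΨc
  have hΦp : ∀ x ∈ S, p (Φ x) = x := hΨp
  -- near each point the section is an inverse branch of `p`
  have hΦQ : ∀ x ∈ S, ∃ Q : OpenPartialHomeomorph M (ℝ × EuclideanSpace ℝ (Fin m)),
      Φ x ∈ Q.source ∧ EqOn Q p Q.source ∧ x ∈ Q.target ∧ (∀ᶠ x' in 𝓝 x, Φ x' = Q.symm x') ∧
      ContMDiffOn 𝓘(ℝ, ℝ × EuclideanSpace ℝ (Fin m)) 𝓘(ℝ, E) ∞ Q.symm Q.target := by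
    intro x hx
    obtain ⟨Q, hxQ, -, hQp, hQs⟩ := hloc (Φ x) (Ψ x).2
    refine ⟨Q, hxQ, hQp, ?_, ?_, hQs⟩
    · rw [← hΦp x hx, ← hQp hxQ]
      exact Q.map_source hxQ
    · filter_upwards [hSo.mem_nhds hx,
        (hΦc.continuousAt (hSo.mem_nhds hx)).eventually (Q.open_source.mem_nhds hxQ)] with x' h1 h2
      rw [← hΦp x' h1, ← hQp h2, Q.left_inv h2, hQp h2, hΦp x' h1]
  have hΦs : ContMDiffOn 𝓘(ℝ, ℝ × EuclideanSpace ℝ (Fin m)) 𝓘(ℝ, E) ∞ Φ S := by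
    intro x hx
    obtain ⟨Q, -, -, hxQ, hΦQ, hQs⟩ := hΦQ x hx
    exact ((hQs.contMDiffAt (Q.open_target.mem_nhds hxQ)).congr_of_eventuallyEq
      hΦQ).contMDiffWithinAt
  have hps : ContMDiffOn 𝓘(ℝ, E) 𝓘(ℝ, ℝ × EuclideanSpace ℝ (Fin m)) ∞ p (Φ '' S) :=
    (hT.contMDiffOn_sheetCoord h hf.toIsFrontal).mono (by rintro _ ⟨x, -, rfl⟩; exact (Ψ x).2)
  have hopen : IsOpen (Φ '' S) := by
    rw [isOpen_iff_mem_nhds]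
    rintro _ ⟨x, hx, rfl⟩
    obtain ⟨Q, hΦx, hQp, -, hΦQ, -⟩ := hΦQ x hx
    have hQx : Q (Φ x) = x := by rw [hQp hΦx, hΦp x hx]
    have hc := Q.continuousAt hΦx
    rw [ContinuousAt, hQx] at hc
    filter_upwards [Q.open_source.mem_nhds hΦx, hc.eventually hΦQ,
      hc.eventually (hSo.mem_nhds hx)] with y h1 h2 h3
    exact ⟨Q y, h3, by rw [h2, Q.left_inv h1]⟩
  refine ⟨Ioo (-ε) ε, γ, e, a, f q,
    { toFun := Φ
      invFun := p
      source := S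
      target := Φ '' S
      map_source' := fun x hx ↦ mem_image_of_mem Φ hx
      map_target' := by
        rintro _ ⟨x, hx, rfl⟩
        rwa [hΦp x hx]
      left_inv' := hΦp
      right_inv' := by
        rintro _ ⟨x, hx, rfl⟩
        rw [hΦp x hx]
      open_source := hSo
      open_target := hopen
      continuousOn_toFun := hΦc
      continuousOn_invFun := hps.continuousOn },
    h.mono isOpen_Ioo ordConnected_Ioo ⟨by linarith, hε⟩ fun t ht ↦ (hεI ht).1, rfl, ?_, hΦs, hps,
    fun x hx ↦ ?_⟩
  · have h0 : (0 : ℝ) ∈ Ioo (-ε) ε := ⟨by linarith, hε⟩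
    refine ⟨(0, 0), ⟨h0, mem_univ _⟩, ?_⟩
    change (Ψ (0, 0) : M) = q
    rw [hΨ0 0 h0, hσ 0 h0, ← hQ0, Q.left_inv hqQ]
  · have h1 : f (Φ x) = f q + repMap γ e a (p (Φ x)) :=
      (hT.sheetCoord_spec h (interior_subset (Ψ x).2)).2.2
    rw [hΦp x hx] at h1
    exact h1

omit [FiniteDimensional ℝ E] [CompleteSpace E] [IsManifold 𝓘(ℝ, E) ∞ M] [CompleteSpace V] in
theorem exists_dGauss_ne_zero_of_not_isUmbilic {q : M} (hq : ¬ IsUmbilic E f ν q) :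
    ∃ u, dGauss E ν q u ≠ 0 := by
  by_contra! h0
  refine hq ⟨0, 1, by simp, ?_⟩
  ext v
  simp [h0]

end Representation

end FlatFront

theorem mainTheorem2 (n : ℕ) (hn : 2 ≤ n) :
    (∀ (M : Type*) [TopologicalSpace M] [T2Space M] [SecondCountableTopology M]
        [ConnectedSpace M] [ChartedSpace (EuclideanSpace ℝ (Fin n)) M] [IsManifold (𝓡 n) ∞ M]
        (f : M → EuclideanSpace ℝ (Fin (n + 1))) (ν : M → M → EuclideanSpace ℝ (Fin (n + 1))),
        FlatFront.IsFlatFront (EuclideanSpace ℝ (Fin n)) f univ ν →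
        FlatFront.IsWeaklyComplete (EuclideanSpace ℝ (Fin n)) f ν →
        (¬ ∀ p, FlatFront.IsUmbilic (EuclideanSpace ℝ (Fin n)) f ν p) →
        ∀ q : M, ¬ FlatFront.IsUmbilic (EuclideanSpace ℝ (Fin n)) f ν q →
        ∃ (I : Set ℝ) (γ : ℝ → EuclideanSpace ℝ (Fin (n + 1)))
          (e : Fin (n - 1) → ℝ → EuclideanSpace ℝ (Fin (n + 1))) (a : ℝ → ℝ)
          (c : EuclideanSpace ℝ (Fin (n + 1)))
          (Φ : OpenPartialHomeomorph (ℝ × EuclideanSpace ℝ (Fin (n - 1))) M),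
          FlatFront.IsRepData I γ e a ∧
          Φ.source = I ×ˢ univ ∧ q ∈ Φ.target ∧
          ContMDiffOn 𝓘(ℝ, ℝ × EuclideanSpace ℝ (Fin (n - 1))) (𝓡 n) ∞ Φ Φ.source ∧
          ContMDiffOn (𝓡 n) 𝓘(ℝ, ℝ × EuclideanSpace ℝ (Fin (n - 1))) ∞ Φ.symm Φ.target ∧
          ∀ x ∈ Φ.source, f (Φ x) = c + FlatFront.repMap γ e a x) ∧
    (∀ (I : Set ℝ) (γ : ℝ → EuclideanSpace ℝ (Fin (n + 1)))
        (e : Fin (n - 1) → ℝ → EuclideanSpace ℝ (Fin (n + 1))) (a : ℝ → ℝ)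
        (c : EuclideanSpace ℝ (Fin (n + 1))),
        FlatFront.IsRepData I γ e a →
        ∃ ν : (ℝ × EuclideanSpace ℝ (Fin (n - 1))) → (ℝ × EuclideanSpace ℝ (Fin (n - 1))) →
            EuclideanSpace ℝ (Fin (n + 1)),
          FlatFront.IsFlatFront (ℝ × EuclideanSpace ℝ (Fin (n - 1))) (fun x ↦ c + FlatFront.repMap γ e a x) (I ×ˢ univ) ν ∧
          ∀ x ∈ I ×ˢ (univ : Set (EuclideanSpace ℝ (Fin (n - 1)))),
            ¬ FlatFront.IsUmbilic (ℝ × EuclideanSpace ℝ (Fin (n - 1))) (fun x ↦ c + FlatFront.repMap γ e a x) ν x) := by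
  constructor
  · intro M _ _ _ _ _ _ f ν hf hcomp _ q hq
    obtain ⟨u, hu⟩ := FlatFront.exists_dGauss_ne_zero_of_not_isUmbilic hq
    exact FlatFront.exists_openPartialHomeomorph_repMap (by simp; omega) (by simp; omega) hf hcomp
      hu
  · intro I γ e a c h
    exact ⟨fun _ x ↦ γ x.1, h.isFlatFront c, fun x hx ↦ h.not_isUmbilic (by omega) c hx.1⟩
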